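/- Let $D,\gamma,\nu,\delta,\epsilon,\beta,\mu,\alpha\in\mathbb R$ with $\beta\ge 0$ and $(D,\beta)\neq(0,0)$. Let $e^{-i\alpha t}\psi(x)$ be a (classical, $\psi\in C^2(\mathbb R,\mathbb C)$) stationary solution of the cubic-quintic complex Ginzburg–Landau equation $$ i\psi_t+\tfrac D2\psi_{xx}+\gamma|\psi|^2\psi+\nu|\psi|^4\psi = i\delta\psi+i\epsilon|\psi|^2\psi+i\beta\psi_{xx}+i\mu|\psi|^4\psi, $$ and suppose that there are $C,a>0$ with $|\psi(x)|\le Ce^{-a|x|}$ for all $x\in\mathbb R$. Put $\boldsymbol\psi=[\operatorname{Re}\psi\ \operatorname{Im}\psi]^T$, $$ B=\begin{bmatrix}\beta&-\frac D2\\ \frac D2&\beta\end{bmatrix},\quad N_0=\begin{bmatrix}\delta&-\alpha\\ \alpha&\delta\end{bmatrix},\quad N_1=\begin{bmatrix}\epsilon&-\gamma\\ \gamma&\epsilon\end{bmatrix},\quad N_2=\begin{bmatrix}\mu&-\nu\\ \nu&\mu\end{bmatrix}, $$ $$ M=N_1|\boldsymbol\psi|^2+N_2|\boldsymbol\psi|^4+(2N_1+4N_2|\boldsymbol\psi|^2)\boldsymbol\psi\boldsymbol\psi^T,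 $$ and let $\mathcal L=B\partial_x^2+N_0+M(x)$ be the linearized operator on $L^2(\mathbb R,\mathbb C^2)$ with domain $H^2(\mathbb R,\mathbb C^2)$. Its point spectrum $\sigma_{\rm pt}(\mathcal L)$ is its set of eigenvalues, and its essential spectrum $\sigma_{\rm ess}(\mathcal L)$ is the spectrum without those eigenvalues $\lambda$ for which $\mathcal L-\lambda$ is Fredholm of index $0$. For $\lambda\in\mathbb C\setminus\sigma_{\rm ess}(\mathcal L)$ let $$ A_\infty(\lambda)=\begin{bmatrix}0&I\\ B^{-1}(\lambda-N_0)&0\end{bmatrix}, $$ let $Q(\lambda)$ be the spectral projection of $A_\infty(\lambda)$ onto its stable subspace (eigenvalues with negative real part), and let $G(x)=-e^{A_\infty(\lambda)x}Q(\lambda)$ for $x\ge0$, $G(x)=e^{A_\infty(\lambda)x}(I-Q(\lambda))$ for $x<0$. With $|M|=(M^*M)^{1/2}$ and $$ R_r=\begin{bmatrix}|M|^{1/2}&0\\0&0\end{bmatrix},\qquad R_\ell=\begin{bmatrix}0&0\\-B^{-1}M|M|^{-1/2}&0\end{bmatrix} $$ (where $|M|^{-1/2}$ is taken to be $0$ on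 $\ker|M|$), let $\mathcal K(\lambda)$ be the Birman–Schwinger operator on $L^2(\mathbb R,\mathbb C^4)$, that is, the integral operator with kernel $R_r(x)\,G(x-y)\,R_\ell(y)$. Then, for every $\lambda\in\mathbb C\setminus\sigma_{\rm ess}(\mathcal L)$, the operator $\mathcal K(\lambda)$ is a well-defined bounded operator, it is Hilbert–Schmidt, and $$ \lambda\in\sigma_{\rm pt}(\mathcal L)\iff {\det}_2(\mathcal I+\mathcal K(\lambda))=0, $$ where $\det_2$ denotes the 2-modified Fredholm determinant, i.e. the continuous extension of $F\mapsto\det(I+F)e^{-\operatorname{tr}F}$ from finite-rank to Hilbert–Schmidt operators. -/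

import Mathlib

open MeasureTheory Filter Topology
open scoped ENNReal ContDiff MatrixOrder

noncomputable section

namespace CGLE

/-! ### Hilbert–Schmidt operators and the 2-modified Fredholm determinant -/

section Determinant

variable {H : Type*} [NormedAddCommGroup H] [InnerProductSpace ℂ H]

/-- The Hilbert–Schmidt norm, with values in `[0, ∞]`: the square root of the supremum of
`∑ ‖T e‖²` over all finite orthonormal systems. On a Hilbert space this is
`(∑ ‖T eᵢ‖²)^{1/2}` for any orthonormal basis `(eᵢ)`. -/
def hsNorm (T : H →L[ℂ] H) : ℝ≥0∞ :=
  (⨆ (s : Finset H) (_ : Orthonormal ℂ (fun e : s => (e : H))), ∑ e ∈ s, ‖T e‖ₑ ^ 2) ^ (1 / 2 : ℝ)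

/-- `T` is a Hilbert–Schmidt operator. -/
def IsHilbertSchmidt (T : H →L[ℂ] H) : Prop := hsNorm T < ⊤

/-- The restriction of an operator to its own range. -/
def restrictRange (F : H →L[ℂ] H) :
    (LinearMap.range (F : H →ₗ[ℂ] H)) →ₗ[ℂ] (LinearMap.range (F : H →ₗ[ℂ] H)) :=
  (F : H →ₗ[ℂ] H).restrict (fun x _ => LinearMap.mem_range_self (F : H →ₗ[ℂ] H) x)

/-- For an operator `F` of finite rank, `det(I + F) · exp(-tr F)`, where the determinant and the
trace are those of `I + F` and `F` on the finite-dimensional invariant subspace `range F`. -/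
def detTwoFiniteRank (F : H →L[ℂ] H) : ℂ :=
  LinearMap.det (LinearMap.id + restrictRange F) *
    Complex.exp (-LinearMap.trace ℂ _ (restrictRange F))

/-- The finite-rank operators near `K` in the Hilbert–Schmidt norm. -/
def finiteRankNhds (K : H →L[ℂ] H) : Filter (H →L[ℂ] H) :=
  comap (fun F => hsNorm (F - K)) (𝓝 0) ⊓
    𝓟 {F | FiniteDimensional ℂ (LinearMap.range (F : H →ₗ[ℂ] H))}

/-- The 2-modified Fredholm determinant `det₂(I + K)` of a Hilbert–Schmidt operator `K`: the
value at `K` of the continuous extension, from the finite-rank operators to the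
Hilbert–Schmidt operators, of `F ↦ det(I + F) · exp(-tr F)`. -/
def detTwo (K : H →L[ℂ] H) : ℂ := limUnder (finiteRankNhds K) detTwoFiniteRank

end Determinant

/-! ### Spectra of unbounded operators -/

section Spectrum

variable {E : Type*} [NormedAddCommGroup E] [NormedSpace ℂ E]

/-- `T - λ` on the domain of `T`. -/
def shift (T : E →ₗ.[ℂ] E) (l : ℂ) : T.domain →ₗ[ℂ] E := T.toFun - l • T.domain.subtype

/-- `T - λ` is invertible with bounded inverse. -/
def resolventSet (T : E →ₗ.[ℂ] E) : Set ℂ :=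
  {l | Function.Bijective (shift T l) ∧ ∃ C : ℝ, ∀ u : T.domain, ‖u‖ ≤ C * ‖shift T l u‖}

def spectrum (T : E →ₗ.[ℂ] E) : Set ℂ := (resolventSet T)ᶜ

/-- The set of eigenvalues of `T`. -/
def pointSpectrum (T : E →ₗ.[ℂ] E) : Set ℂ := {l | LinearMap.ker (shift T l) ≠ ⊥}

/-- `T - λ` is Fredholm. -/
def IsFredholmAt (T : E →ₗ.[ℂ] E) (l : ℂ) : Prop :=
  IsClosed (LinearMap.range (shift T l) : Set E) ∧
    FiniteDimensional ℂ (LinearMap.ker (shift T l)) ∧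
    FiniteDimensional ℂ (E ⧸ LinearMap.range (shift T l))

/-- The Fredholm index of `T - λ`. -/
def fredholmIndex (T : E →ₗ.[ℂ] E) (l : ℂ) : ℤ :=
  (Module.finrank ℂ (LinearMap.ker (shift T l)) : ℤ) -
    (Module.finrank ℂ (E ⧸ LinearMap.range (shift T l)) : ℤ)

def fredholmPointSpectrum (T : E →ₗ.[ℂ] E) : Set ℂ :=
  {l | IsFredholmAt T l ∧ fredholmIndex T l = 0 ∧ LinearMap.ker (shift T l) ≠ ⊥}

def essentialSpectrum (T : E →ₗ.[ℂ] E) : Set ℂ := spectrum T \ fredholmPointSpectrum T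

end Spectrum

/-! ### Vector-valued `L²` functions on the line, weak derivatives, integral operators -/

section LTwo

variable {n : Type*} [Fintype n]

/-- `L²(ℝ, ℂⁿ)`. -/
abbrev L2 (n : Type*) [Fintype n] := Lp (EuclideanSpace ℂ n) 2 (volume : Measure ℝ)

/-- `g` is the weak derivative of `f`. -/
def HasWeakDeriv (f g : L2 n) : Prop :=
  ∀ φ : ℝ → ℝ, ContDiff ℝ ∞ φ → HasCompactSupport φ →
    ∫ x, deriv φ x • f x = -∫ x, φ x • g x

/-- `h` is the second weak derivative of `f`, the first one being in `L²` too. -/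
def HasWeakDeriv₂ (f h : L2 n) : Prop := ∃ g : L2 n, HasWeakDeriv f g ∧ HasWeakDeriv g h

lemma integrable_smul_L2 (f : L2 n) {φ : ℝ → ℝ} (hφ : Continuous φ)
    (hc : HasCompactSupport φ) : Integrable (fun x => φ x • f x) :=
  ((Lp.memLp f).locallyIntegrable (by norm_num)).integrable_smul_left_of_hasCompactSupport hφ hc

lemma HasWeakDeriv.unique {f g g' : L2 n} (h : HasWeakDeriv f g) (h' : HasWeakDeriv f g') :
    g = g' := by
  apply Lp.ext
  refine ae_eq_of_integral_contDiff_smul_eq ((Lp.memLp g).locallyIntegrable (by norm_num))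
    ((Lp.memLp g').locallyIntegrable (by norm_num)) ?_
  intro φ h1 h2
  have := (h φ h1 h2).symm.trans (h' φ h1 h2)
  simpa using this

lemma HasWeakDeriv.add {f g f' g' : L2 n} (h : HasWeakDeriv f g) (h' : HasWeakDeriv f' g') :
    HasWeakDeriv (f + f') (g + g') := by
  intro φ h1 h2
  have hd : Continuous (deriv φ) := h1.continuous_deriv (by simp)
  have e1 : ∫ x, deriv φ x • (f + f' : L2 n) x = ∫ x, (deriv φ x • f x + deriv φ x • f' x) := by
    refine integral_congr_ae ?_
    filter_upwards [Lp.coeFn_add f f'] with x hx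
    simp only [hx, Pi.add_apply, smul_add]
  have e2 : ∫ x, φ x • (g + g' : L2 n) x = ∫ x, (φ x • g x + φ x • g' x) := by
    refine integral_congr_ae ?_
    filter_upwards [Lp.coeFn_add g g'] with x hx
    simp only [hx, Pi.add_apply, smul_add]
  rw [e1, e2, integral_add (integrable_smul_L2 f hd h2.deriv) (integrable_smul_L2 f' hd h2.deriv),
    integral_add (integrable_smul_L2 g h1.continuous h2) (integrable_smul_L2 g' h1.continuous h2),
    h φ h1 h2, h' φ h1 h2]
  abel

lemma HasWeakDeriv.smul (c : ℂ) {f g : L2 n} (h : HasWeakDeriv f g) :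
    HasWeakDeriv (c • f) (c • g) := by
  intro φ h1 h2
  have e1 : ∫ x, deriv φ x • (c • f : L2 n) x = ∫ x, c • (deriv φ x • f x) := by
    refine integral_congr_ae ?_
    filter_upwards [Lp.coeFn_smul c f] with x hx
    simp only [hx, Pi.smul_apply]
    exact smul_comm _ _ _
  have e2 : ∫ x, φ x • (c • g : L2 n) x = ∫ x, c • (φ x • g x) := by
    refine integral_congr_ae ?_
    filter_upwards [Lp.coeFn_smul c g] with x hx
    simp only [hx, Pi.smul_apply]
    exact smul_comm _ _ _
  rw [e1, e2, integral_smul, integral_smul, h φ h1 h2, smul_neg]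

lemma HasWeakDeriv₂.unique {f h h' : L2 n} (H : HasWeakDeriv₂ f h) (H' : HasWeakDeriv₂ f h') :
    h = h' := by
  obtain ⟨g, h1, h2⟩ := H
  obtain ⟨g', h1', h2'⟩ := H'
  obtain rfl := h1.unique h1'
  exact h2.unique h2'

lemma HasWeakDeriv₂.add {f h f' h' : L2 n} (H : HasWeakDeriv₂ f h) (H' : HasWeakDeriv₂ f' h') :
    HasWeakDeriv₂ (f + f') (h + h') := by
  obtain ⟨g, h1, h2⟩ := H
  obtain ⟨g', h1', h2'⟩ := H'
  exact ⟨g + g', h1.add h1', h2.add h2'⟩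

lemma HasWeakDeriv₂.smul (c : ℂ) {f h : L2 n} (H : HasWeakDeriv₂ f h) :
    HasWeakDeriv₂ (c • f) (c • h) := by
  obtain ⟨g, h1, h2⟩ := H
  exact ⟨c • g, h1.smul c, h2.smul c⟩

/-- The Sobolev space `H²(ℝ, ℂⁿ)` as a subspace of `L²(ℝ, ℂⁿ)`. -/
def H2 (n : Type*) [Fintype n] : Submodule ℂ (L2 n) where
  carrier := {f | ∃ h, HasWeakDeriv₂ f h}
  add_mem' := fun ⟨h, H⟩ ⟨h', H'⟩ => ⟨h + h', H.add H'⟩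
  zero_mem' := ⟨(0 : ℂ) • 0, by
    have h0 : HasWeakDeriv (0 : L2 n) 0 := by
      intro φ _ _
      have e : ∀ ψ : ℝ → ℝ, ∫ x, ψ x • (0 : L2 n) x = 0 := by
        intro ψ
        refine integral_eq_zero_of_ae ?_
        filter_upwards [Lp.coeFn_zero (EuclideanSpace ℂ n) 2 (volume : Measure ℝ)] with x hx
        simp
      rw [e, e, neg_zero]
    rw [smul_zero]
    exact ⟨0, h0, h0⟩⟩
  smul_mem' := fun c _ ⟨h, H⟩ => ⟨c • h, H.smul c⟩

/-- The second derivative `∂ₓ² : H²(ℝ, ℂⁿ) → L²(ℝ, ℂⁿ)`. -/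
def secondDeriv : H2 n →ₗ[ℂ] L2 n where
  toFun f := f.2.choose
  map_add' f f' := (f + f').2.choose_spec.unique (f.2.choose_spec.add f'.2.choose_spec)
  map_smul' c f := (c • f).2.choose_spec.unique (f.2.choose_spec.smul c)

lemma secondDeriv_spec (f : H2 n) : HasWeakDeriv₂ (f : L2 n) (secondDeriv f) := f.2.choose_spec

variable [DecidableEq n]

/-- A matrix acting on `ℂⁿ`. -/
abbrev act (M : Matrix n n ℂ) : EuclideanSpace ℂ n →L[ℂ] EuclideanSpace ℂ n :=
  Matrix.toEuclideanCLM (n := n) (𝕜 := ℂ) M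

open Classical in
/-- The operator of multiplication by an (essentially) bounded matrix-valued function `M`. -/
def mulOp (M : ℝ → Matrix n n ℂ) : L2 n →L[ℂ] L2 n :=
  if h : MemLp (fun x => act (M x)) ∞ (volume : Measure ℝ) then
    (ContinuousLinearMap.id ℂ (EuclideanSpace ℂ n →L[ℂ] EuclideanSpace ℂ n)).holderL
      volume ∞ 2 2 (h.toLp _)
  else 0

lemma mulOp_apply {M : ℝ → Matrix n n ℂ}
    (h : MemLp (fun x => act (M x)) ∞ (volume : Measure ℝ)) (f : L2 n) :
    mulOp M f =ᵐ[volume] fun x => act (M x) (f x) := by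
  have e : mulOp M f = (ContinuousLinearMap.id ℂ
      (EuclideanSpace ℂ n →L[ℂ] EuclideanSpace ℂ n)).holder 2 (h.toLp _) f := by
    rw [mulOp, dif_pos h]; rfl
  rw [e]
  filter_upwards [ContinuousLinearMap.coeFn_holder (r := 2) (ContinuousLinearMap.id ℂ
      (EuclideanSpace ℂ n →L[ℂ] EuclideanSpace ℂ n)) (h.toLp _) f, h.coeFn_toLp] with x h1 h2
  rw [h1, h2]; rfl

/-- `T` is the integral operator with matrix-valued kernel `k`. -/
def IsIntegralOperator (k : ℝ → ℝ → Matrix n n ℂ) (T : L2 n →L[ℂ] L2 n) : Prop :=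
  ∀ f : L2 n, ∀ᵐ x : ℝ, Integrable (fun y => act (k x y) (f y)) ∧
    T f x = ∫ y, act (k x y) (f y)

open Classical in
/-- The bounded operator on `L²(ℝ, ℂⁿ)` with matrix-valued kernel `k` (there is at most one);
by convention `0` if `k` is not the kernel of a bounded operator. -/
def integralOperator (k : ℝ → ℝ → Matrix n n ℂ) : L2 n →L[ℂ] L2 n :=
  if h : ∃ T, IsIntegralOperator k T then h.choose else 0

lemma IsIntegralOperator.unique {k : ℝ → ℝ → Matrix n n ℂ} {T T' : L2 n →L[ℂ] L2 n}
    (h : IsIntegralOperator k T) (h' : IsIntegralOperator k T') : T = T' := by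
  ext1 f
  apply Lp.ext
  filter_upwards [h f, h' f] with x h1 h2
  rw [h1.2, h2.2]

end LTwo

/-! ### Spectral projection onto the stable subspace of a matrix -/

section Projection

variable {n : Type*} [Fintype n] [DecidableEq n]

/-- Sum of the generalized eigenspaces for eigenvalues with negative real part. -/
def stableSubspace (A : Matrix n n ℂ) : Submodule ℂ (n → ℂ) :=
  ⨆ μ ∈ {z : ℂ | z.re < 0}, Module.End.maxGenEigenspace (Matrix.toLin' A) μ

/-- Sum of the generalized eigenspaces for eigenvalues with nonnegative real part. -/
def nonstableSubspace (A : Matrix n n ℂ) : Submodule ℂ (n → ℂ) :=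
  ⨆ μ ∈ {z : ℂ | 0 ≤ z.re}, Module.End.maxGenEigenspace (Matrix.toLin' A) μ

lemma isCompl_stableSubspace (A : Matrix n n ℂ) :
    IsCompl (stableSubspace A) (nonstableSubspace A) := by
  constructor
  · refine (Module.End.independent_maxGenEigenspace (Matrix.toLin' A)).disjoint_biSup_biSup ?_
    rw [Set.disjoint_left]
    intro z (hz : z.re < 0) (hz' : 0 ≤ z.re)
    linarith
  · rw [codisjoint_iff, eq_top_iff, ← Module.End.iSup_maxGenEigenspace_eq_top (Matrix.toLin' A)]
    refine iSup_le fun z => ?_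
    rcases lt_or_ge z.re 0 with h | h
    · exact le_sup_of_le_left (le_iSup₂_of_le z h le_rfl)
    · exact le_sup_of_le_right (le_iSup₂_of_le z h le_rfl)

/-- The spectral projection `Q` of `A` onto its stable subspace. -/
def stableProjection (A : Matrix n n ℂ) : Matrix n n ℂ :=
  LinearMap.toMatrix' (Submodule.projection _ _ (isCompl_stableSubspace A))

/-- The Green's kernel of `-∂ₓ + A`. -/
def greenKernel (A : Matrix n n ℂ) (x : ℝ) : Matrix n n ℂ :=
  if 0 ≤ x then -(NormedSpace.exp ((x : ℂ) • A) * stableProjection A)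
  else NormedSpace.exp ((x : ℂ) • A) * (1 - stableProjection A)

end Projection

/-! ### The complex Ginzburg–Landau equation and its linearization -/

/-- The coefficients of the cubic-quintic complex Ginzburg–Landau equation, and the phase change
`α` of the stationary solution. -/
structure Params where
  (D γ ν δ ε β μ α : ℝ)

/-- `Ψ(t, x)` satisfies, for `t ≥ 0`, the equation
`i Ψ_t + (D/2) Ψ_xx + γ|Ψ|²Ψ + ν|Ψ|⁴Ψ = iδΨ + iε|Ψ|²Ψ + iβΨ_xx + iμ|Ψ|⁴Ψ`. -/
def SolvesCGLE (p : Params) (Ψ : ℝ → ℝ → ℂ) : Prop :=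
  ∀ t : ℝ, 0 ≤ t → ∀ x : ℝ,
    Complex.I * deriv (fun s => Ψ s x) t + (p.D / 2 : ℂ) * iteratedDeriv 2 (Ψ t) x
        + (p.γ : ℂ) * (‖Ψ t x‖ : ℂ) ^ 2 * Ψ t x + (p.ν : ℂ) * (‖Ψ t x‖ : ℂ) ^ 4 * Ψ t x
      = Complex.I * p.δ * Ψ t x + Complex.I * p.ε * (‖Ψ t x‖ : ℂ) ^ 2 * Ψ t x
        + Complex.I * p.β * iteratedDeriv 2 (Ψ t) x
        + Complex.I * p.μ * (‖Ψ t x‖ : ℂ) ^ 4 * Ψ t x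

/-- `ψ` is the profile of a (classical) stationary solution `e^{-iαt} ψ(x)`. -/
def IsStationarySolution (p : Params) (ψ : ℝ → ℂ) : Prop :=
  ContDiff ℝ 2 ψ ∧ SolvesCGLE p (fun t x => Complex.exp (-(Complex.I * p.α * t)) * ψ x)

def matB (p : Params) : Matrix (Fin 2) (Fin 2) ℂ :=
  !![(p.β : ℂ), -(p.D : ℂ) / 2; (p.D : ℂ) / 2, (p.β : ℂ)]

def matN0 (p : Params) : Matrix (Fin 2) (Fin 2) ℂ := !![(p.δ : ℂ), -(p.α : ℂ); (p.α : ℂ), (p.δ : ℂ)]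

def matN1 (p : Params) : Matrix (Fin 2) (Fin 2) ℂ := !![(p.ε : ℂ), -(p.γ : ℂ); (p.γ : ℂ), (p.ε : ℂ)]

def matN2 (p : Params) : Matrix (Fin 2) (Fin 2) ℂ := !![(p.μ : ℂ), -(p.ν : ℂ); (p.ν : ℂ), (p.μ : ℂ)]

/-- The column `[Re z, Im z]ᵀ`. -/
def reIm (z : ℂ) : Fin 2 → ℂ := ![(z.re : ℂ), (z.im : ℂ)]

/-- The matrix `M` at a point where the pulse has the value `z`; the zeroth-order coefficient of
the linearized operator is `N₀ + M`. -/
def matM (p : Params) (z : ℂ) : Matrix (Fin 2) (Fin 2) ℂ :=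
  (‖z‖ : ℂ) ^ 2 • matN1 p + (‖z‖ : ℂ) ^ 4 • matN2 p
    + ((2 : ℂ) • matN1 p + (4 * (‖z‖ : ℂ) ^ 2) • matN2 p) * Matrix.vecMulVec (reIm z) (reIm z)

/-- `M̃(x) = N₀ + M(x)`. -/
def potential (p : Params) (ψ : ℝ → ℂ) (x : ℝ) : Matrix (Fin 2) (Fin 2) ℂ :=
  matN0 p + matM p (ψ x)

/-- For a bounded continuous pulse, `M̃` is bounded. -/
lemma memLp_potential (p : Params) {ψ : ℝ → ℂ} (hψ : Continuous ψ) {C : ℝ}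
    (hC : ∀ x, ‖ψ x‖ ≤ C) : MemLp (fun x => act (potential p ψ x)) ∞ (volume : Measure ℝ) := by
  have h1 : Continuous (fun z : ℂ => matN0 p + matM p z) := by
    unfold matM
    have : Continuous reIm := by
      refine continuous_pi fun i => ?_
      fin_cases i
      · exact Complex.continuous_ofReal.comp Complex.continuous_re
      · exact Complex.continuous_ofReal.comp Complex.continuous_im
    fun_prop
  have h2 : Continuous (fun M : Matrix (Fin 2) (Fin 2) ℂ => act M) :=
    LinearMap.continuous_of_finiteDimensional
      (Matrix.toEuclideanCLM (n := Fin 2) (𝕜 := ℂ)).toAlgEquiv.toLinearMap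
  have h3 := h2.comp h1
  obtain ⟨K, hK⟩ := (isCompact_closedBall (0 : ℂ) C).exists_bound_of_continuousOn h3.continuousOn
  exact memLp_top_of_bound (h3.comp hψ).aestronglyMeasurable K
    (Eventually.of_forall fun x => hK (ψ x) (by simpa using hC x))

/-- The linearized operator `𝓛 = B ∂ₓ² + M̃(x)` on `L²(ℝ, ℂ²)`, with domain `H²(ℝ, ℂ²)`. -/
def linearization (p : Params) (ψ : ℝ → ℂ) : L2 (Fin 2) →ₗ.[ℂ] L2 (Fin 2) where
  domain := H2 (Fin 2)
  toFun := ((act (matB p)).compLpL 2 volume : L2 (Fin 2) →L[ℂ] L2 (Fin 2)).toLinearMap ∘ₗ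
      secondDeriv
    + (mulOp (potential p ψ)).toLinearMap ∘ₗ (H2 (Fin 2)).subtype

/-! ### The Birman–Schwinger operator -/

/-- The matrix of the unperturbed first-order system `∂ₓ u = A_∞(λ) u`. -/
def matAInf (p : Params) (l : ℂ) : Matrix (Fin 2 ⊕ Fin 2) (Fin 2 ⊕ Fin 2) ℂ :=
  Matrix.fromBlocks 0 1 ((matB p)⁻¹ * (l • 1 - matN0 p)) 0

/-- `R_r = [|M|^{1/2}, 0; 0, 0]`, with `|M| = (M* M)^{1/2}`. -/
def matRr (p : Params) (z : ℂ) : Matrix (Fin 2 ⊕ Fin 2) (Fin 2 ⊕ Fin 2) ℂ :=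
  Matrix.fromBlocks (CFC.abs (matM p z) ^ (1 / 2 : ℝ)) 0 0 0

/-- `R_ℓ = [0, 0; -B⁻¹ M |M|^{-1/2}, 0]`. The power `|M|^{-1/2}` is taken to be `0` on the kernel of
`|M|`, so that `M |M|^{-1/2} = V |M|^{1/2}` for every polar decomposition `M = V |M|`. -/
def matRl (p : Params) (z : ℂ) : Matrix (Fin 2 ⊕ Fin 2) (Fin 2 ⊕ Fin 2) ℂ :=
  Matrix.fromBlocks 0 0 (-((matB p)⁻¹ * matM p z * CFC.abs (matM p z) ^ (-(1 / 2) : ℝ))) 0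

/-- The kernel of `R_r 𝓖_A R_ℓ`, where `𝓖_A` is convolution with the Green's kernel of
`-∂ₓ + A_∞(λ)`. -/
def birmanSchwingerKernel (p : Params) (ψ : ℝ → ℂ) (l : ℂ) (x y : ℝ) :
    Matrix (Fin 2 ⊕ Fin 2) (Fin 2 ⊕ Fin 2) ℂ :=
  matRr p (ψ x) * greenKernel (matAInf p l) (x - y) * matRl p (ψ y)

/-- The (symmetrized) Birman–Schwinger operator `𝓚(λ) = R_r 𝓖_A R_ℓ` on `L²(ℝ, ℂ⁴)`. -/
def birmanSchwinger (p : Params) (ψ : ℝ → ℂ) (l : ℂ) :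
    L2 (Fin 2 ⊕ Fin 2) →L[ℂ] L2 (Fin 2 ⊕ Fin 2) :=
  integralOperator (birmanSchwingerKernel p ψ l)

end CGLE

end

/-!
The first-order form of the eigenvalue problem `𝓛 u = λ u` is `U' = (A_∞(λ) + R_ℓ(x) R_r(x)) U` for
`U = (u, u')`, because `R_ℓ R_r = [0, 0; -B⁻¹ M, 0]` (`matRl_mul_matRr`, which rests on
`M |M|^{-1/2} |M|^{1/2} = M`). If `A_∞(λ)` has no eigenvalues on the imaginary axis, then `-∂ₓ + A_∞(λ)`
is invertible, its inverse `𝓖` being the convolution with the Green's kernel. Hence `U` solves the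
system if and only if `U = -𝓖 R_ℓ R_r U`, and `U ↦ R_r U`, `w ↦ -𝓖 R_ℓ w` identify the solutions
with the eigenvectors of `𝓚(λ) = R_r 𝓖 R_ℓ` for the eigenvalue `-1` (`ker_shift_ne_bot_iff`).

* *The essential spectrum.* The matrices `B` and `N₀` are simultaneously diagonalized by
  `(1, ∓i)`, so `A_∞(λ)` has imaginary eigenvalues exactly if `λ` lies on one of the dispersion curves
  `δ ± iα - k² (β ± iD/2)`. For such `λ`, wave packets moving to infinity form a Weyl sequence, and
  `𝓛 - λ` is not Fredholm (`eigSq_ne_of_isFredholmAt`). Off the curves the eigenvalues of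
  `A_∞(λ)` come in pairs `±κ ≠ 0`, so that `A_∞(λ)` is diagonalizable
  (`exists_isSpectralDecomposition`), and the Green's operator is a finite sum of scalar ones
  (`IsSpectralDecomposition.isIntegralOperator_greenOp`).
* *The Hilbert–Schmidt property.* The square-root factors of `M` decay like `ψ`, since `M` is
  quadratic in `ψ` to leading order. The kernel is thus dominated by `c e^{-a|x|} e^{-a|y|}`
  (`IsIntegralOperator.isHilbertSchmidt`).
* *The determinant.* On finite-rank operators, `|det(I + F) e^{-tr F}| ≤ e^{‖F‖² / 2}`, which by the
  Schwarz lemma gives a Lipschitz bound on balls of the Hilbert–Schmidt norm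
  (`norm_detTwoFiniteRank_sub_le`), so the defining limit of `det₂` exists (`tendsto_detTwo`).
  It vanishes exactly if `-1` is an eigenvalue (`detTwo_eq_zero_iff`): when `I + K` is invertible,
  the determinants of the approximations are bounded away from zero through their inverses,
  and when it is not, a nearby finite-rank operator shares a kernel vector.
-/

noncomputable section

namespace CGLE

/-! ### The Hilbert–Schmidt norm -/

section HilbertSchmidt

variable {H : Type*} [NormedAddCommGroup H] [InnerProductSpace ℂ H]

lemma hsNorm_sq (T : H →L[ℂ] H) :
    hsNorm T ^ 2 = ⨆ (s : Finset H) (_ : Orthonormal ℂ (fun e : s => (e : H))),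
      ∑ e ∈ s, ‖T e‖ₑ ^ 2 := by
  rw [hsNorm, ← ENNReal.rpow_natCast, ← ENNReal.rpow_mul]
  norm_num

lemma hsNorm_le_iff {T : H →L[ℂ] H} {c : ℝ≥0∞} :
    hsNorm T ≤ c ↔ ∀ s : Finset H, Orthonormal ℂ (fun e : s => (e : H)) →
      ∑ e ∈ s, ‖T e‖ₑ ^ 2 ≤ c ^ 2 := by
  have h : hsNorm T ≤ c ↔ hsNorm T ^ 2 ≤ c ^ 2 := by
    constructor
    · intro h; gcongr
    · intro h; exact (ENNReal.pow_right_strictMono (two_ne_zero)).le_iff_le.1 h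
  rw [h, hsNorm_sq]
  simp only [iSup_le_iff]

lemma sum_enorm_sq_le_hsNorm_sq (T : H →L[ℂ] H) {ι : Type*} {v : ι → H} (hv : Orthonormal ℂ v)
    (s : Finset ι) : ∑ i ∈ s, ‖T (v i)‖ₑ ^ 2 ≤ hsNorm T ^ 2 := by
  classical
  have hinj : Function.Injective v := hv.linearIndependent.injective
  have h2 : Orthonormal ℂ (fun e : (s.image v : Finset H) => (e : H)) := by
    have h3 : Orthonormal ℂ ((↑) : Set.range v → H) := hv.toSubtypeRange
    refine h3.comp (fun e : (s.image v : Finset H) => (⟨(e : H), ?_⟩ : Set.range v)) ?_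
    · obtain ⟨i, -, hi⟩ := Finset.mem_image.1 e.2
      exact ⟨i, hi⟩
    · intro a b hab
      exact Subtype.ext (congrArg (fun z : Set.range v => (z : H)) hab)
  have h4 := hsNorm_le_iff.1 (le_refl (hsNorm T)) (s.image v) h2
  rwa [Finset.sum_image (fun a _ b _ hab => hinj hab)] at h4

lemma hsNorm_add_le (S T : H →L[ℂ] H) : hsNorm (S + T) ≤ hsNorm S + hsNorm T := by
  refine hsNorm_le_iff.2 fun s hs => ?_
  have h1 := hsNorm_le_iff.1 (le_refl (hsNorm S)) s hs
  have h2 := hsNorm_le_iff.1 (le_refl (hsNorm T)) s hs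
  have h3 := ENNReal.Lp_add_le s (fun e => ‖S e‖ₑ) (fun e => ‖T e‖ₑ) (p := 2) (by norm_num)
  have key : ∀ {a c : ℝ≥0∞}, a ≤ c ^ 2 → a ^ (1 / 2 : ℝ) ≤ c := by
    intro a c h
    calc a ^ (1 / 2 : ℝ) ≤ (c ^ 2) ^ (1 / 2 : ℝ) := by gcongr
      _ = c := by rw [← ENNReal.rpow_natCast, ← ENNReal.rpow_mul]; norm_num
  have e2 : ∀ x : ℝ≥0∞, x ^ (2 : ℝ) = x ^ 2 := fun x => ENNReal.rpow_natCast x 2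
  simp only [e2] at h3
  have h4 : (∑ e ∈ s, ‖(S + T) e‖ₑ ^ 2) ^ (1 / 2 : ℝ) ≤ hsNorm S + hsNorm T := by
    refine le_trans ?_ (h3.trans (add_le_add (key h1) (key h2)))
    gcongr with e he
    exact enorm_add_le _ _
  calc ∑ e ∈ s, ‖(S + T) e‖ₑ ^ 2 = ((∑ e ∈ s, ‖(S + T) e‖ₑ ^ 2) ^ (1 / 2 : ℝ)) ^ 2 := by
        rw [← ENNReal.rpow_natCast, ← ENNReal.rpow_mul]; norm_num
    _ ≤ _ := by gcongr

lemma hsNorm_smul_le (c : ℂ) (T : H →L[ℂ] H) : hsNorm (c • T) ≤ ‖c‖ₑ * hsNorm T := by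
  refine hsNorm_le_iff.2 fun s hs => ?_
  have h1 := hsNorm_le_iff.1 (le_refl (hsNorm T)) s hs
  simp only [_root_.smul_apply, enorm_smul, mul_pow, ← Finset.mul_sum]
  gcongr

lemma hsNorm_neg (T : H →L[ℂ] H) : hsNorm (-T) = hsNorm T := by simp [hsNorm]

lemma hsNorm_sub_comm (S T : H →L[ℂ] H) : hsNorm (S - T) = hsNorm (T - S) := by
  rw [← hsNorm_neg, neg_sub]

lemma enorm_apply_le_hsNorm (T : H →L[ℂ] H) (x : H) : ‖T x‖ₑ ≤ hsNorm T * ‖x‖ₑ := by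
  rcases eq_or_ne x 0 with rfl | hx
  · simp
  have hn : ‖x‖ ≠ 0 := norm_ne_zero_iff.2 hx
  have h1 : Orthonormal ℂ (fun _ : Unit => ((‖x‖⁻¹ : ℝ) : ℂ) • x) := by
    refine ⟨fun _ => ?_, fun i j hij => (hij (Subsingleton.elim _ _)).elim⟩
    rw [norm_smul]; simp [hn]
  have h2 := sum_enorm_sq_le_hsNorm_sq T h1 Finset.univ
  simp only [Finset.univ_unique, Finset.sum_singleton] at h2
  have h3 := (ENNReal.pow_right_strictMono (two_ne_zero)).le_iff_le.1 h2
  have h4 : x = ((‖x‖ : ℝ) : ℂ) • (((‖x‖⁻¹ : ℝ) : ℂ) • x) := by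
    rw [smul_smul, ← Complex.ofReal_mul, mul_inv_cancel₀ hn]; simp
  calc ‖T x‖ₑ = ‖((‖x‖ : ℝ) : ℂ)‖ₑ * ‖T (((‖x‖⁻¹ : ℝ) : ℂ) • x)‖ₑ := by
        rw [← enorm_smul, ← map_smul, ← h4]
    _ ≤ ‖x‖ₑ * hsNorm T := by
        refine mul_le_mul' ?_ h3
        rw [← ofReal_norm, ← ofReal_norm]; simp
    _ = _ := mul_comm _ _

lemma enorm_le_hsNorm (T : H →L[ℂ] H) : ‖T‖ₑ ≤ hsNorm T := by
  rcases eq_or_ne (hsNorm T) ⊤ with h | h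
  · rw [h]; exact le_top
  have : ‖T‖ ≤ (hsNorm T).toReal := by
    refine T.opNorm_le_bound ENNReal.toReal_nonneg fun x => ?_
    have h1 := enorm_apply_le_hsNorm T x
    have h2 := ENNReal.toReal_mono (ENNReal.mul_ne_top h enorm_ne_top) h1
    simpa [ENNReal.toReal_mul] using h2
  rw [← ofReal_norm]
  exact ENNReal.ofReal_le_of_le_toReal this

/-- The Hilbert–Schmidt norm of a rank-one operator, by Bessel's inequality. -/
lemma hsNorm_smulRight_innerSL_le (w v : H) :
    hsNorm ((innerSL ℂ w).smulRight v) ≤ ‖w‖ₑ * ‖v‖ₑ := by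
  refine hsNorm_le_iff.2 fun s hs => ?_
  simp only [ContinuousLinearMap.smulRight_apply, enorm_smul, mul_pow, ← Finset.sum_mul]
  gcongr
  have h1 := Orthonormal.sum_inner_products_le (𝕜 := ℂ) (s := Finset.univ) w hs
  have h2 : ∑ e ∈ s, ‖(innerSL ℂ w) e‖ₑ ^ 2
      = ENNReal.ofReal (∑ e ∈ s, ‖inner ℂ e w‖ ^ 2) := by
    rw [ENNReal.ofReal_sum_of_nonneg (fun _ _ => by positivity)]
    refine Finset.sum_congr rfl fun e _ => ?_
    rw [innerSL_apply_apply, ← ofReal_norm, ENNReal.ofReal_pow (norm_nonneg _), norm_inner_symm]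
  rw [h2, ← ofReal_norm, ← ENNReal.ofReal_pow (norm_nonneg _)]
  refine ENNReal.ofReal_le_ofReal ?_
  rw [← Finset.sum_coe_sort s (fun e => ‖inner ℂ e w‖ ^ 2)]
  exact h1

lemma tsum_enorm_inner_sq {ι : Type*} (b : HilbertBasis ι ℂ H) (x : H) :
    ∑' i, ‖inner ℂ (b i) x‖ₑ ^ 2 = ‖x‖ₑ ^ 2 := by
  have h1 := b.hasSum_inner_mul_inner x x
  have e : ∀ i, inner ℂ x (b i) * inner ℂ (b i) x = ((‖inner ℂ (b i) x‖ ^ 2 : ℝ) : ℂ) := by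
    intro i
    rw [← inner_conj_symm, Complex.conj_mul']
    norm_cast
  simp only [e] at h1
  have e2 : inner ℂ x x = ((‖x‖ ^ 2 : ℝ) : ℂ) := by
    rw [inner_self_eq_norm_sq_to_K]; norm_cast
  rw [e2] at h1
  have h2 := Complex.hasSum_ofReal.1 h1
  have h3 : ∀ y : ℂ, ‖y‖ₑ ^ 2 = ENNReal.ofReal (‖y‖ ^ 2) := fun y => by
    rw [← ofReal_norm, ENNReal.ofReal_pow (norm_nonneg _)]
  simp only [h3]
  rw [← ofReal_norm, ← ENNReal.ofReal_pow (norm_nonneg _), ← h2.tsum_eq,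
    ENNReal.ofReal_tsum_of_nonneg (fun _ => by positivity) h2.summable]

variable [CompleteSpace H]

lemma hsNorm_sq_le_tsum_adjoint {ι : Type*} (b : HilbertBasis ι ℂ H) (T : H →L[ℂ] H) :
    hsNorm T ^ 2 ≤ ∑' i, ‖ContinuousLinearMap.adjoint T (b i)‖ₑ ^ 2 := by
  rw [hsNorm_sq]
  refine iSup₂_le fun s hs => ?_
  calc ∑ e ∈ s, ‖T e‖ₑ ^ 2 = ∑ e ∈ s, ∑' i, ‖inner ℂ (b i) (T e)‖ₑ ^ 2 := by
        simp only [tsum_enorm_inner_sq]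
    _ = ∑' i, ∑ e ∈ s, ‖inner ℂ (b i) (T e)‖ₑ ^ 2 :=
        (Summable.tsum_finsetSum fun _ _ => ENNReal.summable).symm
    _ ≤ _ := by
        refine ENNReal.tsum_le_tsum fun i => ?_
        have h1 := Orthonormal.sum_inner_products_le (𝕜 := ℂ) (s := Finset.univ)
          (ContinuousLinearMap.adjoint T (b i)) hs
        have h2 : ∑ e ∈ s, ‖inner ℂ (b i) (T e)‖ₑ ^ 2 = ENNReal.ofReal
            (∑ e ∈ s, ‖inner ℂ e (ContinuousLinearMap.adjoint T (b i))‖ ^ 2) := by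
          rw [ENNReal.ofReal_sum_of_nonneg (fun _ _ => by positivity)]
          refine Finset.sum_congr rfl fun e _ => ?_
          rw [ContinuousLinearMap.adjoint_inner_right, ← ofReal_norm,
            ENNReal.ofReal_pow (norm_nonneg _), norm_inner_symm]
        rw [h2, ← ofReal_norm, ← ENNReal.ofReal_pow (norm_nonneg _)]
        refine ENNReal.ofReal_le_ofReal ?_
        rw [← Finset.sum_coe_sort s (fun e => ‖inner ℂ e _‖ ^ 2)]
        exact h1

lemma tsum_adjoint_le_hsNorm_sq {ι : Type*} (b : HilbertBasis ι ℂ H) (T : H →L[ℂ] H) :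
    ∑' i, ‖ContinuousLinearMap.adjoint T (b i)‖ₑ ^ 2 ≤ hsNorm T ^ 2 := by
  calc ∑' i, ‖ContinuousLinearMap.adjoint T (b i)‖ₑ ^ 2
      = ∑' i, ∑' j, ‖inner ℂ (b j) (ContinuousLinearMap.adjoint T (b i))‖ₑ ^ 2 := by
        simp only [tsum_enorm_inner_sq]
    _ = ∑' j, ∑' i, ‖inner ℂ (b i) (T (b j))‖ₑ ^ 2 := by
        rw [ENNReal.tsum_comm]
        refine tsum_congr fun j => tsum_congr fun i => ?_
        rw [ContinuousLinearMap.adjoint_inner_right, ← ofReal_norm, ← ofReal_norm,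
          norm_inner_symm]
    _ = ∑' j, ‖T (b j)‖ₑ ^ 2 := by simp only [tsum_enorm_inner_sq]
    _ ≤ _ := by
        rw [ENNReal.tsum_eq_iSup_sum]
        exact iSup_le fun s => sum_enorm_sq_le_hsNorm_sq T b.orthonormal s

/-- Hilbert–Schmidt operators are limits of finite-rank operators in the Hilbert–Schmidt norm:
compose with the projections onto the spans of finitely many vectors of a Hilbert basis. -/
lemma exists_finiteRank_hsNorm_sub_lt {T : H →L[ℂ] H} (hT : IsHilbertSchmidt T) {r : ℝ≥0∞}
    (hr : 0 < r) : ∃ F : H →L[ℂ] H,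
      FiniteDimensional ℂ (LinearMap.range (F : H →ₗ[ℂ] H)) ∧ hsNorm (F - T) < r := by
  classical
  obtain ⟨w, b, -⟩ := exists_hilbertBasis ℂ H
  have hfin : ∑' i, ‖ContinuousLinearMap.adjoint T (b i)‖ₑ ^ 2 ≠ ⊤ :=
    ((tsum_adjoint_le_hsNorm_sq b T).trans_lt (ENNReal.pow_lt_top hT)).ne
  have hlim := ENNReal.tendsto_tsum_compl_atTop_zero hfin
  obtain ⟨s, hs⟩ := (hlim.eventually (gt_mem_nhds (ENNReal.pow_pos hr 2))).exists
  let P : H →L[ℂ] H := ∑ i ∈ s, (innerSL ℂ (b i)).smulRight (b i)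
  have hP : ∀ x, P x = ∑ i ∈ s, inner ℂ (b i) x • b i := by
    intro x; simp [P]
  have hPsymm : ∀ x y, inner ℂ (P x) y = inner ℂ x (P y) := by
    intro x y
    simp only [hP, sum_inner, inner_sum, inner_smul_left, inner_smul_right]
    refine Finset.sum_congr rfl fun i _ => ?_
    rw [inner_conj_symm, mul_comm]
  have hPb : ∀ i, P (b i) = if i ∈ s then b i else 0 := by
    intro i
    rw [hP]
    simp only [orthonormal_iff_ite.1 b.orthonormal, ite_smul, one_smul, zero_smul]
    simp
  refine ⟨P ∘L T, ?_, ?_⟩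
  · let V : Submodule ℂ H := Submodule.span ℂ ((s.image b : Finset H) : Set H)
    have : FiniteDimensional ℂ V := FiniteDimensional.span_finset ℂ _
    refine Submodule.finiteDimensional_of_le (S₂ := V) ?_
    rintro _ ⟨x, rfl⟩
    change P (T x) ∈ V
    rw [hP]
    refine Submodule.sum_mem _ fun i hi => Submodule.smul_mem _ _ (Submodule.subset_span ?_)
    simpa using ⟨i, i.2, hi, rfl⟩
  · rw [hsNorm_sub_comm]
    have hadj : ∀ i, ContinuousLinearMap.adjoint (T - P ∘L T) (b i)
        = if i ∈ s then 0 else ContinuousLinearMap.adjoint T (b i) := by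
      intro i
      refine ext_inner_right ℂ fun y => ?_
      rw [ContinuousLinearMap.adjoint_inner_left]
      have : inner ℂ (b i) ((T - P ∘L T) y) = inner ℂ (b i - P (b i)) (T y) := by
        simp only [_root_.sub_apply, ContinuousLinearMap.comp_apply, inner_sub_right,
          inner_sub_left, hPsymm]
      rw [this, hPb]
      split_ifs
      · simp
      · rw [sub_zero, ContinuousLinearMap.adjoint_inner_left]
    have h1 := hsNorm_sq_le_tsum_adjoint b (T - P ∘L T)
    have h2 : ∑' i, ‖ContinuousLinearMap.adjoint (T - P ∘L T) (b i)‖ₑ ^ 2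
        = ∑' i : {x // x ∉ s}, ‖ContinuousLinearMap.adjoint T (b i)‖ₑ ^ 2 := by
      rw [← tsum_subtype_eq_of_support_subset (s := {x | x ∉ s})]
      · refine tsum_congr fun i => ?_
        have : (i : w) ∉ s := i.2
        rw [hadj, if_neg this]
      · intro i hi h
        apply hi
        simp only [hadj]
        rw [if_pos (by simpa using h)]
        simp
    rw [h2] at h1
    exact (ENNReal.pow_right_strictMono (two_ne_zero)).lt_iff_lt.1 (h1.trans_lt hs)

end HilbertSchmidt

/-! ### The 2-modified determinant in finite dimensions -/

section FiniteDimensional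

open scoped ComplexOrder in
/-- The bound `|det(1 + M) e^{-tr M}| ≤ exp(‖M‖² / 2)` with the Frobenius norm. The eigenvalues
`p` of `(1 + M)ᴴ (1 + M)` satisfy `0 ≤ p ≤ e^{p - 1}`, so its determinant is at most the
exponential of `tr ((1 + M)ᴴ (1 + M) - 1)`. -/
lemma norm_det_one_add_mul_exp_neg_trace_le {m : Type*} [Fintype m] [DecidableEq m]
    (M : Matrix m m ℂ) :
    ‖(1 + M).det * Complex.exp (-M.trace)‖ ≤ Real.exp ((∑ j, ∑ i, ‖M i j‖ ^ 2) / 2) := by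
  have hP : ((1 + M).conjTranspose * (1 + M)).PosSemidef :=
    Matrix.posSemidef_conjTranspose_mul_self _
  have h1 : (((1 + M).conjTranspose * (1 + M)).det) = ((‖(1 + M).det‖ ^ 2 : ℝ) : ℂ) := by
    rw [Matrix.det_mul, Matrix.det_conjTranspose]
    have := Complex.conj_mul' (1 + M).det
    rw [← starRingEnd_apply, this]; norm_cast
  have htr : ((1 + M).conjTranspose * (1 + M)).trace
      = ((Fintype.card m + 2 * M.trace.re + ∑ j, ∑ i, ‖M i j‖ ^ 2 : ℝ) : ℂ) := by
    have e : (1 + M).conjTranspose * (1 + M) = 1 + M + M.conjTranspose + M.conjTranspose * M := by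
      rw [Matrix.conjTranspose_add, Matrix.conjTranspose_one]; noncomm_ring
    have e2 : (M.conjTranspose * M).trace = ((∑ j, ∑ i, ‖M i j‖ ^ 2 : ℝ) : ℂ) := by
      simp only [Matrix.trace, Matrix.diag, Matrix.mul_apply, Matrix.conjTranspose_apply]
      push_cast
      refine Finset.sum_congr rfl fun j _ => Finset.sum_congr rfl fun i _ => ?_
      exact Complex.conj_mul' _
    have e3 : M.trace + star M.trace = ((2 * M.trace.re : ℝ) : ℂ) := Complex.add_conj _
    rw [e, Matrix.trace_add, Matrix.trace_add, Matrix.trace_add, Matrix.trace_one, e2,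
      Matrix.trace_conjTranspose, add_assoc (Fintype.card m : ℂ), e3]
    push_cast; ring
  have h2 := hP.1.det_eq_prod_eigenvalues
  have h3 := hP.1.trace_eq_sum_eigenvalues
  rw [h1] at h2
  rw [htr] at h3
  have h2' : ‖(1 + M).det‖ ^ 2 = ∏ i, hP.1.eigenvalues i := by
    apply Complex.ofReal_injective; rw [h2]; push_cast; rfl
  have h3' : (Fintype.card m + 2 * M.trace.re + ∑ j, ∑ i, ‖M i j‖ ^ 2 : ℝ)
      = ∑ i, hP.1.eigenvalues i := by
    apply Complex.ofReal_injective; rw [h3]; push_cast; rfl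
  have h4 : ‖(1 + M).det‖ ^ 2 ≤ Real.exp (2 * M.trace.re + ∑ j, ∑ i, ‖M i j‖ ^ 2) := by
    rw [h2']
    calc ∏ i, hP.1.eigenvalues i ≤ ∏ i, Real.exp (hP.1.eigenvalues i - 1) := by
          refine Finset.prod_le_prod (fun i _ => hP.eigenvalues_nonneg i) fun i _ => ?_
          have := Real.add_one_le_exp (hP.1.eigenvalues i - 1)
          linarith
      _ = Real.exp (2 * M.trace.re + ∑ j, ∑ i, ‖M i j‖ ^ 2) := by
          rw [← Real.exp_sum, Finset.sum_sub_distrib, ← h3']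
          congr 1
          simp; ring
  have h5 : ‖Complex.exp (-M.trace)‖ ^ 2 = Real.exp (-(2 * M.trace.re)) := by
    rw [Complex.norm_exp, ← Real.exp_nat_mul]; congr 1; simp
  refine le_of_sq_le_sq ?_ (Real.exp_pos _).le
  rw [norm_mul, mul_pow, h5, ← Real.exp_nat_mul]
  calc _ ≤ Real.exp (2 * M.trace.re + ∑ j, ∑ i, ‖M i j‖ ^ 2) * Real.exp (-(2 * M.trace.re)) := by
        gcongr
    _ = _ := by rw [← Real.exp_add]; congr 1; push_cast; ring

variable {V : Type*} [NormedAddCommGroup V] [InnerProductSpace ℂ V]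
  {ι : Type*} [Fintype ι]

lemma sum_norm_toMatrix_sq [DecidableEq ι] (b : OrthonormalBasis ι ℂ V) (T : V →ₗ[ℂ] V) :
    ∑ j, ∑ i, ‖LinearMap.toMatrix b.toBasis b.toBasis T i j‖ ^ 2 = ∑ j, ‖T (b j)‖ ^ 2 := by
  refine Finset.sum_congr rfl fun j _ => ?_
  rw [← b.sum_sq_norm_inner_right (T (b j))]
  refine Finset.sum_congr rfl fun i _ => ?_
  rw [LinearMap.toMatrix_apply, b.coe_toBasis, b.coe_toBasis_repr_apply, b.repr_apply_apply]

lemma norm_det_mul_exp_le (b : OrthonormalBasis ι ℂ V) (T : V →ₗ[ℂ] V) :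
    ‖LinearMap.det (LinearMap.id + T) * Complex.exp (-LinearMap.trace ℂ V T)‖ ≤
      Real.exp ((∑ j, ‖T (b j)‖ ^ 2) / 2) := by
  classical
  rw [← sum_norm_toMatrix_sq, ← LinearMap.det_toMatrix b.toBasis,
    LinearMap.trace_eq_matrix_trace ℂ b.toBasis, map_add, LinearMap.toMatrix_id]
  exact norm_det_one_add_mul_exp_neg_trace_le _

lemma norm_trace_comp_le (b : OrthonormalBasis ι ℂ V) (S T : V →ₗ[ℂ] V) :
    ‖LinearMap.trace ℂ V (S ∘ₗ T)‖ ≤ (∑ j, ‖S (b j)‖ ^ 2 + ∑ j, ‖T (b j)‖ ^ 2) / 2 := by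
  classical
  rw [LinearMap.trace_eq_matrix_trace ℂ b.toBasis, LinearMap.toMatrix_comp _ b.toBasis,
    ← sum_norm_toMatrix_sq, ← sum_norm_toMatrix_sq]
  set A := LinearMap.toMatrix b.toBasis b.toBasis S
  set B := LinearMap.toMatrix b.toBasis b.toBasis T
  have e : ∑ j, ∑ i, ‖A i j‖ ^ 2 = ∑ i, ∑ j, ‖A i j‖ ^ 2 := Finset.sum_comm
  rw [e, ← Finset.sum_add_distrib, Finset.sum_div]
  simp only [Matrix.trace, Matrix.diag, Matrix.mul_apply]
  refine (norm_sum_le _ _).trans (Finset.sum_le_sum fun i _ => ?_)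
  refine (norm_sum_le _ _).trans ?_
  rw [← Finset.sum_add_distrib, Finset.sum_div]
  refine Finset.sum_le_sum fun j _ => ?_
  rw [norm_mul]
  nlinarith [sq_nonneg (‖A i j‖ - ‖B j i‖)]

/-- If `1 + T` is bounded below, then `det(1 + T) e^{-tr T}` is bounded below in terms of the
Hilbert–Schmidt norm of `T`: with `1 + S = (1 + T)⁻¹` one has `T + S = -T S`, hence
`det(1 + T) e^{-tr T} · det(1 + S) e^{-tr S} = e^{tr (T S)}`, and the second factor is bounded. -/
lemma exp_neg_le_norm_det_mul_exp (b : OrthonormalBasis ι ℂ V) (T : V →ₗ[ℂ] V) {c : ℝ}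
    (hc : 0 < c) (hT : ∀ x, c * ‖x‖ ≤ ‖x + T x‖) :
    Real.exp (-((∑ j, ‖T (b j)‖ ^ 2) / 2 + (∑ j, ‖T (b j)‖ ^ 2) / c ^ 2)) ≤
      ‖LinearMap.det (LinearMap.id + T) * Complex.exp (-LinearMap.trace ℂ V T)‖ := by
  have : FiniteDimensional ℂ V := b.toBasis.finiteDimensional_of_finite
  set s := ∑ j, ‖T (b j)‖ ^ 2 with hs
  have hinj : Function.Injective (LinearMap.id + T : V →ₗ[ℂ] V) := by
    rw [← LinearMap.ker_eq_bot, LinearMap.ker_eq_bot']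
    intro x hx
    have h1 := hT x
    have h2 : x + T x = 0 := hx
    rw [h2, norm_zero] at h1
    exact norm_le_zero_iff.1 (by nlinarith [norm_nonneg x])
  let e := LinearEquiv.ofInjectiveEndo _ hinj
  have he : ∀ x, e x = x + T x := fun x => rfl
  let S : V →ₗ[ℂ] V := (e.symm : V →ₗ[ℂ] V) - LinearMap.id
  have hS : LinearMap.id + S = (e.symm : V →ₗ[ℂ] V) := by simp [S]
  have hcomp : (LinearMap.id + T) ∘ₗ (LinearMap.id + S) = LinearMap.id := by
    rw [hS]; ext x
    exact e.apply_symm_apply x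
  have hdet : LinearMap.det (LinearMap.id + T) * LinearMap.det (LinearMap.id + S) = 1 := by
    rw [← LinearMap.det_comp, hcomp, LinearMap.det_id]
  have hsum : T + S = -(T ∘ₗ S) := by
    have : (LinearMap.id + T) ∘ₗ (LinearMap.id + S) = LinearMap.id + (T + S + T ∘ₗ S) := by
      ext x; simp; abel
    rw [this] at hcomp
    exact eq_neg_of_add_eq_zero_left (add_eq_left.1 hcomp)
  have htr : LinearMap.trace ℂ V T + LinearMap.trace ℂ V S
      = -LinearMap.trace ℂ V (T ∘ₗ S) := by rw [← map_add, hsum, map_neg]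
  have hSb : ∑ j, ‖S (b j)‖ ^ 2 ≤ s / c ^ 2 := by
    rw [hs, Finset.sum_div]
    refine Finset.sum_le_sum fun j _ => ?_
    have h1 : S (b j) = -e.symm (T (b j)) := by
      apply e.injective
      have hSj : S (b j) = e.symm (b j) - b j := rfl
      rw [map_neg, e.apply_symm_apply, hSj, map_sub, e.apply_symm_apply, he]
      abel
    have h2 := hT (e.symm (T (b j)))
    rw [← he, e.apply_symm_apply] at h2
    rw [h1, norm_neg, le_div_iff₀ (by positivity), ← mul_pow]
    gcongr
    linarith
  have hB := norm_det_mul_exp_le b S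
  have hC := norm_trace_comp_le b T S
  set X := LinearMap.det (LinearMap.id + T) * Complex.exp (-LinearMap.trace ℂ V T)
  set Y := LinearMap.det (LinearMap.id + S) * Complex.exp (-LinearMap.trace ℂ V S)
  have hXY : X * Y = Complex.exp (LinearMap.trace ℂ V (T ∘ₗ S)) := by
    have : X * Y = (LinearMap.det (LinearMap.id + T) * LinearMap.det (LinearMap.id + S)) *
      Complex.exp (-(LinearMap.trace ℂ V T + LinearMap.trace ℂ V S)) := by
      rw [neg_add, Complex.exp_add]; ring
    rw [this, hdet, htr, one_mul, neg_neg]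
  have hlow : Real.exp (-((s + s / c ^ 2) / 2)) ≤ ‖X‖ * ‖Y‖ := by
    rw [← norm_mul, hXY, Complex.norm_exp]
    apply Real.exp_le_exp.2
    have := (abs_le.1 (Complex.abs_re_le_norm (LinearMap.trace ℂ V (T ∘ₗ S)))).1
    linarith
  have hY : ‖Y‖ ≤ Real.exp (s / c ^ 2 / 2) := hB.trans (Real.exp_le_exp.2 (by linarith))
  have h6 : Real.exp (-(s / 2 + s / c ^ 2)) * Real.exp (s / c ^ 2 / 2)
      ≤ ‖X‖ * Real.exp (s / c ^ 2 / 2) := by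
    rw [← Real.exp_add]
    refine le_trans (le_of_eq ?_) (hlow.trans (by gcongr))
    congr 1; ring
  exact le_of_mul_le_mul_right h6 (Real.exp_pos _)

end FiniteDimensional

section DetTwo

lemma det_id_add_comp_comm {V W : Type*} [AddCommGroup V] [Module ℂ V] [AddCommGroup W]
    [Module ℂ W] [FiniteDimensional ℂ V] [FiniteDimensional ℂ W]
    (f : V →ₗ[ℂ] W) (g : W →ₗ[ℂ] V) :
    LinearMap.det (LinearMap.id + g ∘ₗ f) = LinearMap.det (LinearMap.id + f ∘ₗ g) := by
  let b := Module.finBasis ℂ V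
  let c := Module.finBasis ℂ W
  rw [← LinearMap.det_toMatrix b, ← LinearMap.det_toMatrix c, map_add, map_add,
    LinearMap.toMatrix_id, LinearMap.toMatrix_id, LinearMap.toMatrix_comp b c b,
    LinearMap.toMatrix_comp c b c, Matrix.det_one_add_mul_comm]

variable {H : Type*} [NormedAddCommGroup H] [InnerProductSpace ℂ H]

/-- The restriction of an operator to a subspace containing its range. -/
def restrictTo (F : H →L[ℂ] H) {V : Submodule ℂ H} (hV : LinearMap.range (F : H →ₗ[ℂ] H) ≤ V) :
    V →ₗ[ℂ] V :=
  (F : H →ₗ[ℂ] H).restrict (fun x _ => hV (LinearMap.mem_range_self (F : H →ₗ[ℂ] H) x))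

lemma coe_restrictTo_apply (F : H →L[ℂ] H) {V : Submodule ℂ H}
    (hV : LinearMap.range (F : H →ₗ[ℂ] H) ≤ V) (x : V) : (restrictTo F hV x : H) = F x := rfl

/-- The range of `F` may be replaced by any larger finite-dimensional space in the definition of
`detTwoFiniteRank F`, since `det(1 + g f) = det(1 + f g)` and `tr (g f) = tr (f g)`. -/
lemma detTwoFiniteRank_eq (F : H →L[ℂ] H) {V : Submodule ℂ H} [FiniteDimensional ℂ V]
    (hV : LinearMap.range (F : H →ₗ[ℂ] H) ≤ V) :
    detTwoFiniteRank F = LinearMap.det (LinearMap.id + restrictTo F hV) *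
      Complex.exp (-LinearMap.trace ℂ V (restrictTo F hV)) := by
  have : FiniteDimensional ℂ (LinearMap.range (F : H →ₗ[ℂ] H)) :=
    Submodule.finiteDimensional_of_le hV
  let i := Submodule.inclusion hV
  let g : V →ₗ[ℂ] LinearMap.range (F : H →ₗ[ℂ] H) :=
    (F : H →ₗ[ℂ] H).rangeRestrict ∘ₗ V.subtype
  have h1 : restrictTo F hV = i ∘ₗ g := rfl
  have h2 : restrictRange F = g ∘ₗ i := rfl
  rw [detTwoFiniteRank, h1, h2, det_id_add_comp_comm i g, LinearMap.trace_comp_comm' i g]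

lemma sum_norm_restrictTo_sq_le {F : H →L[ℂ] H} {V : Submodule ℂ H}
    (hV : LinearMap.range (F : H →ₗ[ℂ] H) ≤ V) {ι : Type*} [Fintype ι]
    (b : OrthonormalBasis ι ℂ V) {r : ℝ} (hr : hsNorm F ≤ ENNReal.ofReal r) :
    ∑ j, ‖restrictTo F hV (b j)‖ ^ 2 ≤ r ^ 2 := by
  have h1 : Orthonormal ℂ (fun j => (b j : H)) := b.orthonormal.comp_linearIsometry V.subtypeₗᵢ
  have h2 := sum_enorm_sq_le_hsNorm_sq F h1 Finset.univ
  have h3 : ∑ j, ‖F (b j)‖ₑ ^ 2 = ENNReal.ofReal (∑ j, ‖F (b j)‖ ^ 2) := by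
    rw [ENNReal.ofReal_sum_of_nonneg (fun _ _ => by positivity)]
    refine Finset.sum_congr rfl fun j _ => ?_
    rw [← ofReal_norm, ENNReal.ofReal_pow (norm_nonneg _)]
  rw [h3] at h2
  rcases le_or_gt 0 r with h0 | h0
  · have h4 : ENNReal.ofReal (∑ j, ‖F (b j)‖ ^ 2) ≤ ENNReal.ofReal (r ^ 2) := by
      refine h2.trans ?_
      rw [ENNReal.ofReal_pow h0]; gcongr
    exact (ENNReal.ofReal_le_ofReal_iff (by positivity)).1 h4
  · rw [ENNReal.ofReal_of_nonpos h0.le, nonpos_iff_eq_zero] at hr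
    rw [hr] at h2
    have h4 : (∑ j, ‖F (b j)‖ ^ 2) ≤ 0 := by simpa using h2
    exact h4.trans (sq_nonneg r)

lemma norm_detTwoFiniteRank_le {F : H →L[ℂ] H}
    (hF : FiniteDimensional ℂ (LinearMap.range (F : H →ₗ[ℂ] H))) {r : ℝ}
    (hr : hsNorm F ≤ ENNReal.ofReal r) : ‖detTwoFiniteRank F‖ ≤ Real.exp (r ^ 2 / 2) := by
  rw [detTwoFiniteRank_eq F le_rfl]
  refine (norm_det_mul_exp_le (stdOrthonormalBasis ℂ _) _).trans (Real.exp_le_exp.2 ?_)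
  have := sum_norm_restrictTo_sq_le (le_refl (LinearMap.range (F : H →ₗ[ℂ] H)))
    (stdOrthonormalBasis ℂ _) hr
  linarith

lemma exp_neg_le_norm_detTwoFiniteRank {F : H →L[ℂ] H}
    (hF : FiniteDimensional ℂ (LinearMap.range (F : H →ₗ[ℂ] H))) {r c : ℝ} (hc : 0 < c)
    (hr : hsNorm F ≤ ENNReal.ofReal r) (hb : ∀ x, c * ‖x‖ ≤ ‖x + F x‖) :
    Real.exp (-(r ^ 2 / 2 + r ^ 2 / c ^ 2)) ≤ ‖detTwoFiniteRank F‖ := by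
  rw [detTwoFiniteRank_eq F le_rfl]
  refine le_trans ?_ (exp_neg_le_norm_det_mul_exp (stdOrthonormalBasis ℂ _) _ hc fun x => hb x)
  have := sum_norm_restrictTo_sq_le (le_refl (LinearMap.range (F : H →ₗ[ℂ] H)))
    (stdOrthonormalBasis ℂ _) hr
  apply Real.exp_le_exp.2
  have h2 := div_le_div_of_nonneg_right this (sq_nonneg c)
  linarith

lemma detTwoFiniteRank_eq_zero {F : H →L[ℂ] H}
    (hF : FiniteDimensional ℂ (LinearMap.range (F : H →ₗ[ℂ] H))) {w : H} (hw : w ≠ 0)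
    (h : F w = -w) : detTwoFiniteRank F = 0 := by
  rw [detTwoFiniteRank_eq F le_rfl]
  have hmem : w ∈ LinearMap.range (F : H →ₗ[ℂ] H) := ⟨-w, by simp [h]⟩
  rw [LinearMap.det_eq_zero_iff_ker_ne_bot.2, zero_mul]
  rw [Submodule.ne_bot_iff]
  refine ⟨⟨w, hmem⟩, ?_, fun h => hw (congrArg Subtype.val h)⟩
  rw [LinearMap.mem_ker]
  ext
  simp [coe_restrictTo_apply, h]

end DetTwo

/-! ### The 2-modified Fredholm determinant -/

section DetTwoLimit

variable {H : Type*} [NormedAddCommGroup H] [InnerProductSpace ℂ H]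

lemma range_add_smul_le {F N : H →L[ℂ] H} {V : Submodule ℂ H}
    (hF : LinearMap.range (F : H →ₗ[ℂ] H) ≤ V) (hN : LinearMap.range (N : H →ₗ[ℂ] H) ≤ V) (z : ℂ) :
    LinearMap.range ((F + z • N : H →L[ℂ] H) : H →ₗ[ℂ] H) ≤ V := by
  rintro _ ⟨x, rfl⟩
  exact V.add_mem (hF ⟨x, rfl⟩) (V.smul_mem z (hN ⟨x, rfl⟩))

lemma differentiable_detTwoFiniteRank_add_smul {F N : H →L[ℂ] H} {V : Submodule ℂ H}
    [FiniteDimensional ℂ V] (hF : LinearMap.range (F : H →ₗ[ℂ] H) ≤ V)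
    (hN : LinearMap.range (N : H →ₗ[ℂ] H) ≤ V) :
    Differentiable ℂ fun z : ℂ => detTwoFiniteRank (F + z • N) := by
  have h1 : ∀ z : ℂ, detTwoFiniteRank (F + z • N)
      = LinearMap.det (LinearMap.id + (restrictTo F hF + z • restrictTo N hN)) *
      Complex.exp (-LinearMap.trace ℂ V (restrictTo F hF + z • restrictTo N hN)) := fun z =>
    detTwoFiniteRank_eq _ (range_add_smul_le hF hN z)
  simp only [h1]
  let b := Module.finBasis ℂ V
  simp only [← LinearMap.det_toMatrix b, map_add, map_smul, Matrix.det_apply, smul_eq_mul]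
  simp only [Matrix.add_apply, Matrix.smul_apply]
  fun_prop

/-- On finite-rank operators, `detTwoFiniteRank` is Lipschitz on balls of the Hilbert–Schmidt norm:
on the complex line through two operators it is an entire function, bounded on a large disc if
the operators are close, and the Schwarz lemma applies. -/
lemma norm_detTwoFiniteRank_sub_le {F F' : H →L[ℂ] H}
    (hF : FiniteDimensional ℂ (LinearMap.range (F : H →ₗ[ℂ] H)))
    (hF' : FiniteDimensional ℂ (LinearMap.range (F' : H →ₗ[ℂ] H))) {r t : ℝ} (hr0 : 0 ≤ r)
    (ht0 : 0 < t) (ht1 : t < 1) (hr : hsNorm F ≤ ENNReal.ofReal r)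
    (ht : hsNorm (F' - F) ≤ ENNReal.ofReal t) :
    ‖detTwoFiniteRank F' - detTwoFiniteRank F‖ ≤ 2 * Real.exp ((r + 1) ^ 2 / 2) * t := by
  let V := LinearMap.range (F : H →ₗ[ℂ] H) ⊔ LinearMap.range (F' : H →ₗ[ℂ] H)
  have hFV : LinearMap.range (F : H →ₗ[ℂ] H) ≤ V := le_sup_left
  have hNV : LinearMap.range ((F' - F : H →L[ℂ] H) : H →ₗ[ℂ] H) ≤ V := by
    rintro _ ⟨x, rfl⟩
    exact V.sub_mem (le_sup_right (a := LinearMap.range (F : H →ₗ[ℂ] H)) ⟨x, rfl⟩)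
      (hFV ⟨x, rfl⟩)
  let f : ℂ → ℂ := fun z => detTwoFiniteRank (F + z • (F' - F))
  have hf : Differentiable ℂ f := differentiable_detTwoFiniteRank_add_smul hFV hNV
  have hbound : ∀ z ∈ Metric.ball (0 : ℂ) (1 / t), ‖f z‖ ≤ Real.exp ((r + 1) ^ 2 / 2) := by
    intro z hz
    refine norm_detTwoFiniteRank_le
      (Submodule.finiteDimensional_of_le (range_add_smul_le hFV hNV z)) ?_
    rw [mem_ball_zero_iff, lt_div_iff₀ ht0] at hz
    calc hsNorm (F + z • (F' - F)) ≤ hsNorm F + ‖z‖ₑ * hsNorm (F' - F) :=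
          (hsNorm_add_le _ _).trans (by gcongr; exact hsNorm_smul_le _ _)
      _ ≤ ENNReal.ofReal r + ENNReal.ofReal ‖z‖ * ENNReal.ofReal t := by
          rw [← ofReal_norm]; gcongr
      _ = ENNReal.ofReal (r + ‖z‖ * t) := by
          rw [← ENNReal.ofReal_mul (norm_nonneg _), ENNReal.ofReal_add hr0 (by positivity)]
      _ ≤ ENNReal.ofReal (r + 1) := ENNReal.ofReal_le_ofReal (by linarith)
  have h1t : (1 : ℝ) < 1 / t := by rw [lt_div_iff₀ ht0]; linarith
  have h0 : (0 : ℂ) ∈ Metric.ball (0 : ℂ) (1 / t) := by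
    rw [mem_ball_zero_iff, norm_zero]; positivity
  have h1 : (1 : ℂ) ∈ Metric.ball (0 : ℂ) (1 / t) := by
    rw [mem_ball_zero_iff, norm_one]; exact h1t
  have hmaps : Set.MapsTo f (Metric.ball 0 (1 / t))
      (Metric.closedBall (f 0) (2 * Real.exp ((r + 1) ^ 2 / 2))) := by
    intro z hz
    rw [mem_closedBall_iff_norm]
    refine (norm_sub_le _ _).trans ?_
    linarith [hbound z hz, hbound 0 h0]
  have key := Complex.dist_le_div_mul_dist_of_mapsTo_ball hf.differentiableOn hmaps h1
  have e0 : f 0 = detTwoFiniteRank F := by simp [f]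
  have e1 : f 1 = detTwoFiniteRank F' := by simp [f]
  rw [e0, e1, dist_eq_norm, dist_zero_right, norm_one, mul_one] at key
  refine key.trans (le_of_eq ?_)
  field_simp

lemma finiteRankNhds_basis_mem (K : H →L[ℂ] H) {r : ℝ≥0∞} (hr : 0 < r) :
    {F : H →L[ℂ] H | hsNorm (F - K) < r ∧
      FiniteDimensional ℂ (LinearMap.range (F : H →ₗ[ℂ] H))} ∈ finiteRankNhds K := by
  refine inter_mem_inf ?_ (mem_principal_self _)
  exact preimage_mem_comap (gt_mem_nhds hr)

lemma exists_of_mem_finiteRankNhds {K : H →L[ℂ] H} {s : Set (H →L[ℂ] H)}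
    (hs : s ∈ finiteRankNhds K) : ∃ r : ℝ≥0∞, 0 < r ∧ ∀ F : H →L[ℂ] H, hsNorm (F - K) < r →
      FiniteDimensional ℂ (LinearMap.range (F : H →ₗ[ℂ] H)) → F ∈ s := by
  rw [finiteRankNhds, mem_inf_principal, mem_comap] at hs
  obtain ⟨t, ht, hts⟩ := hs
  obtain ⟨r, hr, hrt⟩ := ENNReal.nhds_zero_basis.mem_iff.1 ht
  exact ⟨r, hr, fun F h1 h2 => hts (hrt h1) h2⟩

lemma hsNorm_le_of_sub_le {F K : H →L[ℂ] H} (hK : IsHilbertSchmidt K)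
    (h : hsNorm (F - K) ≤ 1) : hsNorm F ≤ ENNReal.ofReal ((hsNorm K).toReal + 1) := by
  rw [ENNReal.ofReal_add ENNReal.toReal_nonneg zero_le_one, ENNReal.ofReal_toReal hK.ne,
    ENNReal.ofReal_one]
  calc hsNorm F = hsNorm (K + (F - K)) := by congr 1; abel
    _ ≤ _ := (hsNorm_add_le _ _).trans (by gcongr)

variable [CompleteSpace H]

lemma neBot_finiteRankNhds {K : H →L[ℂ] H} (hK : IsHilbertSchmidt K) :
    (finiteRankNhds K).NeBot := by
  refine neBot_iff.2 fun h => ?_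
  obtain ⟨r, hr, h1⟩ := exists_of_mem_finiteRankNhds (h ▸ mem_bot : (∅ : Set _) ∈ finiteRankNhds K)
  obtain ⟨F, hF, hFr⟩ := exists_finiteRank_hsNorm_sub_lt hK hr
  exact h1 F hFr hF

/-- The limit defining `detTwo K` exists for every Hilbert–Schmidt operator `K`. -/
lemma tendsto_detTwo {K : H →L[ℂ] H} (hK : IsHilbertSchmidt K) :
    Tendsto detTwoFiniteRank (finiteRankNhds K) (𝓝 (detTwo K)) := by
  have := neBot_finiteRankNhds hK
  have hc : Cauchy (map detTwoFiniteRank (finiteRankNhds K)) := by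
    refine Metric.cauchy_iff.2 ⟨inferInstance, fun ε hε => ?_⟩
    set r := (hsNorm K).toReal + 1 with hr
    have hr0 : 0 ≤ r := by positivity
    set E := 2 * Real.exp ((r + 1) ^ 2 / 2) with hE
    have hE0 : 0 < E := by positivity
    let t := min (1 / 2) (ε / (2 * E))
    have ht0 : 0 < t := by positivity
    have ht1 : t < 1 := (min_le_left _ _).trans_lt (by norm_num)
    have hEt : E * t < ε := by
      have : t ≤ ε / (2 * E) := min_le_right _ _
      calc E * t ≤ E * (ε / (2 * E)) := by gcongr
        _ = ε / 2 := by field_simp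
        _ < ε := by linarith
    refine ⟨_, image_mem_map (finiteRankNhds_basis_mem K
      (r := ENNReal.ofReal (t / 2)) (by simpa using ht0)), ?_⟩
    rintro _ ⟨F, ⟨h1, h2⟩, rfl⟩ _ ⟨F', ⟨h1', h2'⟩, rfl⟩
    rw [dist_comm, dist_eq_norm]
    refine (norm_detTwoFiniteRank_sub_le h2 h2' hr0 ht0 ht1 (hsNorm_le_of_sub_le hK ?_) ?_).trans_lt
      hEt
    · refine h1.le.trans ?_
      rw [← ENNReal.ofReal_one]; exact ENNReal.ofReal_le_ofReal (by linarith)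
    · calc hsNorm (F' - F) = hsNorm ((F' - K) + (K - F)) := by congr 1; abel
        _ ≤ hsNorm (F' - K) + hsNorm (F - K) := by
            rw [hsNorm_sub_comm F K]; exact hsNorm_add_le _ _
        _ ≤ ENNReal.ofReal (t / 2) + ENNReal.ofReal (t / 2) := by gcongr
        _ = ENNReal.ofReal t := by
            rw [← ENNReal.ofReal_add (by positivity) (by positivity)]; congr 1; ring
  obtain ⟨x, hx⟩ := CompleteSpace.complete hc
  exact tendsto_nhds_limUnder ⟨x, hx⟩

lemma isCompactOperator_of_isHilbertSchmidt {K : H →L[ℂ] H} (hK : IsHilbertSchmidt K) :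
    IsCompactOperator K := by
  have := neBot_finiteRankNhds hK
  refine isCompactOperator_of_tendsto (F := fun F => F) (l := finiteRankNhds K) ?_ ?_
  · rw [EMetric.tendsto_nhds]
    intro ε hε
    filter_upwards [finiteRankNhds_basis_mem K hε] with F hF
    rw [edist_eq_enorm_sub]
    exact (enorm_le_hsNorm _).trans_lt hF.1
  · filter_upwards [finiteRankNhds_basis_mem K zero_lt_one] with F hF
    have := hF.2
    have : ProperSpace (LinearMap.range (F : H →ₗ[ℂ] H)) := FiniteDimensional.proper ℂ _
    have h1 : IsCompactOperator (F.rangeRestrict) :=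
      isCompactOperator_of_locallyCompactSpace_dom F.rangeRestrict
    exact h1.clm_comp (LinearMap.range (F : H →ₗ[ℂ] H)).subtypeL

/-- `det₂(I + K)` vanishes exactly if `-1` is an eigenvalue of `K`. -/
lemma detTwo_eq_zero_iff {K : H →L[ℂ] H} (hK : IsHilbertSchmidt K) :
    detTwo K = 0 ↔ ∃ w, w ≠ 0 ∧ K w = -w := by
  have := neBot_finiteRankNhds hK
  have hlim := tendsto_detTwo hK
  constructor
  · contrapose!
    intro h
    have hne : ¬ Module.End.HasEigenvalue (K : Module.End ℂ H) (-1) := by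
      intro h1
      obtain ⟨w, hw⟩ := h1.exists_hasEigenvector
      refine h w hw.2 ?_
      simpa using hw.apply_eq_smul
    obtain ⟨c, hc⟩ := (isCompactOperator_of_isHilbertSchmidt hK).antilipschitz_of_not_hasEigenvalue
      (neg_ne_zero.2 one_ne_zero) hne
    have hlow : ∃ c : ℝ, 0 < c ∧ ∀ x, c * ‖x‖ ≤ ‖x + K x‖ := by
      refine ⟨((c : ℝ) + 1)⁻¹, by positivity, fun x => ?_⟩
      have h1 := hc.le_mul_dist x 0
      simp only [dist_zero_right, map_zero] at h1
      have h2 : (K - (-1 : ℂ) • 1 : H →L[ℂ] H) x = x + K x := by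
        simp [add_comm]
      rw [h2] at h1
      rw [inv_mul_le_iff₀ (by positivity)]
      nlinarith [norm_nonneg (x + K x)]
    obtain ⟨c, hc, hlow⟩ := hlow
    intro h0
    set r := (hsNorm K).toReal + 1
    set A := Real.exp (-(r ^ 2 / 2 + r ^ 2 / (c / 2) ^ 2))
    have hev : ∀ᶠ F in finiteRankNhds K, A ≤ ‖detTwoFiniteRank F‖ := by
      filter_upwards [finiteRankNhds_basis_mem K (r := ENNReal.ofReal (min 1 (c / 2)))
        (by simpa using hc)] with F hF
      refine exp_neg_le_norm_detTwoFiniteRank hF.2 (by positivity) (hsNorm_le_of_sub_le hK ?_) ?_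
      · refine hF.1.le.trans ?_
        rw [← ENNReal.ofReal_one]; exact ENNReal.ofReal_le_ofReal (min_le_left _ _)
      · intro x
        have h1 : ‖F - K‖ ≤ c / 2 := by
          have h2 := ((enorm_le_hsNorm _).trans hF.1.le).trans
            (ENNReal.ofReal_le_ofReal (min_le_right 1 (c / 2)))
          rwa [← ofReal_norm, ENNReal.ofReal_le_ofReal_iff (by positivity)] at h2
        have h3 : ‖(F - K) x‖ ≤ c / 2 * ‖x‖ := (F - K).le_of_opNorm_le h1 x
        have h4 : x + K x = (x + F x) - (F - K) x := by
          rw [_root_.sub_apply]; abel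
        have h5 := hlow x
        rw [h4] at h5
        have h6 := norm_sub_le (x + F x) ((F - K) x)
        linarith
    have h1 := ge_of_tendsto hlim.norm hev
    rw [h0, norm_zero] at h1
    exact absurd h1 (not_le.2 (Real.exp_pos _))
  · rintro ⟨w, hw, hKw⟩
    have hwn : ‖w‖ ≠ 0 := norm_ne_zero_iff.2 hw
    by_contra h0
    have hev := hlim.eventually (isOpen_ne.mem_nhds h0)
    obtain ⟨r, hr, hr2⟩ := exists_of_mem_finiteRankNhds hev
    obtain ⟨F, hF, hFr⟩ := exists_finiteRank_hsNorm_sub_lt hK (ENNReal.half_pos hr.ne')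
    -- Correct `F` by a rank-one operator, so that `w` becomes an eigenvector.
    let c : ℂ := ((‖w‖ ^ 2 : ℝ) : ℂ)⁻¹
    let R : H →L[ℂ] H := c • (innerSL ℂ w).smulRight ((K - F) w)
    have hRw : R w = (K - F) w := by
      have e2 : inner ℂ w w = ((‖w‖ ^ 2 : ℝ) : ℂ) := by
        rw [inner_self_eq_norm_sq_to_K]; norm_cast
      have e3 : ((‖w‖ ^ 2 : ℝ) : ℂ) ≠ 0 := by
        exact_mod_cast pow_ne_zero 2 hwn
      simp only [R, c, _root_.smul_apply, ContinuousLinearMap.smulRight_apply, innerSL_apply_apply,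
        smul_smul, e2, inv_mul_cancel₀ e3, one_smul]
    have hR : hsNorm R ≤ hsNorm (F - K) := by
      have h1 : ‖c‖ₑ * (‖w‖ₑ * ‖w‖ₑ) = 1 := by
        rw [← ofReal_norm, ← ofReal_norm, ← ENNReal.ofReal_mul (norm_nonneg _),
          ← ENNReal.ofReal_mul (norm_nonneg _)]
        have : ‖c‖ * (‖w‖ * ‖w‖) = 1 := by
          simp only [c, norm_inv, Complex.norm_real, norm_pow, norm_norm]
          field_simp
        rw [this, ENNReal.ofReal_one]
      calc hsNorm R ≤ ‖c‖ₑ * (‖w‖ₑ * ‖(K - F) w‖ₑ) :=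
            (hsNorm_smul_le _ _).trans (by gcongr; exact hsNorm_smulRight_innerSL_le _ _)
        _ ≤ ‖c‖ₑ * (‖w‖ₑ * (hsNorm (K - F) * ‖w‖ₑ)) := by
            gcongr; exact enorm_apply_le_hsNorm _ _
        _ = (‖c‖ₑ * (‖w‖ₑ * ‖w‖ₑ)) * hsNorm (K - F) := by ring
        _ = _ := by rw [h1, one_mul, hsNorm_sub_comm]
    have hfin : FiniteDimensional ℂ (LinearMap.range ((F + R : H →L[ℂ] H) : H →ₗ[ℂ] H)) := by
      refine Submodule.finiteDimensional_of_le
        (S₂ := LinearMap.range (F : H →ₗ[ℂ] H) ⊔ Submodule.span ℂ {(K - F) w}) ?_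
      rintro _ ⟨x, rfl⟩
      refine Submodule.add_mem_sup ⟨x, rfl⟩ ?_
      exact Submodule.smul_mem _ _ (Submodule.smul_mem _ _ (Submodule.mem_span_singleton_self _))
    refine hr2 (F + R) ?_ hfin (detTwoFiniteRank_eq_zero hfin hw ?_)
    · calc hsNorm (F + R - K) = hsNorm ((F - K) + R) := by congr 1; abel
        _ ≤ hsNorm (F - K) + hsNorm (F - K) := (hsNorm_add_le _ _).trans (by gcongr)
        _ < r / 2 + r / 2 := ENNReal.add_lt_add hFr hFr
        _ = r := ENNReal.add_halves r
    · rw [_root_.add_apply, hRw, _root_.sub_apply, hKw]; abel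

end DetTwoLimit

/-! ### Convolution operators on `L²` -/

section Convolution

variable {E : Type*} [NormedAddCommGroup E] [NormedSpace ℂ E]

lemma memLp_comp_sub_left {g : ℝ → ℂ} (hg : MemLp g 2 (volume : Measure ℝ)) (x : ℝ) :
    MemLp (fun y => g (x - y)) 2 (volume : Measure ℝ) :=
  hg.comp_measurePreserving (Measure.measurePreserving_sub_left volume x)

lemma integrable_conv {g : ℝ → ℂ} (hg : MemLp g 2 (volume : Measure ℝ)) {f : ℝ → E}
    (hf : MemLp f 2 (volume : Measure ℝ)) (x : ℝ) : Integrable (fun y => g (x - y) • f y) :=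
  memLp_one_iff_integrable.1 (hf.smul (memLp_comp_sub_left hg x))

lemma integral_norm_conv_le {g : ℝ → ℂ} (hg : MemLp g 2 (volume : Measure ℝ)) {f : ℝ → E}
    (hf : MemLp f 2 (volume : Measure ℝ)) (x : ℝ) :
    ∫ y, ‖g (x - y) • f y‖ ≤ (∫ y, ‖g y‖ ^ 2) + ∫ y, ‖f y‖ ^ 2 := by
  have hg2 := memLp_comp_sub_left hg x
  have e : ∫ y, ‖g y‖ ^ 2 = ∫ y, ‖g (x - y)‖ ^ 2 :=
    (integral_sub_left_eq_self (fun y => ‖g y‖ ^ 2) volume x).symm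
  have h1 := (memLp_two_iff_integrable_sq_norm hg2.1).1 hg2
  have h2 := (memLp_two_iff_integrable_sq_norm hf.1).1 hf
  rw [e, ← integral_add h1 h2]
  refine integral_mono (integrable_conv hg hf x).norm (h1.add h2) fun y => ?_
  simp only [norm_smul]
  nlinarith [sq_nonneg (‖g (x - y)‖ - ‖f y‖), sq_nonneg (‖g (x - y)‖), sq_nonneg ‖f y‖]

lemma aestronglyMeasurable_conv_integrand {g : ℝ → ℂ}
    (hg : AEStronglyMeasurable g (volume : Measure ℝ)) {f : ℝ → E}
    (hf : AEStronglyMeasurable f (volume : Measure ℝ)) :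
    AEStronglyMeasurable (fun p : ℝ × ℝ => g (p.1 - p.2) • f p.2)
      ((volume : Measure ℝ).prod volume) :=
  (hg.comp_quasiMeasurePreserving
    (quasiMeasurePreserving_sub_of_right_invariant volume volume)).smul hf.comp_snd

lemma lintegral_conv_sq_le {g : ℝ → ℂ} (hg : AEStronglyMeasurable g (volume : Measure ℝ))
    {f : ℝ → E} (hf : AEStronglyMeasurable f (volume : Measure ℝ)) :
    ∫⁻ x, ‖∫ y, g (x - y) • f y‖ₑ ^ 2 ≤ (∫⁻ y, ‖g y‖ₑ) ^ 2 * ∫⁻ y, ‖f y‖ₑ ^ 2 := by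
  have e2 : ∀ x : ℝ≥0∞, x ^ (2 : ℝ) = x ^ 2 := fun x => ENNReal.rpow_natCast x 2
  have hgx : ∀ x, AEMeasurable (fun y => ‖g (x - y)‖ₑ) volume := fun x =>
    (hg.comp_quasiMeasurePreserving
      (quasiMeasurePreserving_sub_left_of_right_invariant volume x)).enorm
  have hsqrt : ∀ a : ℝ≥0∞, (a ^ (1 / 2 : ℝ)) ^ 2 = a := fun a => by
    rw [← ENNReal.rpow_natCast, ← ENNReal.rpow_mul]; norm_num
  have hG : ∀ x, ∫⁻ y, ‖g (x - y)‖ₑ = ∫⁻ y, ‖g y‖ₑ := fun x =>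
    lintegral_sub_left_eq_self (fun y => ‖g y‖ₑ) x
  -- The Cauchy–Schwarz inequality with respect to the weight `‖g (x - y)‖`.
  have hpt : ∀ x, ‖∫ y, g (x - y) • f y‖ₑ ^ 2
      ≤ (∫⁻ y, ‖g y‖ₑ) * ∫⁻ y, ‖g (x - y)‖ₑ * ‖f y‖ₑ ^ 2 := by
    intro x
    have h1 : ‖∫ y, g (x - y) • f y‖ₑ ≤ ∫⁻ y, (‖g (x - y)‖ₑ ^ (1 / 2 : ℝ)) *
        (‖g (x - y)‖ₑ ^ (1 / 2 : ℝ) * ‖f y‖ₑ) := by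
      refine (enorm_integral_le_lintegral_enorm _).trans (le_of_eq (lintegral_congr fun y => ?_))
      rw [enorm_smul, ← mul_assoc, ← ENNReal.rpow_add_of_nonneg _ _ (by norm_num) (by norm_num)]
      norm_num
    have h2 := ENNReal.lintegral_mul_le_Lp_mul_Lq volume Real.HolderConjugate.two_two
      ((hgx x).pow_const (1 / 2 : ℝ)) (((hgx x).pow_const (1 / 2 : ℝ)).mul hf.enorm)
    simp only [e2, hsqrt, mul_pow, Pi.mul_apply] at h2
    calc ‖∫ y, g (x - y) • f y‖ₑ ^ 2 ≤ ((∫⁻ y, ‖g (x - y)‖ₑ) ^ (1 / 2 : ℝ) *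
          (∫⁻ y, ‖g (x - y)‖ₑ * ‖f y‖ₑ ^ 2) ^ (1 / 2 : ℝ)) ^ 2 := by
          gcongr; exact h1.trans h2
      _ = _ := by rw [mul_pow, hsqrt, hsqrt, hG]
  calc ∫⁻ x, ‖∫ y, g (x - y) • f y‖ₑ ^ 2
      ≤ ∫⁻ x, (∫⁻ y, ‖g y‖ₑ) * ∫⁻ y, ‖g (x - y)‖ₑ * ‖f y‖ₑ ^ 2 := lintegral_mono hpt
    _ = (∫⁻ y, ‖g y‖ₑ) * ∫⁻ x, ∫⁻ y, ‖g (x - y)‖ₑ * ‖f y‖ₑ ^ 2 := by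
        refine lintegral_const_mul'' _ ?_
        exact (((hg.comp_quasiMeasurePreserving
          (quasiMeasurePreserving_sub_of_right_invariant volume volume)).enorm).mul
            (hf.comp_snd.enorm.pow_const 2)).lintegral_prod_right'
    _ = (∫⁻ y, ‖g y‖ₑ) * ∫⁻ y, ∫⁻ x, ‖g (x - y)‖ₑ * ‖f y‖ₑ ^ 2 := by
        rw [lintegral_lintegral_swap]
        exact ((hg.comp_quasiMeasurePreserving
          (quasiMeasurePreserving_sub_of_right_invariant volume volume)).enorm).mul
            (hf.comp_snd.enorm.pow_const 2)
    _ = (∫⁻ y, ‖g y‖ₑ) * ∫⁻ y, (∫⁻ z, ‖g z‖ₑ) * ‖f y‖ₑ ^ 2 := by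
        congr 1
        refine lintegral_congr fun y => ?_
        have hy : AEMeasurable (fun x => ‖g (x - y)‖ₑ) volume := (hg.comp_quasiMeasurePreserving
          (measurePreserving_sub_right volume y).quasiMeasurePreserving).enorm
        rw [lintegral_mul_const'' _ hy, lintegral_sub_right_eq_self (fun z => ‖g z‖ₑ) y]
    _ = _ := by
        rw [lintegral_const_mul'' _ (hf.enorm.pow_const 2)]; ring

/-- Young's inequality `‖g * f‖₂ ≤ ‖g‖₁ ‖f‖₂`. -/
lemma eLpNorm_conv_le {g : ℝ → ℂ} (hg : AEStronglyMeasurable g (volume : Measure ℝ))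
    {f : ℝ → E} (hf : AEStronglyMeasurable f (volume : Measure ℝ)) :
    eLpNorm (fun x => ∫ y, g (x - y) • f y) 2 volume
      ≤ (∫⁻ y, ‖g y‖ₑ) * eLpNorm f 2 volume := by
  have e2 : ∀ x : ℝ≥0∞, x ^ (2 : ℝ) = x ^ 2 := fun x => ENNReal.rpow_natCast x 2
  rw [eLpNorm_eq_lintegral_rpow_enorm_toReal (by norm_num) (by norm_num),
    eLpNorm_eq_lintegral_rpow_enorm_toReal (by norm_num) (by norm_num)]
  simp only [ENNReal.toReal_ofNat, e2]
  calc _ ≤ ((∫⁻ y, ‖g y‖ₑ) ^ 2 * ∫⁻ y, ‖f y‖ₑ ^ 2) ^ (1 / 2 : ℝ) := by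
        gcongr; exact lintegral_conv_sq_le hg hf
    _ = _ := by
        rw [ENNReal.mul_rpow_of_nonneg _ _ (by norm_num), ← ENNReal.rpow_natCast,
          ← ENNReal.rpow_mul]
        norm_num

lemma memLp_conv {g : ℝ → ℂ} (hg : Integrable g (volume : Measure ℝ))
    {f : ℝ → E} (hf : MemLp f 2 (volume : Measure ℝ)) :
    MemLp (fun x => ∫ y, g (x - y) • f y) 2 (volume : Measure ℝ) :=
  ⟨(aestronglyMeasurable_conv_integrand hg.1 hf.1).integral_prod_right',
    (eLpNorm_conv_le hg.1 hf.1).trans_lt (ENNReal.mul_lt_top hg.2 hf.2)⟩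

variable {n : Type*} [Fintype n]

/-- Convolution with an integrable and square-integrable function, as an operator on `L²`. -/
def convOp (g : ℝ → ℂ) (hg1 : Integrable g) (hg2 : MemLp g 2 (volume : Measure ℝ)) :
    L2 n →L[ℂ] L2 n :=
  LinearMap.mkContinuous
    { toFun := fun f => (memLp_conv hg1 (Lp.memLp f)).toLp _
      map_add' := by
        intro f f'
        rw [← MemLp.toLp_add]
        refine MemLp.toLp_congr _ _ (Eventually.of_forall fun x => ?_)
        simp only [Pi.add_apply]
        rw [← integral_add (integrable_conv hg2 (Lp.memLp f) x)
          (integrable_conv hg2 (Lp.memLp f') x)]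
        refine integral_congr_ae ?_
        filter_upwards [Lp.coeFn_add f f'] with y hy
        rw [hy, Pi.add_apply, smul_add]
      map_smul' := by
        intro c f
        rw [RingHom.id_apply, ← MemLp.toLp_const_smul]
        refine MemLp.toLp_congr _ _ (Eventually.of_forall fun x => ?_)
        simp only [Pi.smul_apply]
        rw [← integral_smul]
        refine integral_congr_ae ?_
        filter_upwards [Lp.coeFn_smul c f] with y hy
        rw [hy, Pi.smul_apply, smul_comm] }
    (∫⁻ y, ‖g y‖ₑ).toReal
    (by
      intro f
      change ‖(memLp_conv hg1 (Lp.memLp f)).toLp _‖ ≤ _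
      rw [Lp.norm_toLp, Lp.norm_def, ← ENNReal.toReal_mul]
      exact ENNReal.toReal_mono (ENNReal.mul_ne_top hg1.2.ne (Lp.memLp f).2.ne)
        (eLpNorm_conv_le hg1.1 (Lp.memLp f).1))

lemma convOp_apply (g : ℝ → ℂ) (hg1 : Integrable g) (hg2 : MemLp g 2 (volume : Measure ℝ))
    (f : L2 n) : convOp g hg1 hg2 f =ᵐ[volume] fun x => ∫ y, g (x - y) • f y :=
  (memLp_conv hg1 (Lp.memLp f)).coeFn_toLp

lemma hasWeakDeriv_convOp {g : ℝ → ℂ} (hg1 : Integrable g)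
    (hg2 : MemLp g 2 (volume : Measure ℝ)) {d : ℂ}
    (hd : ∀ φ : ℝ → ℝ, ContDiff ℝ ∞ φ → HasCompactSupport φ → ∀ y,
      ∫ x, ((deriv φ x : ℝ) : ℂ) * g (x - y) = φ y - d * ∫ x, (φ x : ℂ) * g (x - y)) (f : L2 n) :
    HasWeakDeriv (convOp g hg1 hg2 f) (d • convOp g hg1 hg2 f - f) := by
  set u := convOp g hg1 hg2 f with hu
  have hua := convOp_apply g hg1 hg2 f
  have hint : ∀ χ : ℝ → ℝ, Continuous χ → HasCompactSupport χ →
      Integrable (fun p : ℝ × ℝ => χ p.1 • g (p.1 - p.2) • f p.2)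
        ((volume : Measure ℝ).prod volume) := by
    intro χ hχ hχc
    have hm : AEStronglyMeasurable (fun p : ℝ × ℝ => χ p.1 • g (p.1 - p.2) • f p.2)
        ((volume : Measure ℝ).prod volume) :=
      (hχ.aestronglyMeasurable.comp_fst).smul
        (aestronglyMeasurable_conv_integrand hg1.1 (Lp.memLp f).1)
    refine (integrable_prod_iff hm).2 ⟨Eventually.of_forall fun x =>
      (integrable_conv hg2 (Lp.memLp f) x).smul (χ x), ?_⟩
    refine Integrable.mono' (((hχ.integrable_of_hasCompactSupport hχc).norm).mul_const
      ((∫ y, ‖g y‖ ^ 2) + ∫ y, ‖f y‖ ^ 2)) hm.norm.integral_prod_right' ?_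
    refine Eventually.of_forall fun x => ?_
    rw [Real.norm_of_nonneg (integral_nonneg fun y => norm_nonneg _)]
    simp only [norm_smul (χ x)]
    rw [integral_const_mul]
    gcongr
    exact integral_norm_conv_le hg2 (Lp.memLp f) x
  have hswap : ∀ χ : ℝ → ℝ, Continuous χ → HasCompactSupport χ →
      ∫ x, χ x • u x = ∫ y, (∫ x, (χ x : ℂ) * g (x - y)) • f y := by
    intro χ hχ hχc
    calc ∫ x, χ x • u x = ∫ x, ∫ y, χ x • g (x - y) • f y := by
          refine integral_congr_ae ?_
          filter_upwards [hua] with x hx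
          rw [hx, integral_smul]
      _ = ∫ y, ∫ x, χ x • g (x - y) • f y := integral_integral_swap (hint χ hχ hχc)
      _ = _ := by
          refine integral_congr_ae (Eventually.of_forall fun y => ?_)
          simp only
          rw [← integral_smul_const]
          refine integral_congr_ae (Eventually.of_forall fun x => ?_)
          simp only
          rw [mul_smul, Complex.coe_smul]
  intro φ h1 h2
  have hφ' : Continuous (deriv φ) := h1.continuous_deriv (by simp)
  have e1 : ∫ x, φ x • (d • u - f : L2 n) x = (d • ∫ x, φ x • u x) - ∫ x, φ x • f x := by
    rw [← integral_smul, ← integral_sub]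
    · refine integral_congr_ae ?_
      filter_upwards [Lp.coeFn_sub (d • u) f, Lp.coeFn_smul d u] with x hx hx'
      rw [hx, Pi.sub_apply, hx', Pi.smul_apply, smul_sub, smul_comm]
    · exact (integrable_smul_L2 u h1.continuous h2).smul d
    · exact integrable_smul_L2 f h1.continuous h2
  rw [e1, hswap _ hφ' h2.deriv, hswap _ h1.continuous h2, ← integral_smul, ← integral_sub,
    ← integral_neg]
  · refine integral_congr_ae (Eventually.of_forall fun y => ?_)
    simp only
    rw [hd φ h1 h2, ← Complex.coe_smul (φ y), ← mul_smul, ← sub_smul, ← neg_smul]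
    congr 1; ring
  · have h3 := (hint φ h1.continuous h2).integral_prod_right.smul d
    refine h3.congr (Eventually.of_forall fun y => ?_)
    simp only [Pi.smul_apply]
    rw [← integral_smul_const]
    congr 1
    refine integral_congr_ae (Eventually.of_forall fun x => ?_)
    simp only
    rw [mul_smul, Complex.coe_smul]
  · exact integrable_smul_L2 f h1.continuous h2

end Convolution

/-! ### The scalar Green's function -/

section ScalarGreen

/-- The Green's function of `-∂ₓ + d` for a number `d` off the imaginary axis: the solution of
`-g' + d g = δ₀` that decays in both directions. -/
def scalarGreen (d : ℂ) (x : ℝ) : ℂ :=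
  if 0 ≤ x then (if d.re < 0 then -Complex.exp (d * x) else 0)
  else (if d.re < 0 then 0 else Complex.exp (d * x))

lemma norm_scalarGreen_le (d : ℂ) (x : ℝ) : ‖scalarGreen d x‖ ≤ Real.exp (-|d.re| * |x|) := by
  unfold scalarGreen
  split_ifs with h1 h2 h2
  · rw [norm_neg, Complex.norm_exp, abs_of_neg h2, abs_of_nonneg h1]; simp
  · rw [norm_zero]; positivity
  · rw [norm_zero]; positivity
  · rw [Complex.norm_exp, abs_of_nonneg (not_lt.1 h2), abs_of_neg (not_le.1 h1)]; simp

lemma measurable_scalarGreen (d : ℂ) : Measurable (scalarGreen d) := by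
  have h : Measurable fun x : ℝ => Complex.exp (d * x) :=
    (Complex.continuous_exp.comp (continuous_const.mul Complex.continuous_ofReal)).measurable
  refine Measurable.ite (measurableSet_le measurable_const measurable_id) ?_ ?_
  · split_ifs
    · exact h.neg
    · exact measurable_const
  · split_ifs
    · exact measurable_const
    · exact h

lemma integrable_exp_neg_mul_abs {a : ℝ} (ha : 0 < a) :
    Integrable (fun x : ℝ => Real.exp (-a * |x|)) := by
  rw [← integrableOn_univ, ← Set.Iic_union_Ioi (a := (0 : ℝ))]
  refine IntegrableOn.union ?_ ?_
  · refine (integrableOn_exp_mul_Iic ha 0).congr_fun (fun x hx => ?_) measurableSet_Iic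
    simp only; rw [abs_of_nonpos hx]; congr 1; ring
  · refine (integrableOn_exp_mul_Ioi (neg_lt_zero.2 ha) 0).congr_fun (fun x hx => ?_)
      measurableSet_Ioi
    simp only; rw [abs_of_pos hx]

variable {d : ℂ}

lemma integrable_scalarGreen (hd : d.re ≠ 0) : Integrable (scalarGreen d) :=
  (integrable_exp_neg_mul_abs (abs_pos.2 hd)).mono'
    (measurable_scalarGreen d).aestronglyMeasurable
    (Eventually.of_forall (norm_scalarGreen_le d))

lemma memLp_scalarGreen (hd : d.re ≠ 0) : MemLp (scalarGreen d) 2 (volume : Measure ℝ) := by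
  have hm := (measurable_scalarGreen d).aestronglyMeasurable (μ := (volume : Measure ℝ))
  rw [memLp_two_iff_integrable_sq_norm hm]
  have h := integrable_exp_neg_mul_abs (a := 2 * |d.re|) (by positivity)
  refine h.mono' (hm.norm.pow 2) (Eventually.of_forall fun x => ?_)
  rw [Real.norm_of_nonneg (by positivity)]
  calc ‖scalarGreen d x‖ ^ 2 ≤ Real.exp (-|d.re| * |x|) ^ 2 := by
        gcongr; exact norm_scalarGreen_le d x
    _ = _ := by rw [← Real.exp_nat_mul]; congr 1; push_cast; ring

/-- The distributional equation `-g' + d g = δ₀` for the scalar Green's function. -/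
lemma integral_deriv_mul_scalarGreen (d : ℂ) (φ : ℝ → ℝ) (hφ : ContDiff ℝ ∞ φ)
    (hc : HasCompactSupport φ) (y : ℝ) :
    ∫ x, ((deriv φ x : ℝ) : ℂ) * scalarGreen d (x - y)
      = φ y - d * ∫ x, (φ x : ℂ) * scalarGreen d (x - y) := by
  let e : ℝ → ℂ := fun x => Complex.exp (d * (x - y : ℝ))
  let F : ℝ → ℂ := fun x => (φ x : ℂ) * e x
  have hφd : Differentiable ℝ φ := hφ.differentiable (by simp)
  have he : ContDiff ℝ 1 e := by
    refine ContDiff.cexp (contDiff_const.mul ?_)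
    exact Complex.ofRealCLM.contDiff.comp (contDiff_id.sub contDiff_const)
  have hφC : ContDiff ℝ 1 (fun x => (φ x : ℂ)) :=
    Complex.ofRealCLM.contDiff.comp (hφ.of_le (by exact_mod_cast le_top))
  have hcC : HasCompactSupport (fun x => (φ x : ℂ)) :=
    hc.comp_left (g := fun r : ℝ => (r : ℂ)) Complex.ofReal_zero
  have hcC' : HasCompactSupport (fun x => ((deriv φ x : ℝ) : ℂ)) :=
    hc.deriv.comp_left (g := fun r : ℝ => (r : ℂ)) Complex.ofReal_zero
  have hφ'c : Continuous (fun x => ((deriv φ x : ℝ) : ℂ)) :=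
    Complex.continuous_ofReal.comp (hφ.continuous_deriv (by simp))
  have hF : ContDiff ℝ 1 F := hφC.mul he
  have hFc : HasCompactSupport F := hcC.mul_right
  have hd' : deriv F = fun x => ((deriv φ x : ℝ) : ℂ) * e x + d * ((φ x : ℂ) * e x) := by
    ext x
    have h1 : HasDerivAt (fun x => (φ x : ℂ)) ((deriv φ x : ℝ) : ℂ) x :=
      (hφd x).hasDerivAt.ofReal_comp
    have h2 : HasDerivAt e (e x * (d * 1)) x := by
      refine HasDerivAt.cexp (HasDerivAt.const_mul d ?_)
      exact ((hasDerivAt_id x).sub_const y).ofReal_comp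
    have h3 : HasDerivAt F _ x := h1.mul h2
    rw [h3.deriv]; ring
  have i1 : Integrable (fun x => ((deriv φ x : ℝ) : ℂ) * e x) :=
    (hφ'c.mul he.continuous).integrable_of_hasCompactSupport hcC'.mul_right
  have i2 : Integrable (fun x => d * ((φ x : ℂ) * e x)) :=
    (hF.continuous.integrable_of_hasCompactSupport hFc).const_mul d
  have hFy : F y = φ y := by simp [F, e]
  by_cases hre : d.re < 0
  · have key : ∀ u : ℝ → ℂ, ∫ x, u x * scalarGreen d (x - y) = -∫ x in Set.Ioi y, u x * e x := by
      intro u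
      rw [← integral_Ici_eq_integral_Ioi, ← integral_indicator measurableSet_Ici, ← integral_neg]
      refine integral_congr_ae (Eventually.of_forall fun x => ?_)
      by_cases hx : y ≤ x
      · simp [scalarGreen, hre, hx, e, Set.indicator]
      · simp [scalarGreen, hre, hx, Set.indicator]
    rw [key, key]
    have h3 := hFc.integral_Ioi_deriv_eq hF y
    rw [hd', integral_add i1.integrableOn i2.integrableOn, integral_const_mul, hFy] at h3
    linear_combination -h3
  · have key : ∀ u : ℝ → ℂ, ∫ x, u x * scalarGreen d (x - y) = ∫ x in Set.Iic y, u x * e x := by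
      intro u
      rw [integral_Iic_eq_integral_Iio, ← integral_indicator measurableSet_Iio]
      refine integral_congr_ae (Eventually.of_forall fun x => ?_)
      by_cases hx : y ≤ x
      · simp [scalarGreen, hre, hx, Set.indicator]
      · simp [scalarGreen, hre, hx, e, Set.indicator, not_le.1 hx]
    rw [key, key]
    have h3 := hFc.integral_Iic_deriv_eq hF y
    rw [hd', integral_add i1.integrableOn i2.integrableOn, integral_const_mul, hFy] at h3
    linear_combination h3

variable {n : Type*} [Fintype n]

/-- The operator `(-∂ₓ + d)⁻¹` on `L²`, for `Re d ≠ 0`. -/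
def scalarGreenOp (d : ℂ) (hd : d.re ≠ 0) : L2 n →L[ℂ] L2 n :=
  convOp (scalarGreen d) (integrable_scalarGreen hd) (memLp_scalarGreen hd)

lemma hasWeakDeriv_scalarGreenOp (hd : d.re ≠ 0) (f : L2 n) :
    HasWeakDeriv (scalarGreenOp d hd f) (d • scalarGreenOp d hd f - f) :=
  hasWeakDeriv_convOp _ _ (integral_deriv_mul_scalarGreen d) f

/-- The equation `w' = d w` has no nonzero solution in `L²`: a mollification `h` of `w` is a
classical solution, so a multiple of `e^{d x}`, and it is bounded, hence `h = 0`. -/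
lemma HasWeakDeriv.eq_zero_of_smul {w : L2 n} (hd : d.re ≠ 0) (hw : HasWeakDeriv w (d • w)) :
    w = 0 := by
  apply Lp.ext
  have hloc : LocallyIntegrable w := (Lp.memLp w).locallyIntegrable (by norm_num)
  refine EventuallyEq.trans ?_ (Lp.coeFn_zero _ _ _).symm
  refine ae_eq_zero_of_integral_contDiff_smul_eq_zero hloc fun φ h1 h2 => ?_
  let ρ : ℝ → ℝ := fun y => φ (-y)
  have hρ : ContDiff ℝ ∞ ρ := h1.comp contDiff_neg
  have hρc : HasCompactSupport ρ := h2.comp_homeomorph (Homeomorph.neg ℝ)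
  let L : EuclideanSpace ℂ n →L[ℝ] ℝ →L[ℝ] EuclideanSpace ℂ n :=
    (ContinuousLinearMap.lsmul ℝ ℝ).flip
  let h : ℝ → EuclideanSpace ℂ n := fun x => ∫ y, ρ (x - y) • w y
  have hder : ∀ x, HasDerivAt h (d • h x) x := by
    intro x
    have e1 := hρc.hasDerivAt_convolution_right L hloc (hρ.of_le (by exact_mod_cast le_top)) x
    have e2 : convolution w ρ L volume = h := rfl
    have e3 : convolution w (deriv ρ) L volume x = d • h x := by
      change ∫ y, deriv ρ (x - y) • w y = d • h x
      have e4 := hw (fun y => ρ (x - y)) (hρ.comp (contDiff_const.sub contDiff_id))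
        (hρc.comp_homeomorph (Homeomorph.subLeft x))
      have e5 : ∀ y, deriv (fun y => ρ (x - y)) y = -deriv ρ (x - y) := fun y =>
        deriv_comp_const_sub ρ x y
      simp only [e5, neg_smul] at e4
      rw [integral_neg, neg_inj] at e4
      rw [e4, ← integral_smul]
      refine integral_congr_ae ?_
      filter_upwards [Lp.coeFn_smul d w] with y hy
      rw [hy, Pi.smul_apply, smul_comm]
    rw [e2, e3] at e1
    exact e1
  have hconst : ∀ x : ℝ, Complex.exp (-d * x) • h x = h 0 := by
    have hd2 : ∀ x : ℝ, HasDerivAt (fun x : ℝ => Complex.exp (-d * x) • h x) 0 x := by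
      intro x
      have e1 : HasDerivAt (fun x : ℝ => Complex.exp (-d * x)) (Complex.exp (-d * x) * (-d * 1)) x :=
        HasDerivAt.cexp (HasDerivAt.const_mul _ (Complex.ofRealCLM.hasDerivAt))
      have e2 := e1.smul (hder x)
      refine e2.congr_deriv ?_
      rw [smul_smul, ← add_smul]
      have : Complex.exp (-d * x) * d + Complex.exp (-d * x) * (-d * 1) = 0 := by ring
      rw [this, zero_smul]
    intro x
    have := is_const_of_deriv_eq_zero (fun x => (hd2 x).differentiableAt)
      (fun x => (hd2 x).deriv) x 0
    simpa using this
  have hρ2 : MemLp (fun y => (ρ y : ℂ)) 2 (volume : Measure ℝ) :=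
    (Complex.continuous_ofReal.comp hρ.continuous).memLp_of_hasCompactSupport
      (hρc.comp_left (g := fun r : ℝ => (r : ℂ)) Complex.ofReal_zero)
  set C := (∫ y, ‖(ρ y : ℂ)‖ ^ 2) + ∫ y, ‖w y‖ ^ 2
  have hbd : ∀ x, ‖h x‖ ≤ C := by
    intro x
    have e1 := integral_norm_conv_le hρ2 (Lp.memLp w) x
    refine le_trans ?_ e1
    refine (norm_integral_le_integral_norm _).trans (le_of_eq ?_)
    refine integral_congr_ae (Eventually.of_forall fun y => ?_)
    simp only [Complex.coe_smul]
  have h0 : h 0 = 0 := by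
    have hle : ∀ x : ℝ, ‖h 0‖ ≤ Real.exp (-d.re * x) * C := by
      intro x
      rw [← hconst x, norm_smul, Complex.norm_exp]
      have : (-d * (x : ℂ)).re = -d.re * x := by simp
      rw [this]
      gcongr
      exact hbd x
    have ht : Tendsto (fun s : ℝ => Real.exp (-s) * C) atTop (𝓝 0) := by
      simpa using Real.tendsto_exp_neg_atTop_nhds_zero.mul_const C
    have : ‖h 0‖ ≤ 0 := by
      refine ge_of_tendsto ht (Eventually.of_forall fun s => ?_)
      have := hle (s / d.re)
      rwa [neg_mul, mul_div_cancel₀ _ hd] at this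
    exact norm_le_zero_iff.1 this
  have : h 0 = ∫ y, φ y • w y := by
    simp only [h, ρ, zero_sub, neg_neg]
  rw [← this, h0]

end ScalarGreen

/-! ### Constant matrices acting on `L²`, and weak derivatives -/

section MatOp

variable {m n : Type*} [Fintype m] [Fintype n]

lemma HasWeakDeriv.compLpL (T : EuclideanSpace ℂ m →L[ℂ] EuclideanSpace ℂ n) {f g : L2 m}
    (h : HasWeakDeriv f g) : HasWeakDeriv (T.compLpL 2 volume f) (T.compLpL 2 volume g) := by
  intro φ h1 h2
  have key : ∀ (χ : ℝ → ℝ) (u : L2 m), Continuous χ → HasCompactSupport χ →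
      ∫ x, χ x • (T.compLpL 2 volume u) x = T (∫ x, χ x • u x) := by
    intro χ u hχ hc
    rw [← T.integral_comp_comm (integrable_smul_L2 u hχ hc)]
    refine integral_congr_ae ?_
    filter_upwards [T.coeFn_compLpL (p := 2) (μ := volume) u] with x hx
    rw [hx, ← Complex.coe_smul, ← Complex.coe_smul, map_smul]
  rw [key _ _ (h1.continuous_deriv (by simp)) h2.deriv, key _ _ h1.continuous h2, h φ h1 h2,
    map_neg]

lemma hasWeakDeriv_zero : HasWeakDeriv (0 : L2 n) 0 := by
  intro φ _ _
  have e : ∀ ψ : ℝ → ℝ, ∫ x, ψ x • (0 : L2 n) x = 0 := by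
    intro ψ
    refine integral_eq_zero_of_ae ?_
    filter_upwards [Lp.coeFn_zero (EuclideanSpace ℂ n) 2 (volume : Measure ℝ)] with x hx
    simp
  rw [e, e, neg_zero]

lemma HasWeakDeriv.sub {f g f' g' : L2 n} (h : HasWeakDeriv f g) (h' : HasWeakDeriv f' g') :
    HasWeakDeriv (f - f') (g - g') := by
  have := h.add (h'.smul (-1))
  simpa [sub_eq_add_neg] using this

lemma HasWeakDeriv.sum {ι : Type*} {s : Finset ι} {f g : ι → L2 n}
    (h : ∀ i ∈ s, HasWeakDeriv (f i) (g i)) : HasWeakDeriv (∑ i ∈ s, f i) (∑ i ∈ s, g i) := by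
  classical
  induction s using Finset.induction_on with
  | empty => simpa using hasWeakDeriv_zero
  | insert a s ha ih =>
    rw [Finset.sum_insert ha, Finset.sum_insert ha]
    exact (h a (Finset.mem_insert_self _ _)).add
      (ih fun i hi => h i (Finset.mem_insert_of_mem hi))

variable [DecidableEq n]

/-- A constant matrix acting on `L²`. -/
abbrev matOp (M : Matrix n n ℂ) : L2 n →L[ℂ] L2 n := (act M).compLpL 2 volume

lemma matOp_apply (M : Matrix n n ℂ) (f : L2 n) : matOp M f =ᵐ[volume] fun x => act M (f x) :=
  (act M).coeFn_compLpL f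

lemma act_mul_apply (M N : Matrix n n ℂ) (v : EuclideanSpace ℂ n) :
    act (M * N) v = act M (act N v) := by
  simp only [act, map_mul]; rfl

lemma act_one_apply (v : EuclideanSpace ℂ n) : act (1 : Matrix n n ℂ) v = v := by
  simp only [act, map_one]; rfl

lemma matOp_mul (M N : Matrix n n ℂ) (f : L2 n) : matOp (M * N) f = matOp M (matOp N f) := by
  apply Lp.ext
  filter_upwards [matOp_apply (M * N) f, matOp_apply M (matOp N f), matOp_apply N f] with x h1 h2 h3
  rw [h1, h2, h3, act_mul_apply]

lemma matOp_one (f : L2 n) : matOp (1 : Matrix n n ℂ) f = f := by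
  apply Lp.ext
  filter_upwards [matOp_apply 1 f] with x h1
  rw [h1, act_one_apply]

lemma matOp_smul (c : ℂ) (M : Matrix n n ℂ) (f : L2 n) : matOp (c • M) f = c • matOp M f := by
  apply Lp.ext
  filter_upwards [matOp_apply (c • M) f, matOp_apply M f, Lp.coeFn_smul c (matOp M f)]
    with x h1 h2 h3
  rw [h1, h3, Pi.smul_apply, h2, act, map_smul]; rfl

lemma matOp_add (M N : Matrix n n ℂ) (f : L2 n) : matOp (M + N) f = matOp M f + matOp N f := by
  apply Lp.ext
  filter_upwards [matOp_apply (M + N) f, matOp_apply M f, matOp_apply N f,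
    Lp.coeFn_add (matOp M f) (matOp N f)] with x h1 h2 h3 h4
  rw [h1, h4, Pi.add_apply, h2, h3, act, map_add]; rfl

lemma matOp_sum {ι : Type*} (s : Finset ι) (M : ι → Matrix n n ℂ) (f : L2 n) :
    matOp (∑ i ∈ s, M i) f = ∑ i ∈ s, matOp (M i) f := by
  classical
  induction s using Finset.induction_on with
  | empty =>
    have := matOp_smul (0 : ℂ) (0 : Matrix n n ℂ) f
    simpa using this
  | insert a s ha ih => rw [Finset.sum_insert ha, Finset.sum_insert ha, matOp_add, ih]

lemma scalarGreenOp_matOp {d : ℂ} (hd : d.re ≠ 0) (M : Matrix n n ℂ) (f : L2 n) :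
    scalarGreenOp d hd (matOp M f) = matOp M (scalarGreenOp d hd f) := by
  apply Lp.ext
  filter_upwards [convOp_apply (scalarGreen d) (integrable_scalarGreen hd) (memLp_scalarGreen hd)
    (matOp M f), convOp_apply (scalarGreen d) (integrable_scalarGreen hd) (memLp_scalarGreen hd) f,
    matOp_apply M (scalarGreenOp d hd f)] with x h1 h2 h3
  rw [h3, scalarGreenOp, h1, h2,
    ← (act M).integral_comp_comm (integrable_conv (memLp_scalarGreen hd) (Lp.memLp f) x)]
  refine integral_congr_ae ?_
  filter_upwards [matOp_apply M f] with y hy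
  rw [hy, map_smul]

end MatOp

/-! ### The Green's kernel of a diagonalizable matrix -/

section Spectral

variable {n : Type*} [Fintype n] [DecidableEq n] {ι : Type*} [Fintype ι] [DecidableEq ι]

/-- A spectral decomposition `A = ∑ dᵢ Eᵢ` with complementary projections `Eᵢ`; the numbers `dᵢ`
need not be distinct. -/
structure IsSpectralDecomposition (A : Matrix n n ℂ) (d : ι → ℂ) (E : ι → Matrix n n ℂ) :
    Prop where
  mul : ∀ i j, E i * E j = if i = j then E i else 0
  sum : ∑ i, E i = 1
  eq : A = ∑ i, d i • E i

namespace IsSpectralDecomposition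

variable {A : Matrix n n ℂ} {d : ι → ℂ} {E : ι → Matrix n n ℂ}

lemma mul_left (h : IsSpectralDecomposition A d E) (i : ι) : A * E i = d i • E i := by
  rw [h.eq, Finset.sum_mul]
  simp only [Matrix.smul_mul, h.mul]
  simp

lemma mul_right (h : IsSpectralDecomposition A d E) (i : ι) : E i * A = d i • E i := by
  rw [h.eq, Finset.mul_sum]
  simp only [Matrix.mul_smul, h.mul]
  simp

/-- The functional calculus `a ↦ ∑ aᵢ Eᵢ` of a spectral decomposition. -/
def hom (h : IsSpectralDecomposition A d E) : (ι → ℂ) →+* Matrix n n ℂ where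
  toFun a := ∑ i, a i • E i
  map_one' := by simp [h.sum]
  map_zero' := by simp
  map_add' a b := by simp [add_smul, Finset.sum_add_distrib]
  map_mul' a b := by
    rw [Finset.sum_mul_sum]
    simp only [Matrix.smul_mul, Matrix.mul_smul, h.mul]
    simp [smul_smul, mul_comm]

open scoped Matrix.Norms.Operator in
lemma exp_smul (h : IsSpectralDecomposition A d E) (z : ℂ) :
    NormedSpace.exp (z • A) = ∑ i, Complex.exp (d i * z) • E i := by
  have hc : Continuous h.hom := by
    change Continuous fun a : ι → ℂ => ∑ i, a i • E i
    fun_prop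
  have h1 : z • A = h.hom (fun i => d i * z) := by
    change z • A = ∑ i, (d i * z) • E i
    conv_lhs => rw [h.eq]
    rw [Finset.smul_sum]
    refine Finset.sum_congr rfl fun i _ => ?_
    rw [smul_smul, mul_comm]
  rw [h1]
  refine (NormedSpace.map_exp h.hom hc _).symm.trans ?_
  change ∑ i, (NormedSpace.exp (fun i => d i * z)) i • E i = _
  refine Finset.sum_congr rfl fun i _ => ?_
  rw [Pi.coe_exp, Complex.exp_eq_exp_ℂ]

lemma stableProjection_eq (h : IsSpectralDecomposition A d E) :
    stableProjection A = ∑ i, if (d i).re < 0 then E i else 0 := by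
  have hmem : ∀ i x, (E i).mulVec x ∈ Module.End.maxGenEigenspace (Matrix.toLin' A) (d i) := by
    intro i x
    rw [Module.End.mem_maxGenEigenspace]
    refine ⟨1, ?_⟩
    rw [pow_one, LinearMap.sub_apply, Matrix.toLin'_apply, Matrix.mulVec_mulVec, h.mul_left]
    simp [Matrix.smul_mulVec]
  have hproj : ∀ i x, Submodule.projection _ _ (isCompl_stableSubspace A) ((E i).mulVec x)
      = (if (d i).re < 0 then E i else 0).mulVec x := by
    intro i x
    split_ifs with hi
    · refine Submodule.projection_apply_of_mem_left _ ?_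
      exact Submodule.mem_iSup_of_mem (d i) (Submodule.mem_iSup_of_mem hi (hmem i x))
    · rw [Matrix.zero_mulVec]
      refine Submodule.projection_apply_of_mem_right _ ?_
      exact Submodule.mem_iSup_of_mem (d i) (Submodule.mem_iSup_of_mem (not_lt.1 hi) (hmem i x))
  rw [stableProjection]
  apply (Matrix.toLin').injective
  rw [Matrix.toLin'_toMatrix']
  refine LinearMap.ext fun x => ?_
  rw [Matrix.toLin'_apply, Matrix.sum_mulVec]
  have hx : x = ∑ i, (E i).mulVec x := by
    rw [← Matrix.sum_mulVec, h.sum, Matrix.one_mulVec]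
  conv_lhs => rw [hx, map_sum]
  exact Finset.sum_congr rfl fun i _ => hproj i x

lemma greenKernel_eq (h : IsSpectralDecomposition A d E) (x : ℝ) :
    greenKernel A x = ∑ i, scalarGreen (d i) x • E i := by
  have hQ := h.stableProjection_eq
  have key : ∀ c : ι → Matrix n n ℂ, (∀ i, c i = 0 ∨ c i = E i) →
      NormedSpace.exp ((x : ℂ) • A) * ∑ i, c i = ∑ i, Complex.exp (d i * x) • c i := by
    intro c hc
    rw [h.exp_smul, Finset.sum_mul_sum]
    refine Finset.sum_congr rfl fun i _ => ?_
    rw [Finset.sum_eq_single i]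
    · rcases hc i with h0 | h0 <;> simp [h0, h.mul]
    · intro j _ hj
      rcases hc j with h0 | h0 <;> simp [h0, h.mul, hj.symm]
    · simp
  unfold greenKernel
  split_ifs with hx
  · rw [hQ, key _ (fun i => by split_ifs <;> simp), ← Finset.sum_neg_distrib]
    refine Finset.sum_congr rfl fun i _ => ?_
    by_cases hi : (d i).re < 0 <;> simp [scalarGreen, hx, hi]
  · have h1 : 1 - stableProjection A = ∑ i, if (d i).re < 0 then 0 else E i := by
      rw [hQ, ← h.sum, ← Finset.sum_sub_distrib]
      refine Finset.sum_congr rfl fun i _ => ?_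
      split_ifs <;> simp
    rw [h1, key _ (fun i => by split_ifs <;> simp)]
    refine Finset.sum_congr rfl fun i _ => ?_
    by_cases hi : (d i).re < 0 <;> simp [scalarGreen, hx, hi]

/-- The operator `(-∂ₓ + A)⁻¹` on `L²`, for a diagonalizable matrix `A` without eigenvalues on the
imaginary axis. -/
def greenOp (_ : IsSpectralDecomposition A d E) (hd : ∀ i, (d i).re ≠ 0) : L2 n →L[ℂ] L2 n :=
  ∑ i, scalarGreenOp (d i) (hd i) ∘L matOp (E i)

lemma greenOp_apply (h : IsSpectralDecomposition A d E) (hd : ∀ i, (d i).re ≠ 0) (f : L2 n) :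
    h.greenOp hd f = ∑ i, scalarGreenOp (d i) (hd i) (matOp (E i) f) := by
  simp [greenOp]

lemma isIntegralOperator_greenOp (h : IsSpectralDecomposition A d E) (hd : ∀ i, (d i).re ≠ 0) :
    IsIntegralOperator (fun x y => greenKernel A (x - y)) (h.greenOp hd) := by
  intro f
  have h1 : ∀ᵐ x : ℝ, ∀ i, scalarGreenOp (d i) (hd i) (matOp (E i) f) x
      = ∫ y, scalarGreen (d i) (x - y) • matOp (E i) f y :=
    ae_all_iff.2 fun i => convOp_apply _ _ _ _
  have h2 : ∀ᵐ y : ℝ, ∀ i, matOp (E i) f y = act (E i) (f y) :=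
    ae_all_iff.2 fun i => matOp_apply _ _
  have h3 : h.greenOp hd f =ᵐ[volume]
      fun x => ∑ i, scalarGreenOp (d i) (hd i) (matOp (E i) f) x := by
    rw [greenOp_apply]
    have := Lp.coeFn_finsetSum (p := 2) (μ := (volume : Measure ℝ)) Finset.univ
      (fun i => scalarGreenOp (d i) (hd i) (matOp (E i) f))
    filter_upwards [this] with x hx
    rw [hx, Finset.sum_apply]
  have hint : ∀ x i, Integrable fun y => scalarGreen (d i) (x - y) • matOp (E i) f y :=
    fun x i => integrable_conv (memLp_scalarGreen (hd i)) (Lp.memLp _) x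
  filter_upwards [h1, h3] with x hx hx3
  have hae : (fun y => ∑ i, scalarGreen (d i) (x - y) • matOp (E i) f y) =ᵐ[volume]
      fun y => act (greenKernel A (x - y)) (f y) := by
    filter_upwards [h2] with y hy
    simp only [hy, h.greenKernel_eq, act, map_sum, map_smul]
    simp
  refine ⟨(integrable_finsetSum _ fun i _ => hint x i).congr hae, ?_⟩
  rw [hx3, ← integral_congr_ae hae, integral_finsetSum _ fun i _ => hint x i]
  exact Finset.sum_congr rfl fun i _ => hx i

lemma hasWeakDeriv_greenOp (h : IsSpectralDecomposition A d E) (hd : ∀ i, (d i).re ≠ 0)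
    (f : L2 n) : HasWeakDeriv (h.greenOp hd f) (matOp A (h.greenOp hd f) - f) := by
  have h1 : matOp A (h.greenOp hd f) - f = ∑ i, (d i • scalarGreenOp (d i) (hd i) (matOp (E i) f)
      - matOp (E i) f) := by
    rw [Finset.sum_sub_distrib, ← matOp_sum, h.sum, matOp_one, greenOp_apply, map_sum]
    congr 1
    refine Finset.sum_congr rfl fun i _ => ?_
    rw [← scalarGreenOp_matOp, ← matOp_mul, h.mul_left, matOp_smul, map_smul]
  rw [h1, greenOp_apply]
  exact HasWeakDeriv.sum fun i _ => hasWeakDeriv_scalarGreenOp (hd i) _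

/-- `-∂ₓ + A` is injective on `H¹`. -/
lemma eq_greenOp (h : IsSpectralDecomposition A d E) (hd : ∀ i, (d i).re ≠ 0)
    {u f : L2 n} (hu : HasWeakDeriv u (matOp A u - f)) : u = h.greenOp hd f := by
  have h1 := hu.sub (h.hasWeakDeriv_greenOp hd f)
  set w := u - h.greenOp hd f with hw
  have h2 : matOp A u - f - (matOp A (h.greenOp hd f) - f) = matOp A w := by
    rw [hw, map_sub]; abel
  rw [h2] at h1
  have h3 : ∀ i, matOp (E i) w = 0 := by
    intro i
    have h4 := h1.compLpL (act (E i))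
    have h5 : matOp (E i) (matOp A w) = d i • matOp (E i) w := by
      rw [← matOp_mul, h.mul_right, matOp_smul]
    change HasWeakDeriv (matOp (E i) w) (matOp (E i) (matOp A w)) at h4
    rw [h5] at h4
    exact h4.eq_zero_of_smul (hd i)
  have h6 : w = 0 := by
    rw [← matOp_one w, ← h.sum, matOp_sum]
    exact Finset.sum_eq_zero fun i _ => h3 i
  exact sub_eq_zero.1 h6

end IsSpectralDecomposition

end Spectral

/-! ### Spectral decomposition of `A_∞(λ)` -/

section AInf

/-- The two signs. -/
def sgn (s : Bool) : ℂ := if s then 1 else -1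

@[simp] lemma sgn_true : sgn true = 1 := rfl
@[simp] lemma sgn_false : sgn false = -1 := rfl

lemma sgn_mul_self (s : Bool) : sgn s * sgn s = 1 := by cases s <;> simp [sgn]

/-- The spectral projection of the rotation matrix `!![0, -1; 1, 0]` for the eigenvalue `± i`. It
commutes with all the constant matrices of the linearized equation. -/
def rotProj (s : Bool) : Matrix (Fin 2) (Fin 2) ℂ :=
  (1 / 2 : ℂ) • !![1, sgn s * Complex.I; -(sgn s * Complex.I), 1]

lemma rotProj_mul (s t : Bool) :
    rotProj s * rotProj t = if s = t then rotProj s else 0 := by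
  cases s <;> cases t <;> ext i j <;> fin_cases i <;> fin_cases j <;>
    simp [rotProj, Matrix.mul_apply, Fin.sum_univ_two] <;> ring_nf <;> simp <;> norm_num

lemma rotProj_add : rotProj true + rotProj false = 1 := by
  ext i j; fin_cases i <;> fin_cases j <;> simp [rotProj] <;> norm_num

/-- The eigenvalue `β ± i D / 2` of `B` on the range of `rotProj`. -/
def eigB (p : Params) (s : Bool) : ℂ := p.β + sgn s * Complex.I * (p.D / 2)

/-- The eigenvalue `δ ± i α` of `N₀` on the range of `rotProj`. -/
def eigN (p : Params) (s : Bool) : ℂ := p.δ + sgn s * Complex.I * p.α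

lemma matB_mul_rotProj (p : Params) (s : Bool) : matB p * rotProj s = eigB p s • rotProj s := by
  cases s <;> ext i j <;> fin_cases i <;> fin_cases j <;>
    simp [rotProj, matB, eigB, Matrix.mul_apply, Fin.sum_univ_two] <;> ring_nf <;> simp <;> ring

lemma matN0_mul_rotProj (p : Params) (s : Bool) : matN0 p * rotProj s = eigN p s • rotProj s := by
  cases s <;> ext i j <;> fin_cases i <;> fin_cases j <;>
    simp [rotProj, matN0, eigN, Matrix.mul_apply, Fin.sum_univ_two] <;> ring_nf <;> simp <;> ring

variable {p : Params}

lemma eigB_ne_zero (hDβ : (p.D, p.β) ≠ (0, 0)) (s : Bool) : eigB p s ≠ 0 := by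
  intro h
  have h1 := congrArg Complex.re h
  have h2 := congrArg Complex.im h
  apply hDβ
  cases s <;> simp [eigB] at h1 h2 <;> simp [h1, h2]

lemma isUnit_matB (hDβ : (p.D, p.β) ≠ (0, 0)) : IsUnit (matB p).det := by
  have : (matB p).det = eigB p true * eigB p false := by
    simp only [matB, Matrix.det_fin_two_of, eigB, sgn_true, sgn_false]
    linear_combination ((p.D / 2 : ℂ) ^ 2) * Complex.I_mul_I
  rw [this]
  exact (mul_ne_zero (eigB_ne_zero hDβ true) (eigB_ne_zero hDβ false)).isUnit

lemma matB_inv_mul_rotProj (hDβ : (p.D, p.β) ≠ (0, 0)) (s : Bool) :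
    (matB p)⁻¹ * rotProj s = (eigB p s)⁻¹ • rotProj s := by
  have h1 : rotProj s = (eigB p s)⁻¹ • (matB p * rotProj s) := by
    rw [matB_mul_rotProj, smul_smul, inv_mul_cancel₀ (eigB_ne_zero hDβ s), one_smul]
  conv_lhs => rw [h1]
  rw [Matrix.mul_smul, ← Matrix.mul_assoc, Matrix.nonsing_inv_mul _ (isUnit_matB hDβ),
    Matrix.one_mul]

/-- The eigenvalue `(λ - δ ∓ i α) / (β ± i D / 2)` of `B⁻¹ (λ - N₀)`, the square of an eigenvalue
of `A_∞(λ)`. -/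
def eigSq (p : Params) (l : ℂ) (s : Bool) : ℂ := (l - eigN p s) / eigB p s

lemma inv_mul_sub_eq (hDβ : (p.D, p.β) ≠ (0, 0)) (l : ℂ) :
    (matB p)⁻¹ * (l • 1 - matN0 p)
      = eigSq p l true • rotProj true + eigSq p l false • rotProj false := by
  have h : ∀ s, (matB p)⁻¹ * (l • 1 - matN0 p) * rotProj s = eigSq p l s • rotProj s := by
    intro s
    rw [Matrix.mul_assoc, Matrix.sub_mul, matN0_mul_rotProj, Matrix.smul_mul, Matrix.one_mul,
      ← sub_smul, Matrix.mul_smul, matB_inv_mul_rotProj hDβ, smul_smul, eigSq, div_eq_mul_inv]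
  rw [← h, ← h, ← Matrix.mul_add, rotProj_add, Matrix.mul_one]

/-- The spectral projections of `A_∞(λ)`, given square roots `κ` of the numbers `eigSq`. -/
def projAInf (κ : Bool → ℂ) (i : Bool × Bool) : Matrix (Fin 2 ⊕ Fin 2) (Fin 2 ⊕ Fin 2) ℂ :=
  (1 / 2 : ℂ) • Matrix.fromBlocks (rotProj i.1) ((sgn i.2 / κ i.1) • rotProj i.1)
    ((sgn i.2 * κ i.1) • rotProj i.1) (rotProj i.1)

lemma isSpectralDecomposition_matAInf (hDβ : (p.D, p.β) ≠ (0, 0)) {l : ℂ} {κ : Bool → ℂ}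
    (hκ : ∀ s, κ s ≠ 0) (hκ2 : ∀ s, κ s ^ 2 = eigSq p l s) :
    IsSpectralDecomposition (matAInf p l) (fun i : Bool × Bool => sgn i.2 * κ i.1)
      (projAInf κ) where
  mul := by
    rintro ⟨s, t⟩ ⟨s', t'⟩
    by_cases hs : s = s'
    · subst hs
      have h0 := hκ s
      have hP := rotProj_mul s s
      simp only [if_true] at hP
      cases t <;> cases t' <;>
        simp only [projAInf, Matrix.smul_mul, Matrix.mul_smul, Matrix.fromBlocks_multiply, hP,
          sgn_true, sgn_false, Prod.mk.injEq, true_and, if_true, smul_smul, ← add_smul,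
          Matrix.fromBlocks_smul, reduceCtorEq, if_false, ← Matrix.fromBlocks_zero] <;>
        congr 1 <;> (congr 1; field_simp; norm_num)
    · have h0 : ¬ ((s, t) = (s', t')) := fun h => hs (congrArg Prod.fst h)
      rw [if_neg h0]
      have hP := rotProj_mul s s'
      rw [if_neg hs] at hP
      simp [projAInf, Matrix.fromBlocks_multiply, hP]
  sum := by
    rw [Fintype.sum_prod_type]
    simp only [Fintype.sum_bool, projAInf, sgn_true, sgn_false, Matrix.fromBlocks_smul,
      Matrix.fromBlocks_add]
    rw [← Matrix.fromBlocks_one, ← rotProj_add]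
    congr 1 <;> module
  eq := by
    rw [Fintype.sum_prod_type, matAInf, inv_mul_sub_eq hDβ, ← hκ2, ← hκ2, ← rotProj_add]
    simp only [Fintype.sum_bool, projAInf, sgn_true, sgn_false, Matrix.fromBlocks_smul,
      Matrix.fromBlocks_add]
    have h1 := hκ true
    have h2 := hκ false
    have e1 : 1 * κ true * (1 / 2 * (1 / κ true)) = 1 / 2 := by field_simp
    have e2 : 1 * κ false * (1 / 2 * (1 / κ false)) = 1 / 2 := by field_simp
    have e3 : -1 * κ true * (1 / 2 * (-1 / κ true)) = 1 / 2 := by field_simp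
    have e4 : -1 * κ false * (1 / 2 * (-1 / κ false)) = 1 / 2 := by field_simp
    simp only [smul_smul, e1, e2, e3, e4]
    congr 1 <;> module

/-- If no number `-k²` with `k` real is an eigenvalue of `B⁻¹ (λ - N₀)`, then `A_∞(λ)` is
diagonalizable without eigenvalues on the imaginary axis. -/
lemma exists_isSpectralDecomposition (hDβ : (p.D, p.β) ≠ (0, 0)) {l : ℂ}
    (h : ∀ s, ∀ k : ℝ, eigSq p l s ≠ -(k : ℂ) ^ 2) :
    ∃ (d : Bool × Bool → ℂ) (E : Bool × Bool → Matrix (Fin 2 ⊕ Fin 2) (Fin 2 ⊕ Fin 2) ℂ),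
      IsSpectralDecomposition (matAInf p l) d E ∧ ∀ i, (d i).re ≠ 0 := by
  have h1 : ∀ s, ∃ κ : ℂ, κ ^ 2 = eigSq p l s := fun s =>
    IsAlgClosed.exists_pow_nat_eq _ two_pos
  choose κ hκ using h1
  have hre : ∀ s, (κ s).re ≠ 0 := by
    intro s hs
    apply h s (κ s).im
    rw [← hκ s]
    have : κ s = (κ s).im * Complex.I := by
      apply Complex.ext <;> simp [hs]
    conv_lhs => rw [this]
    rw [mul_pow, Complex.I_sq]; ring
  refine ⟨_, _, isSpectralDecomposition_matAInf hDβ (κ := κ) (fun s h0 => hre s (by simp [h0])) hκ,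
    ?_⟩
  rintro ⟨s, t⟩
  cases t <;> simpa [sgn] using hre s

end AInf

/-- `-∂ₓ + d` is injective on `H¹`. -/
lemma eq_scalarGreenOp {n : Type*} [Fintype n] {d : ℂ} (hd : d.re ≠ 0) {u f : L2 n}
    (hu : HasWeakDeriv u (d • u - f)) : u = scalarGreenOp d hd f := by
  have h1 := hu.sub (hasWeakDeriv_scalarGreenOp hd f)
  have h2 : d • u - f - (d • scalarGreenOp d hd f - f) = d • (u - scalarGreenOp d hd f) := by
    rw [smul_sub]; abel
  rw [h2] at h1
  exact sub_eq_zero.1 (h1.eq_zero_of_smul hd)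

/-! ### Weyl sequences and the essential spectrum -/

section Laplace

variable {n : Type*} [Fintype n]

lemma one_re_ne_zero : (1 : ℂ).re ≠ 0 := by simp

lemma neg_one_re_ne_zero : (-1 : ℂ).re ≠ 0 := by simp

/-- The inverse of `∂ₓ² - 1 : H² → L²`, from the factorization `∂ₓ² - 1 = (-∂ₓ - 1) (-∂ₓ + 1)`. -/
def laplaceInv : L2 n →L[ℂ] L2 n :=
  scalarGreenOp 1 one_re_ne_zero ∘L scalarGreenOp (-1) neg_one_re_ne_zero

lemma hasWeakDeriv₂_laplaceInv (f : L2 n) :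
    HasWeakDeriv₂ (laplaceInv f) (laplaceInv f + f) := by
  set g := scalarGreenOp (-1) neg_one_re_ne_zero f with hg
  have h1 := hasWeakDeriv_scalarGreenOp neg_one_re_ne_zero f
  have h2 := hasWeakDeriv_scalarGreenOp one_re_ne_zero g
  rw [← hg] at h1
  rw [one_smul] at h2
  have h3 := h2.sub h1
  refine ⟨_, h2, ?_⟩
  convert h3 using 1
  change scalarGreenOp 1 one_re_ne_zero g + f = _
  rw [neg_one_smul]; abel

lemma eq_laplaceInv {u h : L2 n} (H : HasWeakDeriv₂ u h) : u = laplaceInv (h - u) := by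
  obtain ⟨g, h1, h2⟩ := H
  have h3 : u - g = scalarGreenOp (-1) neg_one_re_ne_zero (h - u) := by
    apply eq_scalarGreenOp
    convert h1.sub h2 using 1
    rw [neg_one_smul]; abel
  have h4 : u = scalarGreenOp 1 one_re_ne_zero (u - g) := by
    apply eq_scalarGreenOp
    convert h1 using 1
    rw [one_smul]; abel
  rw [h3] at h4
  exact h4

end Laplace

section Fredholm

variable {p : Params} {ψ : ℝ → ℂ} {l : ℂ}

/-- The operator `𝓛 - λ`, with the domain spelled out. -/
def linShift (p : Params) (ψ : ℝ → ℂ) (l : ℂ) : H2 (Fin 2) →ₗ[ℂ] L2 (Fin 2) :=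
  shift (linearization p ψ) l

lemma linShift_apply (u : H2 (Fin 2)) :
    linShift p ψ l u
      = matOp (matB p) (secondDeriv u) + mulOp (potential p ψ) u - l • (u : L2 (Fin 2)) := rfl

/-- If `𝓛 - λ` has closed range, then it is a quotient map onto its range: by the open mapping
theorem for the bounded operator `(𝓛 - λ) (∂ₓ² - 1)⁻¹`. -/
lemma exists_preimage_of_isClosed_range
    (hF : IsClosed (LinearMap.range (linShift p ψ l) : Set (L2 (Fin 2)))) :
    ∃ C : ℝ, ∀ u : H2 (Fin 2), ∃ v : H2 (Fin 2),
      linShift p ψ l v = linShift p ψ l u ∧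
      ‖(v : L2 (Fin 2))‖ ≤ C * ‖linShift p ψ l u‖ := by
  let R : L2 (Fin 2) →L[ℂ] L2 (Fin 2) := laplaceInv
  let S : L2 (Fin 2) →L[ℂ] L2 (Fin 2) :=
    matOp (matB p) ∘L (R + ContinuousLinearMap.id ℂ _) + mulOp (potential p ψ) ∘L R - l • R
  let e : L2 (Fin 2) → H2 (Fin 2) := fun f => ⟨R f, ⟨_, hasWeakDeriv₂_laplaceInv f⟩⟩
  have he : ∀ f, linShift p ψ l (e f) = S f := by
    intro f
    rw [linShift_apply]
    have h1 : secondDeriv (e f) = R f + f :=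
      (secondDeriv_spec (e f)).unique (hasWeakDeriv₂_laplaceInv f)
    rw [h1]; rfl
  have hsurj : ∀ u : H2 (Fin 2), ∃ f, e f = u := by
    intro u
    refine ⟨secondDeriv u - u, ?_⟩
    exact Subtype.ext (eq_laplaceInv (secondDeriv_spec u)).symm
  have hrange : (LinearMap.range (S : L2 (Fin 2) →ₗ[ℂ] L2 (Fin 2)) : Set (L2 (Fin 2)))
      = LinearMap.range (linShift p ψ l) := by
    ext y
    constructor
    · rintro ⟨f, rfl⟩
      exact ⟨e f, he f⟩
    · rintro ⟨u, rfl⟩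
      obtain ⟨f, rfl⟩ := hsurj u
      exact ⟨f, (he f).symm⟩
  rw [← hrange] at hF
  have : CompleteSpace (LinearMap.range (S : L2 (Fin 2) →ₗ[ℂ] L2 (Fin 2))) :=
    hF.completeSpace_coe
  obtain ⟨C, hC, h⟩ := S.rangeRestrict.exists_preimage_norm_le
    (LinearMap.surjective_rangeRestrict _)
  refine ⟨‖R‖ * C, fun u => ?_⟩
  obtain ⟨f, hf⟩ := hsurj u
  obtain ⟨g, hg1, hg2⟩ := h ⟨S f, ⟨f, rfl⟩⟩
  have hg1' : S g = S f := congrArg Subtype.val hg1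
  refine ⟨e g, ?_, ?_⟩
  · rw [he, hg1', ← hf, he]
  · rw [← hf, he, mul_assoc]
    exact (R.le_opNorm g).trans (by gcongr; exact hg2)

/-- A Fredholm operator `𝓛 - λ` admits no Weyl sequence: the distance of the members of such a
sequence to the finite-dimensional kernel tends to zero, so a subsequence converges, and the
limit is zero almost everywhere. -/
lemma not_weyl_sequence (hF : IsFredholmAt (linearization p ψ) l) (u : ℕ → H2 (Fin 2))
    {c C : ℝ} (hc : 0 < c) (hcu : ∀ k, c ≤ ‖(u k : L2 (Fin 2))‖)
    (hCu : ∀ k, ‖(u k : L2 (Fin 2))‖ ≤ C)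
    (hlim : Tendsto (fun k => ‖linShift p ψ l (u k)‖) atTop (𝓝 0))
    (hae : ∀ᵐ x : ℝ, Tendsto (fun k => (u k : L2 (Fin 2)) x) atTop (𝓝 0)) : False := by
  obtain ⟨hclosed, hker, -⟩ := hF
  change IsClosed (LinearMap.range (linShift p ψ l) : Set (L2 (Fin 2))) at hclosed
  change FiniteDimensional ℂ (LinearMap.ker (linShift p ψ l)) at hker
  obtain ⟨K, hK⟩ := exists_preimage_of_isClosed_range hclosed
  choose v hv1 hv2 using fun k => hK (u k)
  have hvlim : Tendsto (fun k => (v k : L2 (Fin 2))) atTop (𝓝 0) := by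
    refine squeeze_zero_norm hv2 ?_
    simpa using hlim.const_mul K
  let N : Submodule ℂ (L2 (Fin 2)) :=
    (LinearMap.ker (linShift p ψ l)).map (H2 (Fin 2)).subtype
  have hN : FiniteDimensional ℂ N := Module.Finite.map _ _
  have hproper : ProperSpace N := FiniteDimensional.proper ℂ N
  let w : ℕ → N := fun k => ⟨(u k : L2 (Fin 2)) - v k, ⟨u k - v k, by
    refine ⟨?_, rfl⟩
    change linShift p ψ l (u k - v k) = 0
    rw [map_sub, hv1, sub_self]⟩⟩
  obtain ⟨V, hV⟩ := (Metric.isBounded_range_of_tendsto _ hvlim).exists_norm_le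
  have hwb : ∀ k, w k ∈ Metric.closedBall (0 : N) (C + V) := by
    intro k
    rw [mem_closedBall_zero_iff]
    exact (norm_sub_le _ _).trans (add_le_add (hCu k) (hV _ ⟨k, rfl⟩))
  obtain ⟨a, -, φ, hφ, hwa⟩ := tendsto_subseq_of_bounded Metric.isBounded_closedBall hwb
  have hwa' : Tendsto (fun k => (w (φ k) : L2 (Fin 2))) atTop (𝓝 (a : L2 (Fin 2))) :=
    (continuous_subtype_val.tendsto a).comp hwa
  have hua : Tendsto (fun k => (u (φ k) : L2 (Fin 2))) atTop (𝓝 (a : L2 (Fin 2))) := by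
    have := hwa'.add (hvlim.comp hφ.tendsto_atTop)
    rw [add_zero] at this
    refine this.congr fun k => ?_
    simp [w]
  have ha : c ≤ ‖(a : L2 (Fin 2))‖ := ge_of_tendsto hua.norm (Eventually.of_forall fun k => hcu _)
  obtain ⟨ns, hns, hns2⟩ := (tendstoInMeasure_of_tendsto_Lp hua).exists_seq_tendsto_ae
  have ha0 : (a : L2 (Fin 2)) = 0 := by
    apply Lp.ext
    filter_upwards [hae, hns2, Lp.coeFn_zero (EuclideanSpace ℂ (Fin 2)) 2 (volume : Measure ℝ)]
      with x h1 h2 h3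
    rw [h3, Pi.zero_apply]
    exact tendsto_nhds_unique h2 (h1.comp (hφ.tendsto_atTop.comp hns.tendsto_atTop))
  rw [ha0, norm_zero] at ha
  linarith

end Fredholm

section Packets

variable {n : Type*}

/-- The wave packet `χ(x / r - 3) e^{ikx} v`, with an envelope on the interval `[r, 5r]` if `χ` is
supported in `[-2, 2]`. -/
def packet (k : ℝ) (v : EuclideanSpace ℂ n) (χ : ℝ → ℝ) (r x : ℝ) : EuclideanSpace ℂ n :=
  ((χ (x / r - 3) : ℂ) * Complex.exp (Complex.I * k * x)) • v

variable {k : ℝ} {v : EuclideanSpace ℂ n} {χ : ℝ → ℝ} {r : ℝ}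

lemma packet_eq_zero (hr : 0 < r) (hχ : ∀ y, 2 < |y| → χ y = 0) {x : ℝ}
    (hx : x ∉ Set.Icc r (5 * r)) : packet k v χ r x = 0 := by
  have : 2 < |x / r - 3| := by
    by_contra h
    rw [not_lt, abs_le] at h
    apply hx
    have h1 : 1 ≤ x / r := by linarith
    have h2 : x / r ≤ 5 := by linarith
    rw [le_div_iff₀ hr] at h1
    rw [div_le_iff₀ hr] at h2
    exact ⟨by linarith, h2⟩
  rw [packet, hχ _ this]; simp

variable [Fintype n]

lemma norm_sq_eq_integral (f : L2 n) : ‖f‖ ^ 2 = ∫ x, ‖f x‖ ^ 2 := by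
  have h1 : inner ℂ f f = ((‖f‖ ^ 2 : ℝ) : ℂ) := by
    rw [inner_self_eq_norm_sq_to_K]; norm_cast
  rw [L2.inner_def] at h1
  have h2 : ∀ x, inner ℂ (f x) (f x) = ((‖f x‖ ^ 2 : ℝ) : ℂ) := fun x => by
    rw [inner_self_eq_norm_sq_to_K]; norm_cast
  simp only [h2] at h1
  exact Complex.ofReal_injective (h1.symm.trans (integral_ofReal (𝕜 := ℂ)))

lemma hasWeakDeriv_toLp {F F' : ℝ → EuclideanSpace ℂ n} (hF : ∀ x, HasDerivAt F (F' x) x)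
    (h : MemLp F 2 volume) (h' : MemLp F' 2 volume) : HasWeakDeriv (h.toLp F) (h'.toLp F') := by
  intro φ h1 h2
  have e : ∀ (χ : ℝ → ℝ) {G : ℝ → EuclideanSpace ℂ n} (hG : MemLp G 2 volume),
      ∫ x, χ x • hG.toLp G x = ∫ x, χ x • G x := by
    intro χ G hG
    refine integral_congr_ae ?_
    filter_upwards [hG.coeFn_toLp] with x hx
    rw [hx]
  have i : ∀ {χ : ℝ → ℝ} {G : ℝ → EuclideanSpace ℂ n}, MemLp G 2 volume → Continuous χ →
      HasCompactSupport χ → Integrable fun x => χ x • G x := fun hG hχ hc =>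
    (hG.locallyIntegrable (by norm_num)).integrable_smul_left_of_hasCompactSupport hχ hc
  have hc : Continuous (deriv φ) := h1.continuous_deriv (by simp)
  rw [e, e]
  have key := integral_bilinear_hasDerivAt_right_eq_neg_left_of_integrable
    (L := ContinuousLinearMap.lsmul ℝ ℝ (E := EuclideanSpace ℂ n)) (u := φ) (v := F)
    (u' := deriv φ) (v' := F')
    (fun x _ => (h1.differentiable (by simp) x).hasDerivAt) (fun x _ => hF x)
    (i h' h1.continuous h2) (i h hc h2.deriv) (i h h1.continuous h2)
  simp only [ContinuousLinearMap.lsmul_apply] at key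
  rw [key, neg_neg]

lemma norm_packet (x : ℝ) : ‖packet k v χ r x‖ = |χ (x / r - 3)| * ‖v‖ := by
  rw [packet, norm_smul, norm_mul, Complex.norm_exp, Complex.norm_real, Real.norm_eq_abs]
  simp

lemma hasDerivAt_packet {χ' : ℝ → ℝ} (hχ : ∀ y, HasDerivAt χ (χ' y) y) (x : ℝ) :
    HasDerivAt (packet k v χ r)
      ((r : ℂ)⁻¹ • packet k v χ' r x + (Complex.I * k) • packet k v χ r x) x := by
  have h1 : HasDerivAt (fun x : ℝ => χ (x / r - 3)) (χ' (x / r - 3) * (1 / r)) x :=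
    (hχ _).comp x (((hasDerivAt_id x).div_const r).sub_const 3)
  have h2 : HasDerivAt (fun x : ℝ => Complex.exp (Complex.I * k * x))
      (Complex.exp (Complex.I * k * x) * (Complex.I * k * 1)) x :=
    HasDerivAt.cexp (HasDerivAt.const_mul _ (Complex.ofRealCLM.hasDerivAt))
  have h3 := (h1.ofReal_comp.mul h2).smul_const v
  refine h3.congr_deriv ?_
  rw [packet, packet, smul_smul, smul_smul, ← add_smul]
  congr 1
  push_cast
  ring

lemma continuous_packet (hχ : Continuous χ) : Continuous (packet k v χ r) := by
  unfold packet
  fun_prop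

lemma memLp_packet (hr : 0 < r) (hχ : Continuous χ) (hs : ∀ y, 2 < |y| → χ y = 0) :
    MemLp (packet k v χ r) 2 volume :=
  (continuous_packet hχ).memLp_of_hasCompactSupport
    (HasCompactSupport.intro isCompact_Icc fun _ hx => packet_eq_zero hr hs hx)

lemma norm_toLp_packet_sq_le (hr : 0 < r) (hs : ∀ y, 2 < |y| → χ y = 0)
    {K : ℝ} (hK : ∀ y, |χ y| ≤ K) (h : MemLp (packet k v χ r) 2 volume) :
    ‖h.toLp _‖ ^ 2 ≤ 4 * r * (K * ‖v‖) ^ 2 := by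
  rw [norm_sq_eq_integral]
  have h1 : ∫ x, ‖h.toLp _ x‖ ^ 2 ≤ ∫ x, (Set.Icc r (5 * r)).indicator (fun _ => (K * ‖v‖) ^ 2) x := by
    refine integral_mono_of_nonneg (Eventually.of_forall fun x => by positivity) ?_ ?_
    · exact (integrable_indicator_iff measurableSet_Icc).2 (integrableOn_const (by simp))
    · filter_upwards [h.coeFn_toLp] with x hx
      rw [hx]
      by_cases hxI : x ∈ Set.Icc r (5 * r)
      · rw [Set.indicator_of_mem hxI, norm_packet]
        gcongr
        exact hK _
      · rw [Set.indicator_of_notMem hxI, packet_eq_zero hr hs hxI]; simp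
  refine h1.trans (le_of_eq ?_)
  rw [integral_indicator measurableSet_Icc, setIntegral_const, smul_eq_mul, Real.volume_real_Icc_of_le
    (by linarith)]
  ring

lemma le_norm_toLp_packet_sq (hr : 0 < r) (h1χ : ∀ y, |y| ≤ 1 → χ y = 1)
    (h : MemLp (packet k v χ r) 2 volume) :
    2 * r * ‖v‖ ^ 2 ≤ ‖h.toLp _‖ ^ 2 := by
  rw [norm_sq_eq_integral]
  have h1 : ∫ x, (Set.Icc (2 * r) (4 * r)).indicator (fun _ => ‖v‖ ^ 2) x
      ≤ ∫ x, ‖h.toLp _ x‖ ^ 2 := by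
    refine integral_mono_of_nonneg (Eventually.of_forall fun x => ?_) ?_ ?_
    · exact Set.indicator_nonneg (fun _ _ => by positivity) x
    · exact (memLp_two_iff_integrable_sq_norm (Lp.memLp _).1).1 (Lp.memLp (h.toLp _))
    · filter_upwards [h.coeFn_toLp] with x hx
      rw [hx]
      by_cases hxI : x ∈ Set.Icc (2 * r) (4 * r)
      · rw [Set.indicator_of_mem hxI, norm_packet, h1χ, abs_one, one_mul]
        have h2 : 2 ≤ x / r := by rw [le_div_iff₀ hr]; exact hxI.1
        have h3 : x / r ≤ 4 := by rw [div_le_iff₀ hr]; exact hxI.2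
        rw [abs_le]; constructor <;> linarith
      · rw [Set.indicator_of_notMem hxI]; positivity
  refine le_trans (le_of_eq ?_) h1
  rw [integral_indicator measurableSet_Icc, setIntegral_const, smul_eq_mul, Real.volume_real_Icc_of_le
    (by linarith)]
  ring

end Packets

/-! ### The potential of the linearized equation -/

section Potential

lemma continuous_act {n : Type*} [Fintype n] [DecidableEq n] :
    Continuous fun M : Matrix n n ℂ => act M :=
  LinearMap.continuous_of_finiteDimensional
    (Matrix.toEuclideanCLM (n := n) (𝕜 := ℂ)).toAlgEquiv.toLinearMap

lemma continuous_reIm : Continuous reIm := by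
  refine continuous_pi fun i => ?_
  fin_cases i
  · exact Complex.continuous_ofReal.comp Complex.continuous_re
  · exact Complex.continuous_ofReal.comp Complex.continuous_im

lemma continuous_matM (p : Params) : Continuous (matM p) := by
  have := continuous_reIm
  unfold matM
  fun_prop

/-- The matrix `M` is of second order in the pulse, by homogeneity of `z ↦ reIm z`. -/
lemma exists_norm_act_matM_le (p : Params) (C : ℝ) :
    ∃ K : ℝ, 0 ≤ K ∧ ∀ z : ℂ, ‖z‖ ≤ C → ‖act (matM p z)‖ ≤ K * ‖z‖ ^ 2 := by
  let f : ℂ × ℝ → Matrix (Fin 2) (Fin 2) ℂ := fun q =>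
    matN1 p + (q.2 : ℂ) ^ 2 • matN2 p
      + ((2 : ℂ) • matN1 p + (4 * (q.2 : ℂ) ^ 2) • matN2 p) *
        Matrix.vecMulVec (reIm q.1) (reIm q.1)
  have hf : Continuous f := by
    have := continuous_reIm
    fun_prop
  obtain ⟨K, hK⟩ := ((isCompact_closedBall (0 : ℂ) 1).prod
    (isCompact_Icc (a := (0 : ℝ)) (b := C))).exists_bound_of_continuousOn
    (continuous_act.comp hf).continuousOn
  refine ⟨max K 0, le_max_right _ _, fun z hz => ?_⟩
  rcases eq_or_ne z 0 with rfl | h0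
  · have : matM p 0 = 0 := by
      have h : reIm 0 = 0 := by ext i; fin_cases i <;> simp [reIm]
      simp [matM, h]
    simp [this, act]
  have hn : (‖z‖ : ℂ) ≠ 0 := by exact_mod_cast norm_ne_zero_iff.2 h0
  let u : ℂ := z / ‖z‖
  have hu : ‖u‖ = 1 := by simp [u, norm_ne_zero_iff.2 h0]
  have hz' : reIm z = (‖z‖ : ℂ) • reIm u := by
    have h1 : z = ‖z‖ * u := by simp only [u]; field_simp
    have hre : z.re = ‖z‖ * u.re := by conv_lhs => rw [h1]
                                       simp
    have him : z.im = ‖z‖ * u.im := by conv_lhs => rw [h1]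
                                       simp
    ext i
    fin_cases i
    · simp only [reIm, hre]; simp
    · simp only [reIm, him]; simp
  have e : matM p z = (‖z‖ : ℂ) ^ 2 • f (u, ‖z‖) := by
    simp only [matM, f, hz', Matrix.smul_vecMulVec, Matrix.vecMulVec_smul, Matrix.mul_smul,
      smul_add, smul_smul]
    ring_nf
  rw [e, act, map_smul, norm_smul]
  have h2 := hK (u, ‖z‖) ⟨by simp [hu], norm_nonneg _, hz⟩
  have h3 : ‖(‖z‖ : ℂ) ^ 2‖ = ‖z‖ ^ 2 := by simp
  rw [h3, mul_comm]
  gcongr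
  exact h2.trans (le_max_left _ _)

end Potential

/-! ### The essential spectrum of the linearized operator -/

section Hyperbolic

/-- An eigenvector of the rotation matrix `!![0, -1; 1, 0]`. -/
def rotVec (s : Bool) : EuclideanSpace ℂ (Fin 2) := WithLp.toLp 2 ![1, -(sgn s * Complex.I)]

lemma norm_rotVec_pos (s : Bool) : 0 < ‖rotVec s‖ := by
  rw [norm_pos_iff]
  intro h
  have := congrArg (fun w : EuclideanSpace ℂ (Fin 2) => w 0) h
  simp [rotVec] at this

lemma act_matB_rotVec (p : Params) (s : Bool) :
    act (matB p) (rotVec s) = eigB p s • rotVec s := by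
  rw [rotVec, act, Matrix.toEuclideanCLM_toLp, ← WithLp.toLp_smul]
  congr 1
  ext i
  fin_cases i
  · simp [matB, eigB, Matrix.mulVec, dotProduct, Fin.sum_univ_two]; ring
  · simp [matB, eigB, Matrix.mulVec, dotProduct, Fin.sum_univ_two]
    linear_combination (p.D / 2 : ℂ) * (Complex.I * Complex.I) * sgn_mul_self s +
      (p.D / 2 : ℂ) * Complex.I_mul_I

lemma act_matN0_rotVec (p : Params) (s : Bool) :
    act (matN0 p) (rotVec s) = eigN p s • rotVec s := by
  rw [rotVec, act, Matrix.toEuclideanCLM_toLp, ← WithLp.toLp_smul]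
  congr 1
  ext i
  fin_cases i
  · simp [matN0, eigN, Matrix.mulVec, dotProduct, Fin.sum_univ_two]; ring
  · simp [matN0, eigN, Matrix.mulVec, dotProduct, Fin.sum_univ_two]
    linear_combination (p.α : ℂ) * (Complex.I * Complex.I) * sgn_mul_self s +
      (p.α : ℂ) * Complex.I_mul_I

lemma hasWeakDeriv_packet {n : Type*} [Fintype n] {k r : ℝ} {v : EuclideanSpace ℂ n}
    {χ χ' : ℝ → ℝ} (hχ : ∀ y, HasDerivAt χ (χ' y) y) (h : MemLp (packet k v χ r) 2 volume)
    (h' : MemLp (packet k v χ' r) 2 volume) :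
    HasWeakDeriv (h.toLp _) ((r : ℂ)⁻¹ • h'.toLp _ + (Complex.I * k) • h.toLp _) := by
  have hm := (h'.const_smul (r : ℂ)⁻¹).add (h.const_smul (Complex.I * k))
  have key := hasWeakDeriv_toLp (F' := (r : ℂ)⁻¹ • packet k v χ' r +
    (Complex.I * k) • packet k v χ r) (hasDerivAt_packet hχ) h hm
  rwa [MemLp.toLp_add (h'.const_smul (r : ℂ)⁻¹) (h.const_smul (Complex.I * k)),
    MemLp.toLp_const_smul, MemLp.toLp_const_smul] at key

lemma matOp_packet {n : Type*} [Fintype n] [DecidableEq n] {k r : ℝ} {v : EuclideanSpace ℂ n}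
    {χ : ℝ → ℝ} {A : Matrix n n ℂ} {c : ℂ} (hA : act A v = c • v)
    (h : MemLp (packet k v χ r) 2 volume) : matOp A (h.toLp _) = c • h.toLp _ := by
  apply Lp.ext
  filter_upwards [matOp_apply A (h.toLp _), Lp.coeFn_smul c (h.toLp _), h.coeFn_toLp]
    with x h1 h2 h3
  rw [h1, h2, Pi.smul_apply, h3, packet, map_smul, hA, smul_comm]

lemma deriv_eq_zero_of_support {χ : ℝ → ℝ} (hs : ∀ y, 2 < |y| → χ y = 0) (y : ℝ) (hy : 2 < |y|) :
    deriv χ y = 0 := by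
  have : χ =ᶠ[𝓝 y] fun _ => 0 := by
    filter_upwards [(isOpen_lt continuous_const continuous_abs).mem_nhds hy] with z hz
    exact hs z hz
  rw [this.deriv_eq, deriv_const]

lemma exists_bound_of_support {χ : ℝ → ℝ} (hc : Continuous χ) (hs : ∀ y, 2 < |y| → χ y = 0) :
    ∃ K, ∀ y, |χ y| ≤ K := by
  refine (HasCompactSupport.intro (isCompact_Icc (a := -2) (b := 2)) fun x hx => hs x ?_)
    |>.exists_bound_of_continuous hc
  by_contra h
  exact hx (abs_le.1 (not_lt.1 h))

variable {p : Params} {ψ : ℝ → ℂ} {l : ℂ}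

/-- If `𝓛 - λ` is Fredholm, then `λ` is off the dispersion curves `δ ± i α - k² (β ± i D / 2)`. On
the curves, slowly modulated plane waves escaping to infinity form a Weyl sequence. -/
lemma eigSq_ne_of_isFredholmAt (hDβ : (p.D, p.β) ≠ (0, 0)) (hψ : Continuous ψ) {C a : ℝ}
    (ha : 0 < a) (hdecay : ∀ x : ℝ, ‖ψ x‖ ≤ C * Real.exp (-a * |x|))
    (hF : IsFredholmAt (linearization p ψ) l) (s : Bool) (k : ℝ) :
    eigSq p l s ≠ -(k : ℂ) ^ 2 := by
  intro hk
  have hl : l + (k : ℂ) ^ 2 * eigB p s = eigN p s := by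
    rw [eigSq, div_eq_iff (eigB_ne_zero hDβ s)] at hk
    linear_combination hk
  have hC0 : 0 ≤ C := by
    have := (norm_nonneg _).trans (hdecay 0)
    simpa using this
  have hC : ∀ x, ‖ψ x‖ ≤ C := fun x => (hdecay x).trans
    (mul_le_of_le_one_right hC0 (Real.exp_le_one_iff.2 (by nlinarith [abs_nonneg x])))
  obtain ⟨KM, hKM0, hKM⟩ := exists_norm_act_matM_le p C
  set v := rotVec s
  set b := eigB p s with hb
  let bump : ContDiffBump (0 : ℝ) := ⟨1, 2, one_pos, one_lt_two⟩
  let χ : ℝ → ℝ := bump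
  have hχ : ContDiff ℝ ∞ χ := bump.contDiff
  have hχ1 : ContDiff ℝ ∞ (deriv χ) := (contDiff_infty_iff_deriv.1 hχ).2
  have hχ2 : Continuous (deriv (deriv χ)) := hχ1.continuous_deriv (by simp)
  have hd0 : ∀ y, HasDerivAt χ (deriv χ y) y := fun y =>
    (hχ.differentiable (by simp) y).hasDerivAt
  have hd1 : ∀ y, HasDerivAt (deriv χ) (deriv (deriv χ) y) y := fun y =>
    (hχ1.differentiable (by simp) y).hasDerivAt
  have hs0 : ∀ y, 2 < |y| → χ y = 0 := fun y hy =>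
    bump.zero_of_le_dist (by rw [Real.dist_eq, sub_zero]; exact hy.le)
  have hs1 := deriv_eq_zero_of_support hs0
  have hs2 := deriv_eq_zero_of_support hs1
  have hone : ∀ y, |y| ≤ 1 → χ y = 1 := fun y hy =>
    bump.one_of_mem_closedBall (by rw [mem_closedBall_zero_iff]; exact hy)
  obtain ⟨K0, hK0⟩ := exists_bound_of_support hχ.continuous hs0
  obtain ⟨K1, hK1⟩ := exists_bound_of_support hχ1.continuous hs1
  obtain ⟨K2, hK2⟩ := exists_bound_of_support hχ2 hs2
  have hm0 : ∀ {r : ℝ}, 0 < r → MemLp (packet k v χ r) 2 volume := fun hr =>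
    memLp_packet hr hχ.continuous hs0
  have hm1 : ∀ {r : ℝ}, 0 < r → MemLp (packet k v (deriv χ) r) 2 volume := fun hr =>
    memLp_packet hr hχ1.continuous hs1
  have hm2 : ∀ {r : ℝ}, 0 < r → MemLp (packet k v (deriv (deriv χ)) r) 2 volume := fun hr =>
    memLp_packet hr hχ2 hs2
  have hnorm : ∀ {η : ℝ → ℝ} {K r : ℝ} (_ : 0 < r) (_ : ∀ y, 2 < |y| → η y = 0)
      (_ : ∀ y, |η y| ≤ K) (h : MemLp (packet k v η r) 2 volume),
      (√r)⁻¹ * ‖h.toLp _‖ ≤ 2 * (K * ‖v‖) := by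
    intro η K r hr hs hK h
    have hK' : 0 ≤ K := (abs_nonneg _).trans (hK 0)
    have h1 := norm_toLp_packet_sq_le hr hs hK h
    rw [inv_mul_le_iff₀ (Real.sqrt_pos.2 hr)]
    refine le_of_sq_le_sq ?_ (by positivity)
    rw [mul_pow, Real.sq_sqrt hr.le]
    linarith
  -- The image of a packet of length scale `r` under `𝓛 - λ`.
  have hpacket : ∀ {r : ℝ} (hr : 0 < r), ∃ w : H2 (Fin 2), (w : L2 (Fin 2)) = (hm0 hr).toLp _ ∧
      (√r)⁻¹ * ‖linShift p ψ l w‖ ≤ r⁻¹ * (r⁻¹ * (‖b‖ * (2 * (K2 * ‖v‖)))) +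
        r⁻¹ * (2 * |k| * (‖b‖ * (2 * (K1 * ‖v‖)))) +
        KM * (C * Real.exp (-a * r)) ^ 2 * (2 * (K0 * ‖v‖)) := by
    intro r hr
    set X0 := (hm0 hr).toLp _ with hX0
    set X1 := (hm1 hr).toLp _ with hX1
    set X2 := (hm2 hr).toLp _ with hX2
    have hw1 : HasWeakDeriv X0 ((r : ℂ)⁻¹ • X1 + (Complex.I * k) • X0) :=
      hasWeakDeriv_packet hd0 (hm0 hr) (hm1 hr)
    have hw2 : HasWeakDeriv X1 ((r : ℂ)⁻¹ • X2 + (Complex.I * k) • X1) :=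
      hasWeakDeriv_packet hd1 (hm1 hr) (hm2 hr)
    have hw3 := (hw2.smul (r : ℂ)⁻¹).add (hw1.smul (Complex.I * k))
    have hw : HasWeakDeriv₂ X0 _ := ⟨_, hw1, hw3⟩
    refine ⟨⟨X0, ⟨_, hw⟩⟩, rfl, ?_⟩
    have hsd : secondDeriv ⟨X0, ⟨_, hw⟩⟩ = _ := (secondDeriv_spec ⟨X0, ⟨_, hw⟩⟩).unique hw
    have hB0 : matOp (matB p) X0 = b • X0 := matOp_packet (act_matB_rotVec p s) _
    have hB1 : matOp (matB p) X1 = b • X1 := matOp_packet (act_matB_rotVec p s) _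
    have hB2 : matOp (matB p) X2 = b • X2 := matOp_packet (act_matB_rotVec p s) _
    have hlin : linShift p ψ l ⟨X0, ⟨_, hw⟩⟩ = (r : ℂ)⁻¹ • ((r : ℂ)⁻¹ • (b • X2)) +
        (r : ℂ)⁻¹ • ((2 * (Complex.I * k)) • (b • X1)) +
        (mulOp (potential p ψ) X0 - eigN p s • X0) := by
      rw [linShift_apply, hsd]
      simp only [map_add, map_smul, hB0, hB1, hB2]
      rw [← hl]
      have hI : (k : ℂ) ^ 2 = -((Complex.I * k) * (Complex.I * k)) := by
        linear_combination (k : ℂ) ^ 2 * Complex.I_mul_I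
      rw [hI]
      generalize Complex.I * (k : ℂ) = q
      module
    have hpot : ‖mulOp (potential p ψ) X0 - eigN p s • X0‖
        ≤ KM * (C * Real.exp (-a * r)) ^ 2 * ‖X0‖ := by
      refine Lp.norm_le_mul_norm_of_ae_le_mul ?_
      filter_upwards [mulOp_apply (memLp_potential p hψ hC) X0,
        Lp.coeFn_sub (mulOp (potential p ψ) X0) (eigN p s • X0), Lp.coeFn_smul (eigN p s) X0,
        (hm0 hr).coeFn_toLp] with x h1 h2 h3 h4
      have h4' : X0 x = packet k v χ r x := h4
      rw [h2, Pi.sub_apply, h1, h3, Pi.smul_apply, h4']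
      have h5 : act (potential p ψ x) (packet k v χ r x) - eigN p s • packet k v χ r x
          = act (matM p (ψ x)) (packet k v χ r x) := by
        have h6 : act (matN0 p) (packet k v χ r x) = eigN p s • packet k v χ r x := by
          rw [packet, map_smul, act_matN0_rotVec, smul_comm]
        rw [← h6, potential, act, map_add]
        simp
      rw [h5]
      by_cases hx : x ∈ Set.Icc r (5 * r)
      · refine (ContinuousLinearMap.le_opNorm _ _).trans ?_
        gcongr
        refine (hKM _ (hC x)).trans ?_
        gcongr
        refine (hdecay x).trans ?_
        have : r ≤ |x| := hx.1.trans (le_abs_self x)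
        gcongr ?_ * ?_
        exact Real.exp_le_exp.2 (by nlinarith)
      · rw [packet_eq_zero hr hs0 hx]; simp
    have hrn : ‖(r : ℂ)⁻¹‖ = r⁻¹ := by
      rw [norm_inv, Complex.norm_real, Real.norm_of_nonneg hr.le]
    have hkn : ‖2 * (Complex.I * (k : ℂ))‖ = 2 * |k| := by simp
    have hsq : 0 < (√r)⁻¹ := inv_pos.2 (Real.sqrt_pos.2 hr)
    have n0 := hnorm hr hs0 hK0 (hm0 hr)
    have n1 := hnorm hr hs1 hK1 (hm1 hr)
    have n2 := hnorm hr hs2 hK2 (hm2 hr)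
    rw [← hX0] at n0
    rw [← hX1] at n1
    rw [← hX2] at n2
    have hri : 0 ≤ r⁻¹ := (inv_pos.2 hr).le
    rw [hlin]
    calc (√r)⁻¹ * ‖_‖ ≤ (√r)⁻¹ * (r⁻¹ * (r⁻¹ * (‖b‖ * ‖X2‖)) + r⁻¹ * (2 * |k| * (‖b‖ * ‖X1‖)) +
          KM * (C * Real.exp (-a * r)) ^ 2 * ‖X0‖) := by
          gcongr
          refine (norm_add₃_le).trans ?_
          simp only [norm_smul, hrn, hkn]
          gcongr
      _ = r⁻¹ * (r⁻¹ * (‖b‖ * ((√r)⁻¹ * ‖X2‖))) + r⁻¹ * (2 * |k| * (‖b‖ * ((√r)⁻¹ * ‖X1‖))) +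
          KM * (C * Real.exp (-a * r)) ^ 2 * ((√r)⁻¹ * ‖X0‖) := by ring
      _ ≤ _ := by gcongr
  let R : ℕ → ℝ := fun j => (j : ℝ) + 1
  have hR : ∀ j, 0 < R j := fun j => by positivity
  have hRtop : Tendsto R atTop atTop := tendsto_natCast_atTop_atTop.atTop_add tendsto_const_nhds
  choose w hw1 hw2 using fun j => hpacket (hR j)
  let c : ℕ → ℂ := fun j => (((√(R j))⁻¹ : ℝ) : ℂ)
  have hcn : ∀ j, ‖c j‖ = (√(R j))⁻¹ := fun j => by
    rw [Complex.norm_real, Real.norm_of_nonneg (by positivity)]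
  refine not_weyl_sequence hF (fun j => c j • w j) (c := ‖v‖) (C := 2 * (K0 * ‖v‖))
    (norm_rotVec_pos s) ?_ ?_ ?_ ?_
  · intro j
    rw [Submodule.coe_smul, norm_smul, hcn, hw1, le_inv_mul_iff₀ (Real.sqrt_pos.2 (hR j))]
    refine le_of_sq_le_sq ?_ (norm_nonneg _)
    rw [mul_pow, Real.sq_sqrt (hR j).le]
    have := le_norm_toLp_packet_sq (hR j) hone (hm0 (hR j))
    nlinarith [hR j, sq_nonneg ‖v‖, mul_nonneg (hR j).le (sq_nonneg ‖v‖)]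
  · intro j
    rw [Submodule.coe_smul, norm_smul, hcn, hw1]
    exact hnorm (hR j) hs0 hK0 (hm0 (hR j))
  · refine squeeze_zero (fun j => norm_nonneg _) (fun j => ?_) (g := fun j =>
      (R j)⁻¹ * ((R j)⁻¹ * (‖b‖ * (2 * (K2 * ‖v‖)))) +
        (R j)⁻¹ * (2 * |k| * (‖b‖ * (2 * (K1 * ‖v‖)))) +
        KM * (C * Real.exp (-a * R j)) ^ 2 * (2 * (K0 * ‖v‖))) ?_
    · rw [map_smul, norm_smul, hcn]
      exact hw2 j
    · have t1 : Tendsto (fun j => (R j)⁻¹) atTop (𝓝 0) := tendsto_inv_atTop_zero.comp hRtop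
      have t2 : Tendsto (fun j => Real.exp (-a * R j)) atTop (𝓝 0) :=
        Real.tendsto_exp_atBot.comp (hRtop.const_mul_atTop_of_neg (neg_lt_zero.2 ha))
      have := ((t1.mul (t1.mul_const (‖b‖ * (2 * (K2 * ‖v‖))))).add
        (t1.mul_const (2 * |k| * (‖b‖ * (2 * (K1 * ‖v‖)))))).add
        ((((t2.const_mul C).pow 2).const_mul KM).mul_const (2 * (K0 * ‖v‖)))
      simpa using this
  · have h1 : ∀ᵐ x : ℝ, ∀ j, ((c j • w j : H2 (Fin 2)) : L2 (Fin 2)) x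
        = c j • packet k v χ (R j) x := by
      refine ae_all_iff.2 fun j => ?_
      rw [Submodule.coe_smul, hw1]
      filter_upwards [Lp.coeFn_smul (c j) ((hm0 (hR j)).toLp _), (hm0 (hR j)).coeFn_toLp]
        with x h2 h3
      rw [h2, Pi.smul_apply, h3]
    filter_upwards [h1] with x hx
    refine tendsto_const_nhds.congr' ?_
    filter_upwards [hRtop.eventually_gt_atTop x] with j hj
    rw [hx, packet_eq_zero (hR j) hs0 (fun h => absurd h.1 (not_le.2 hj)), smul_zero]

/-- Outside the essential spectrum, `𝓛 - λ` is Fredholm. -/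
lemma isFredholmAt_of_notMem_essentialSpectrum
    (hl : l ∉ essentialSpectrum (linearization p ψ)) : IsFredholmAt (linearization p ψ) l := by
  by_cases h : l ∈ resolventSet (linearization p ψ)
  · have hr : LinearMap.range (shift (linearization p ψ) l) = ⊤ :=
      LinearMap.range_eq_top.2 h.1.2
    have hk : LinearMap.ker (shift (linearization p ψ) l) = ⊥ := LinearMap.ker_eq_bot.2 h.1.1
    refine ⟨?_, ?_, ?_⟩
    · rw [hr]; exact isClosed_univ
    · rw [hk]; infer_instance
    · rw [hr]; infer_instance
  · by_contra h2
    exact hl ⟨h, fun h3 => h2 h3.1⟩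

end Hyperbolic

/-! ### The square-root factorization of the potential -/

section SquareRoot

variable {n : Type*} [Fintype n] [DecidableEq n]

lemma abs_rpow_half_mul_self (M : Matrix n n ℂ) :
    CFC.abs M ^ (1 / 2 : ℝ) * CFC.abs M ^ (1 / 2 : ℝ) = CFC.abs M := by
  rw [← CFC.sqrt_eq_rpow]
  exact CFC.sqrt_mul_sqrt_self _ (CFC.abs_nonneg M)

lemma finite_spectrum_nnreal (A : Matrix n n ℂ) : (_root_.spectrum NNReal A).Finite := by
  have h : (_root_.spectrum ℝ A).Finite := Matrix.finite_real_spectrum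
  refine Set.Finite.of_finite_image (f := algebraMap NNReal ℝ) (h.subset ?_)
    (NNReal.coe_injective.injOn)
  rintro _ ⟨x, hx, rfl⟩
  exact (spectrum.algebraMap_mem_iff ℝ).2 hx

lemma continuousOn_spectrum_nnreal (A : Matrix n n ℂ) (f : NNReal → NNReal) :
    ContinuousOn f (_root_.spectrum NNReal A) :=
  (finite_spectrum_nnreal A).continuousOn f

/-- The identity `|M| |M|^{-1/2} = |M|^{1/2}` also holds on the kernel of `|M|`, where both sides
vanish. -/
lemma abs_mul_rpow_neg_half (M : Matrix n n ℂ) :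
    CFC.abs M * CFC.abs M ^ (-(1 / 2) : ℝ) = CFC.abs M ^ (1 / 2 : ℝ) := by
  have h0 := CFC.abs_nonneg M
  set X := CFC.abs M
  have hc := continuousOn_spectrum_nnreal X
  have h1 : X = cfc (fun t : NNReal => t) X := (cfc_id' NNReal X).symm
  rw [CFC.rpow_def, CFC.rpow_def]
  conv_lhs => enter [1]; rw [h1]
  rw [← cfc_mul _ _ X (hc _) (hc _)]
  congr 1
  ext t : 1
  rcases eq_or_ne t 0 with rfl | ht
  · simp
  · rw [← NNReal.rpow_one_add' (by norm_num)]; norm_num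

lemma isSelfAdjoint_abs_rpow (M : Matrix n n ℂ) (r : ℝ) : star (CFC.abs M ^ r) = CFC.abs M ^ r :=
  (IsSelfAdjoint.of_nonneg CFC.rpow_nonneg).star_eq

lemma star_abs (M : Matrix n n ℂ) : star (CFC.abs M) = CFC.abs M :=
  (IsSelfAdjoint.of_nonneg (CFC.abs_nonneg M)).star_eq

lemma star_mul_abs_rpow_neg_half (M : Matrix n n ℂ) :
    star (M * CFC.abs M ^ (-(1 / 2) : ℝ)) * (M * CFC.abs M ^ (-(1 / 2) : ℝ)) = CFC.abs M := by
  have h1 := abs_mul_rpow_neg_half M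
  have h2 := congrArg star h1
  rw [star_mul, isSelfAdjoint_abs_rpow, isSelfAdjoint_abs_rpow, star_abs] at h2
  rw [star_mul, isSelfAdjoint_abs_rpow, mul_assoc, ← mul_assoc (star M), ← CFC.abs_mul_abs,
    mul_assoc, h1, ← mul_assoc, h2, abs_rpow_half_mul_self]

open scoped ComplexOrder in
/-- The factorization `M = (M |M|^{-1/2}) |M|^{1/2}`. -/
lemma mul_abs_rpow_mul_abs_rpow (M : Matrix n n ℂ) :
    M * CFC.abs M ^ (-(1 / 2) : ℝ) * CFC.abs M ^ (1 / 2 : ℝ) = M := by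
  have h1 := abs_mul_rpow_neg_half M
  have h2 := congrArg star h1
  rw [star_mul, isSelfAdjoint_abs_rpow, isSelfAdjoint_abs_rpow, star_abs] at h2
  have h3 := star_mul_abs_rpow_neg_half M
  have h4 := abs_rpow_half_mul_self M
  have h5 := isSelfAdjoint_abs_rpow M (1 / 2)
  have h6 : star (M * CFC.abs M ^ (-(1 / 2) : ℝ)) * M = CFC.abs M ^ (1 / 2 : ℝ) * CFC.abs M := by
    rw [star_mul, isSelfAdjoint_abs_rpow, mul_assoc, ← CFC.abs_mul_abs, ← mul_assoc, h2]
  have h7 := congrArg star h6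
  rw [star_mul, star_star, star_mul, h5, star_abs] at h7
  set W := M * CFC.abs M ^ (-(1 / 2) : ℝ)
  set S := CFC.abs M ^ (1 / 2 : ℝ)
  rw [← sub_eq_zero, ← Matrix.conjTranspose_mul_self_eq_zero, ← Matrix.star_eq_conjTranspose,
    star_sub, star_mul, h5, sub_mul, mul_sub, mul_sub, mul_assoc S, ← mul_assoc (star W), h3,
    mul_assoc S, h6, ← mul_assoc (star M), h7, ← CFC.abs_mul_abs, ← h4]
  simp only [mul_assoc, sub_self]

section Norm

open scoped Matrix.Norms.L2Operator

lemma continuous_cfc_abs {f : NNReal → NNReal} (hf : Continuous f) :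
    Continuous fun M : Matrix n n ℂ => cfc f (CFC.abs M) :=
  CFC.continuous_abs.cfc_nnreal_of_mem_nhdsSet (s := Set.univ) f Filter.univ_mem
    (fun M => CFC.abs_nonneg M) hf.continuousOn

lemma continuous_abs_rpow_half :
    Continuous fun M : Matrix n n ℂ => CFC.abs M ^ (1 / 2 : ℝ) :=
  continuous_cfc_abs (NNReal.continuous_rpow_const (by norm_num))

/-- The power `|M|^{-1/2}` is the limit of `|M|^{1/2} (|M| + ε)⁻¹` as `ε → 0`. -/
lemma aestronglyMeasurable_abs_rpow_neg_half {F : ℝ → Matrix n n ℂ} (hF : Continuous F) :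
    AEStronglyMeasurable (fun x => CFC.abs (F x) ^ (-(1 / 2) : ℝ)) (volume : Measure ℝ) := by
  let ε : ℕ → NNReal := fun k => 1 / ((k : NNReal) + 1)
  have hε : ∀ k, ε k ≠ 0 := fun k => (by positivity : 0 < ε k).ne'
  have hε0 : Tendsto ε atTop (𝓝 0) := tendsto_one_div_add_atTop_nhds_zero_nat
  let f : ℕ → NNReal → NNReal := fun k t => t ^ (1 / 2 : ℝ) * (t + ε k)⁻¹
  have hf : ∀ k, Continuous (f k) := fun k =>
    (NNReal.continuous_rpow_const (by norm_num)).mul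
      ((continuous_id.add continuous_const).inv₀ fun t =>
        (add_pos_of_nonneg_of_pos zero_le (pos_iff_ne_zero.2 (hε k))).ne')
  refine aestronglyMeasurable_of_tendsto_ae atTop
    (f := fun k x => cfc (f k) (CFC.abs (F x)))
    (fun k => ((continuous_cfc_abs (hf k)).comp hF).aestronglyMeasurable)
    (Eventually.of_forall fun x => ?_)
  simp only [CFC.rpow_def]
  refine tendsto_cfc_fun ?_ (Eventually.of_forall fun k => continuousOn_spectrum_nnreal _ _)
  refine fun u hu => (eventually_all_finite (finite_spectrum_nnreal _)).2 fun t _ => ?_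
  refine (?_ : Tendsto (fun k => f k t) atTop (𝓝 (t ^ (-(1 / 2) : ℝ)))).eventually
    (UniformSpace.ball_mem_nhds _ hu)
  rcases eq_or_ne t 0 with rfl | ht
  · simp [f]
  · have h1 : Tendsto (fun k => t ^ (1 / 2 : ℝ) * (t + ε k)⁻¹) atTop
        (𝓝 (t ^ (1 / 2 : ℝ) * (t + 0)⁻¹)) :=
      ((hε0.const_add t).inv₀ (by simpa using ht)).const_mul _
    convert h1 using 2
    rw [add_zero, ← NNReal.rpow_neg_one, ← NNReal.rpow_add ht]
    norm_num

lemma norm_abs_rpow_half_sq (M : Matrix n n ℂ) : ‖CFC.abs M ^ (1 / 2 : ℝ)‖ ^ 2 = ‖M‖ := by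
  have h := CStarRing.norm_star_mul_self (x := CFC.abs M ^ (1 / 2 : ℝ))
  rw [isSelfAdjoint_abs_rpow, abs_rpow_half_mul_self, CFC.norm_abs] at h
  rw [sq, h]

lemma norm_mul_abs_rpow_neg_half_sq (M : Matrix n n ℂ) :
    ‖M * CFC.abs M ^ (-(1 / 2) : ℝ)‖ ^ 2 = ‖M‖ := by
  have h := CStarRing.norm_star_mul_self (x := M * CFC.abs M ^ (-(1 / 2) : ℝ))
  rw [star_mul_abs_rpow_neg_half, CFC.norm_abs] at h
  rw [sq, h]

end Norm

end SquareRoot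

section Factors

open scoped Matrix.Norms.L2Operator

lemma exists_norm_map_le {m n : Type*} [Fintype m] [DecidableEq m] [Fintype n] [DecidableEq n]
    (T : Matrix m m ℂ →ₗ[ℂ] Matrix n n ℂ) : ∃ c : ℝ, 0 ≤ c ∧ ∀ X, ‖act (T X)‖ ≤ c * ‖X‖ := by
  let T' : Matrix m m ℂ →L[ℂ] Matrix n n ℂ := LinearMap.toContinuousLinearMap T
  exact ⟨‖T'‖, norm_nonneg _, fun X => T'.le_opNorm X⟩

/-- Embedding of the upper left block. -/
def upperLeft : Matrix (Fin 2) (Fin 2) ℂ →ₗ[ℂ] Matrix (Fin 2 ⊕ Fin 2) (Fin 2 ⊕ Fin 2) ℂ where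
  toFun X := Matrix.fromBlocks X 0 0 0
  map_add' X Y := by simp [Matrix.fromBlocks_add]
  map_smul' c X := by simp [Matrix.fromBlocks_smul]

/-- The map `X ↦ [0, 0; -B⁻¹ X, 0]`. -/
def lowerLeft (p : Params) :
    Matrix (Fin 2) (Fin 2) ℂ →ₗ[ℂ] Matrix (Fin 2 ⊕ Fin 2) (Fin 2 ⊕ Fin 2) ℂ where
  toFun X := Matrix.fromBlocks 0 0 (-((matB p)⁻¹ * X)) 0
  map_add' X Y := by simp [Matrix.fromBlocks_add, Matrix.mul_add, add_comm]
  map_smul' c X := by simp [Matrix.fromBlocks_smul]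

lemma matRr_eq (p : Params) (z : ℂ) : matRr p z = upperLeft (CFC.abs (matM p z) ^ (1 / 2 : ℝ)) :=
  rfl

lemma matRl_eq (p : Params) (z : ℂ) :
    matRl p z = lowerLeft p (matM p z * CFC.abs (matM p z) ^ (-(1 / 2) : ℝ)) := by
  rw [matRl, Matrix.mul_assoc]; rfl

lemma matRl_mul_matRr (p : Params) (z : ℂ) :
    matRl p z * matRr p z = Matrix.fromBlocks 0 0 (-((matB p)⁻¹ * matM p z)) 0 := by
  rw [matRl, matRr, Matrix.fromBlocks_multiply]
  have := mul_abs_rpow_mul_abs_rpow (matM p z)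
  simp only [Matrix.mul_zero, Matrix.zero_mul, add_zero, Matrix.neg_mul]
  rw [Matrix.mul_assoc, Matrix.mul_assoc, ← Matrix.mul_assoc (matM p z), this]

variable {p : Params} {ψ : ℝ → ℂ}

lemma aestronglyMeasurable_act_matRr (hψ : Continuous ψ) :
    AEStronglyMeasurable (fun x => act (matRr p (ψ x))) (volume : Measure ℝ) :=
  (continuous_act.comp ((LinearMap.continuous_of_finiteDimensional upperLeft).comp
    (continuous_abs_rpow_half.comp ((continuous_matM p).comp hψ)))).aestronglyMeasurable

lemma aestronglyMeasurable_act_matRl (hψ : Continuous ψ) :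
    AEStronglyMeasurable (fun x => act (matRl p (ψ x))) (volume : Measure ℝ) := by
  have hM := (continuous_matM p).comp hψ
  have h1 := hM.aestronglyMeasurable.mul (aestronglyMeasurable_abs_rpow_neg_half hM)
  simp only [matRl_eq]
  exact (continuous_act.comp (LinearMap.continuous_of_finiteDimensional
    (lowerLeft p))).comp_aestronglyMeasurable h1

/-- Both factors inherit the decay of the pulse, since their squares are of the size of `M`. -/
lemma exists_norm_factors_le {C a : ℝ} (hC : 0 ≤ C) (ha : 0 < a)
    (hdecay : ∀ x : ℝ, ‖ψ x‖ ≤ C * Real.exp (-a * |x|)) :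
    ∃ K : ℝ, 0 ≤ K ∧ ∀ x, ‖act (matRr p (ψ x))‖ ≤ K * Real.exp (-a * |x|) ∧
      ‖act (matRl p (ψ x))‖ ≤ K * Real.exp (-a * |x|) := by
  have hb : ∀ x, ‖ψ x‖ ≤ C := fun x => (hdecay x).trans
    (mul_le_of_le_one_right hC (Real.exp_le_one_iff.2 (by nlinarith [abs_nonneg x])))
  obtain ⟨K, hK0, hK⟩ := exists_norm_act_matM_le p C
  obtain ⟨c₁, hc₁, h₁⟩ := exists_norm_map_le upperLeft
  obtain ⟨c₂, hc₂, h₂⟩ := exists_norm_map_le (lowerLeft p)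
  have key : ∀ (x : ℝ) (X : Matrix (Fin 2) (Fin 2) ℂ), ‖X‖ ^ 2 = ‖matM p (ψ x)‖ →
      ‖X‖ ≤ √K * C * Real.exp (-a * |x|) := by
    intro x X hX
    refine le_of_sq_le_sq ?_ (by positivity)
    rw [hX, mul_assoc, mul_pow, Real.sq_sqrt hK0]
    refine (hK _ (hb x)).trans ?_
    gcongr
    exact hdecay x
  refine ⟨(c₁ + c₂) * (√K * C), by positivity, fun x => ⟨?_, ?_⟩⟩
  · rw [matRr_eq, mul_assoc]
    refine (h₁ _).trans ?_
    gcongr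
    · linarith
    · exact key x _ (norm_abs_rpow_half_sq _)
  · rw [matRl_eq, mul_assoc]
    refine (h₂ _).trans ?_
    gcongr
    · linarith
    · exact key x _ (norm_mul_abs_rpow_neg_half_sq _)

lemma memLp_top_of_norm_le_exp {n : Type*} [Fintype n] [DecidableEq n] {F : ℝ → Matrix n n ℂ}
    {K a : ℝ} (hK : 0 ≤ K) (ha : 0 < a)
    (hF : AEStronglyMeasurable (fun x => act (F x)) (volume : Measure ℝ))
    (h : ∀ x, ‖act (F x)‖ ≤ K * Real.exp (-a * |x|)) :
    MemLp (fun x => act (F x)) ∞ (volume : Measure ℝ) :=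
  memLp_top_of_bound hF K (Eventually.of_forall fun x => (h x).trans
    (mul_le_of_le_one_right hK (Real.exp_le_one_iff.2 (by nlinarith [abs_nonneg x]))))

end Factors

/-! ### Integral operators with decaying kernels -/

section IntegralOperators

variable {n : Type*} [Fintype n] [DecidableEq n]

lemma IsIntegralOperator.mulOp_comp_comp {k : ℝ → ℝ → Matrix n n ℂ} {T : L2 n →L[ℂ] L2 n}
    (hT : IsIntegralOperator k T) {P Q : ℝ → Matrix n n ℂ}
    (hP : MemLp (fun x => act (P x)) ∞ (volume : Measure ℝ))
    (hQ : MemLp (fun x => act (Q x)) ∞ (volume : Measure ℝ)) :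
    IsIntegralOperator (fun x y => P x * k x y * Q y) (mulOp P ∘L T ∘L mulOp Q) := by
  intro f
  filter_upwards [hT (mulOp Q f), mulOp_apply hP (T (mulOp Q f))] with x hx hPx
  have hae : (fun y => act (P x) (act (k x y) (mulOp Q f y))) =ᵐ[volume]
      fun y => act (P x * k x y * Q y) (f y) := by
    filter_upwards [mulOp_apply hQ f] with y hy
    rw [hy, act_mul_apply, act_mul_apply]
  refine ⟨((act (P x)).integrable_comp hx.1).congr hae, ?_⟩
  rw [← integral_congr_ae hae, (act (P x)).integral_comp_comm hx.1, ← hx.2]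
  exact hPx

lemma IsIntegralOperator.integralOperator {k : ℝ → ℝ → Matrix n n ℂ} {T : L2 n →L[ℂ] L2 n}
    (hT : IsIntegralOperator k T) : CGLE.integralOperator k = T := by
  have h : ∃ T, IsIntegralOperator k T := ⟨T, hT⟩
  rw [CGLE.integralOperator, dif_pos h]
  exact h.choose_spec.unique hT

/-- Bessel's inequality for a functional `z` that is only given on a finite orthonormal system. -/
lemma sum_norm_sq_le_of_orthonormal {H : Type*} [NormedAddCommGroup H] [InnerProductSpace ℂ H]
    {s : Finset H} (hs : Orthonormal ℂ (fun e : s => (e : H))) (z : H → ℂ) {B : ℝ}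
    (h : ∀ c : H → ℂ, ‖∑ e ∈ s, c e * z e‖ ≤ B * ‖∑ e ∈ s, c e • e‖) :
    ∑ e ∈ s, ‖z e‖ ^ 2 ≤ B ^ 2 := by
  set S := ∑ e ∈ s, ‖z e‖ ^ 2 with hS
  have hS0 : 0 ≤ S := Finset.sum_nonneg fun _ _ => by positivity
  have h1 : ∑ e ∈ s, star (z e) * z e = (S : ℂ) := by
    rw [hS]
    push_cast
    refine Finset.sum_congr rfl fun e _ => ?_
    exact Complex.conj_mul' (z e)
  have h2 : ‖∑ e ∈ s, star (z e) • e‖ ^ 2 = S := by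
    have h3 := hs.inner_sum (fun e : s => star (z e)) (fun e : s => star (z e)) Finset.univ
    rw [Finset.sum_coe_sort s (fun e => star (z e) • e), inner_self_eq_norm_sq_to_K] at h3
    have h4 : ∑ e : s, (starRingEnd ℂ) (star (z e)) * star (z e) = (S : ℂ) := by
      rw [← h1, ← Finset.sum_coe_sort s (fun e => star (z e) * z e)]
      exact Finset.sum_congr rfl fun e _ => by simp [mul_comm]
    rw [h4] at h3
    exact Complex.ofReal_injective ((Complex.ofReal_pow _ 2).trans h3)
  have h3 := h fun e => star (z e)
  rw [h1, Complex.norm_real, Real.norm_of_nonneg hS0] at h3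
  have h4 : ‖∑ e ∈ s, star (z e) • e‖ = √S := by rw [← h2, Real.sqrt_sq (norm_nonneg _)]
  rw [h4] at h3
  have h5 := Real.sq_sqrt hS0
  rcases eq_or_lt_of_le hS0 with h0 | h0
  · rw [← h0]; positivity
  · have h6 : √S ≤ B := by
      have h7 := Real.sqrt_pos.2 h0
      refine le_of_mul_le_mul_right ?_ h7
      rw [← sq, h5]
      exact h3
    rw [← h5]
    gcongr

/-- An integral operator with kernel dominated by `g(x) g(y)` for some `g ∈ L²` is
Hilbert–Schmidt. -/
lemma IsIntegralOperator.isHilbertSchmidt {k : ℝ → ℝ → Matrix n n ℂ} {T : L2 n →L[ℂ] L2 n}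
    (hT : IsIntegralOperator k T) {g : ℝ → ℝ} (hg : MemLp g 2 volume) (hg0 : ∀ x, 0 ≤ g x)
    (hk : ∀ x y, ‖act (k x y)‖ ≤ g x * g y) : IsHilbertSchmidt T := by
  have hgi : Integrable fun x => g x ^ 2 := hg.integrable_sq
  set J := ∫ x, g x ^ 2 with hJ
  have hJ0 : 0 ≤ J := integral_nonneg fun x => by positivity
  have hcs : ∀ f : L2 n, Integrable (fun y => g y * ‖f y‖) ∧ ∫ y, g y * ‖f y‖ ≤ √J * ‖f‖ := by
    intro f
    refine ⟨hg.integrable_mul (Lp.memLp f).norm, ?_⟩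
    have h1 := integral_mul_le_Lp_mul_Lq_of_nonneg (μ := (volume : Measure ℝ))
      Real.HolderConjugate.two_two (f := g) (g := fun y => ‖f y‖)
      (Eventually.of_forall hg0) (Eventually.of_forall fun y => norm_nonneg _)
      (by simpa using hg) (by simpa using (Lp.memLp f).norm)
    simp only [Real.rpow_two, ← hJ, ← norm_sq_eq_integral, ← Real.sqrt_eq_rpow] at h1
    rwa [Real.sqrt_sq (norm_nonneg _)] at h1
  let N : ℝ := Fintype.card n
  have hpt : ∀ s : Finset (L2 n), Orthonormal ℂ (fun e : s => (e : L2 n)) →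
      ∀ᵐ x : ℝ, ∑ e ∈ s, ‖T e x‖ ^ 2 ≤ N * (g x * √J) ^ 2 := by
    intro s hs
    have h1 : ∀ᵐ x : ℝ, ∀ e ∈ s, Integrable (fun y => act (k x y) (e y)) ∧
        T e x = ∫ y, act (k x y) (e y) := (ae_ball_iff s.countable_toSet).2 fun e _ => hT e
    filter_upwards [h1] with x hx
    have h2 : ∀ i, ∑ e ∈ s, ‖T e x i‖ ^ 2 ≤ (g x * √J) ^ 2 := by
      intro i
      refine sum_norm_sq_le_of_orthonormal hs (fun e => T e x i) fun c => ?_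
      have h3 : ∑ e ∈ s, c e • T e x = ∫ y, act (k x y) ((∑ e ∈ s, c e • e : L2 n) y) := by
        have h4 : (fun y => ∑ e ∈ s, c e • act (k x y) (e y)) =ᵐ[volume]
            fun y => act (k x y) ((∑ e ∈ s, c e • e : L2 n) y) := by
          have h5 : ∀ᵐ y : ℝ, ∀ e ∈ s, (c e • e : L2 n) y = c e • e y :=
            (ae_ball_iff s.countable_toSet).2 fun e _ => Lp.coeFn_smul _ _
          filter_upwards [Lp.coeFn_finsetSum (p := 2) (μ := (volume : Measure ℝ)) s
            (fun e : L2 n => c e • e), h5] with y h6 h7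
          rw [h6, Finset.sum_apply, map_sum]
          refine Finset.sum_congr rfl fun e he => ?_
          rw [h7 e he, map_smul]
        have h9 : ∀ e ∈ s, Integrable fun y => c e • act (k x y) (e y) := fun e he =>
          (hx e he).1.smul (c e)
        rw [← integral_congr_ae h4, integral_finsetSum _ h9]
        refine Finset.sum_congr rfl fun e he => ?_
        rw [integral_smul, (hx e he).2]
      have h8 : ∑ e ∈ s, c e * T e x i = (∑ e ∈ s, c e • T e x) i := by
        simp
      rw [h8, h3]
      set F : L2 n := ∑ e ∈ s, c e • e
      refine (PiLp.norm_apply_le _ i).trans ?_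
      calc ‖∫ y, act (k x y) (F y)‖ ≤ ∫ y, g x * (g y * ‖F y‖) := by
            refine norm_integral_le_of_norm_le ((hcs F).1.const_mul _)
              (Eventually.of_forall fun y => ?_)
            rw [← mul_assoc]
            exact (ContinuousLinearMap.le_opNorm _ _).trans (by gcongr; exact hk x y)
        _ = g x * ∫ y, g y * ‖F y‖ := integral_const_mul _ _
        _ ≤ g x * (√J * ‖F‖) := by
            gcongr
            · exact hg0 x
            · exact (hcs F).2
        _ = g x * √J * ‖F‖ := by ring
    calc ∑ e ∈ s, ‖T e x‖ ^ 2 = ∑ i, ∑ e ∈ s, ‖T e x i‖ ^ 2 := by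
          rw [Finset.sum_comm]
          exact Finset.sum_congr rfl fun e _ => EuclideanSpace.norm_sq_eq _
      _ ≤ ∑ _i : n, (g x * √J) ^ 2 := Finset.sum_le_sum fun i _ => h2 i
      _ = N * (g x * √J) ^ 2 := by simp [N]
  have hfin : ∀ s : Finset (L2 n), Orthonormal ℂ (fun e : s => (e : L2 n)) →
      ∑ e ∈ s, ‖T e‖ ^ 2 ≤ N * J ^ 2 := by
    intro s hs
    calc ∑ e ∈ s, ‖T e‖ ^ 2 = ∫ x, ∑ e ∈ s, ‖T e x‖ ^ 2 := by
          rw [integral_finsetSum _ fun e _ => (Lp.memLp (T e)).integrable_norm_pow (by simp)]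
          exact Finset.sum_congr rfl fun e _ => norm_sq_eq_integral _
      _ ≤ ∫ x, N * (g x * √J) ^ 2 := by
          refine integral_mono_of_nonneg (Eventually.of_forall fun x => ?_) ?_ (hpt s hs)
          · exact Finset.sum_nonneg fun _ _ => by positivity
          · simp only [mul_pow]
            exact (hgi.mul_const _).const_mul _
      _ = N * J ^ 2 := by
          simp only [mul_pow, Real.sq_sqrt hJ0]
          rw [integral_const_mul, integral_mul_const, ← hJ, sq]
  have hle : hsNorm T ≤ ENNReal.ofReal (√(N * J ^ 2)) := by
    rw [hsNorm_le_iff]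
    intro s hs
    have h1 : ∑ e ∈ s, ‖T e‖ₑ ^ 2 = ENNReal.ofReal (∑ e ∈ s, ‖T e‖ ^ 2) := by
      rw [ENNReal.ofReal_sum_of_nonneg fun e _ => by positivity]
      refine Finset.sum_congr rfl fun e _ => ?_
      rw [ENNReal.ofReal_pow (norm_nonneg _), ofReal_norm]
    rw [h1, ← ENNReal.ofReal_pow (Real.sqrt_nonneg _), Real.sq_sqrt (by positivity)]
    exact ENNReal.ofReal_le_ofReal (hfin s hs)
  exact hle.trans_lt ENNReal.ofReal_lt_top

lemma memLp_two_exp_neg_mul_abs {a : ℝ} (ha : 0 < a) :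
    MemLp (fun x : ℝ => Real.exp (-a * |x|)) 2 volume := by
  rw [memLp_two_iff_integrable_sq (by fun_prop)]
  have := integrable_exp_neg_mul_abs (mul_pos two_pos ha)
  refine this.congr (Eventually.of_forall fun x => ?_)
  simp only [← Real.exp_nat_mul]
  congr 1
  push_cast
  ring

end IntegralOperators

section GreenBound

variable {n : Type*} [Fintype n] [DecidableEq n] {ι : Type*} [Fintype ι] [DecidableEq ι]
  {A : Matrix n n ℂ} {d : ι → ℂ} {E : ι → Matrix n n ℂ}

lemma IsSpectralDecomposition.norm_act_greenKernel_le (h : IsSpectralDecomposition A d E) (x : ℝ) :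
    ‖act (greenKernel A x)‖ ≤ ∑ i, ‖act (E i)‖ := by
  rw [h.greenKernel_eq, act, map_sum]
  refine norm_sum_le_of_le _ fun i _ => ?_
  rw [map_smul, norm_smul]
  refine mul_le_of_le_one_left (norm_nonneg _) ((norm_scalarGreen_le _ _).trans ?_)
  exact Real.exp_le_one_iff.2 (by nlinarith [abs_nonneg (d i).re, abs_nonneg x])

end GreenBound

/-! ### The eigenvalue problem as a first-order system -/

section System

/-- The first component of a vector of `ℂ² × ℂ²`. -/
def upper : EuclideanSpace ℂ (Fin 2 ⊕ Fin 2) →L[ℂ] EuclideanSpace ℂ (Fin 2) :=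
  LinearMap.toContinuousLinearMap
    { toFun := fun v => WithLp.toLp 2 fun i => v (Sum.inl i)
      map_add' := fun _ _ => rfl
      map_smul' := fun _ _ => rfl }

/-- The second component of a vector of `ℂ² × ℂ²`. -/
def lower : EuclideanSpace ℂ (Fin 2 ⊕ Fin 2) →L[ℂ] EuclideanSpace ℂ (Fin 2) :=
  LinearMap.toContinuousLinearMap
    { toFun := fun v => WithLp.toLp 2 fun i => v (Sum.inr i)
      map_add' := fun _ _ => rfl
      map_smul' := fun _ _ => rfl }

/-- The embedding of the first factor into `ℂ² × ℂ²`. -/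
def inUpper : EuclideanSpace ℂ (Fin 2) →L[ℂ] EuclideanSpace ℂ (Fin 2 ⊕ Fin 2) :=
  LinearMap.toContinuousLinearMap
    { toFun := fun v => WithLp.toLp 2 (Sum.elim v 0)
      map_add' := fun u v => by ext (i | i) <;> simp
      map_smul' := fun c v => by ext (i | i) <;> simp }

/-- The embedding of the second factor into `ℂ² × ℂ²`. -/
def inLower : EuclideanSpace ℂ (Fin 2) →L[ℂ] EuclideanSpace ℂ (Fin 2 ⊕ Fin 2) :=
  LinearMap.toContinuousLinearMap
    { toFun := fun v => WithLp.toLp 2 (Sum.elim 0 v)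
      map_add' := fun u v => by ext (i | i) <;> simp
      map_smul' := fun c v => by ext (i | i) <;> simp }

@[simp] lemma upper_apply (v : EuclideanSpace ℂ (Fin 2 ⊕ Fin 2)) (i : Fin 2) :
    upper v i = v (Sum.inl i) := rfl

@[simp] lemma lower_apply (v : EuclideanSpace ℂ (Fin 2 ⊕ Fin 2)) (i : Fin 2) :
    lower v i = v (Sum.inr i) := rfl

lemma upper_inUpper_add (u v : EuclideanSpace ℂ (Fin 2)) :
    upper (inUpper u + inLower v) = u := by
  ext i; simp [inUpper, inLower]

lemma lower_inUpper_add (u v : EuclideanSpace ℂ (Fin 2)) :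
    lower (inUpper u + inLower v) = v := by
  ext i; simp [inUpper, inLower]

lemma inUpper_upper_add (v : EuclideanSpace ℂ (Fin 2 ⊕ Fin 2)) :
    inUpper (upper v) + inLower (lower v) = v := by
  ext (i | i) <;> simp [inUpper, inLower]

lemma act_fromBlocks (A B C D : Matrix (Fin 2) (Fin 2) ℂ) (v : EuclideanSpace ℂ (Fin 2 ⊕ Fin 2)) :
    act (Matrix.fromBlocks A B C D) v = inUpper (act A (upper v) + act B (lower v)) +
      inLower (act C (upper v) + act D (lower v)) := by
  have h : ∀ w, upper w = WithLp.toLp 2 (w.ofLp ∘ Sum.inl) ∧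
      lower w = WithLp.toLp 2 (w.ofLp ∘ Sum.inr) := fun w => ⟨rfl, rfl⟩
  rw [(h v).1, (h v).2]
  ext (i | i) <;>
    simp [inUpper, inLower, act, Matrix.ofLp_toEuclideanCLM, Matrix.fromBlocks_mulVec]

/-- The zeroth-order term of the first-order system whose first component is an eigenfunction. -/
lemma act_matAInf_add (p : Params) (l z : ℂ) (v : EuclideanSpace ℂ (Fin 2 ⊕ Fin 2)) :
    act (matAInf p l) v + act (matRl p z) (act (matRr p z) v) = inUpper (lower v) +
      inLower (act (matB p)⁻¹ (l • upper v - act (matN0 p + matM p z) (upper v))) := by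
  rw [← act_mul_apply, matRl_mul_matRr, matAInf, act_fromBlocks, act_fromBlocks]
  have h0 : ∀ w : EuclideanSpace ℂ (Fin 2), act (0 : Matrix (Fin 2) (Fin 2) ℂ) w = 0 := by
    intro w; simp only [act, map_zero]; rfl
  have hN : act (l • 1 - matN0 p) (upper v) = l • upper v - act (matN0 p) (upper v) := by
    conv_rhs => rw [← act_one_apply (upper v)]
    simp only [act, map_sub, map_smul, map_one]; rfl
  have hneg : act (-((matB p)⁻¹ * matM p z)) (upper v)
      = -act (matB p)⁻¹ (act (matM p z) (upper v)) := by
    rw [← act_mul_apply]; simp only [act, map_neg]; rfl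
  have hadd : act (matN0 p + matM p z) (upper v)
      = act (matN0 p) (upper v) + act (matM p z) (upper v) := by
    simp only [act, map_add]; rfl
  simp only [h0, act_one_apply, act_mul_apply, hN, hneg, hadd]
  simp only [map_sub, map_add, map_neg, map_zero]
  abel

/-- The first component of an `L²` function. -/
abbrev upperL : L2 (Fin 2 ⊕ Fin 2) →L[ℂ] L2 (Fin 2) := upper.compLpL 2 volume

/-- The second component of an `L²` function. -/
abbrev lowerL : L2 (Fin 2 ⊕ Fin 2) →L[ℂ] L2 (Fin 2) := lower.compLpL 2 volume

/-- The embedding of the first factor, on `L²` functions. -/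
abbrev inUpperL : L2 (Fin 2) →L[ℂ] L2 (Fin 2 ⊕ Fin 2) := inUpper.compLpL 2 volume

/-- The embedding of the second factor, on `L²` functions. -/
abbrev inLowerL : L2 (Fin 2) →L[ℂ] L2 (Fin 2 ⊕ Fin 2) := inLower.compLpL 2 volume

lemma inUpperL_add_inLowerL_apply (u v : L2 (Fin 2)) :
    inUpperL u + inLowerL v =ᵐ[volume] fun x => inUpper (u x) + inLower (v x) := by
  filter_upwards [inUpper.coeFn_compLpL (p := 2) (μ := volume) u,
    inLower.coeFn_compLpL (p := 2) (μ := volume) v,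
    Lp.coeFn_add (inUpperL u) (inLowerL v)] with x h1 h2 h3
  rw [h3, Pi.add_apply, h1, h2]

lemma upperL_inUpperL_add (u v : L2 (Fin 2)) : upperL (inUpperL u + inLowerL v) = u := by
  apply Lp.ext
  filter_upwards [inUpperL_add_inLowerL_apply u v,
    upper.coeFn_compLpL (p := 2) (μ := volume) (inUpperL u + inLowerL v)] with x h1 h2
  rw [h2, h1, upper_inUpper_add]

lemma lowerL_inUpperL_add (u v : L2 (Fin 2)) : lowerL (inUpperL u + inLowerL v) = v := by
  apply Lp.ext
  filter_upwards [inUpperL_add_inLowerL_apply u v,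
    lower.coeFn_compLpL (p := 2) (μ := volume) (inUpperL u + inLowerL v)] with x h1 h2
  rw [h2, h1, lower_inUpper_add]

lemma inUpperL_upperL_add (U : L2 (Fin 2 ⊕ Fin 2)) :
    inUpperL (upperL U) + inLowerL (lowerL U) = U := by
  apply Lp.ext
  filter_upwards [inUpperL_add_inLowerL_apply (upperL U) (lowerL U),
    upper.coeFn_compLpL (p := 2) (μ := volume) U,
    lower.coeFn_compLpL (p := 2) (μ := volume) U] with x h1 h2 h3
  rw [h1, h2, h3, inUpper_upper_add]

variable {p : Params} {ψ : ℝ → ℂ} {l : ℂ}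

lemma matOp_matAInf_add
    (hV : MemLp (fun x => act (potential p ψ x)) ∞ (volume : Measure ℝ))
    (hr : MemLp (fun x => act (matRr p (ψ x))) ∞ (volume : Measure ℝ))
    (hl : MemLp (fun x => act (matRl p (ψ x))) ∞ (volume : Measure ℝ))
    (U : L2 (Fin 2 ⊕ Fin 2)) :
    matOp (matAInf p l) U +
        mulOp (fun x => matRl p (ψ x)) (mulOp (fun x => matRr p (ψ x)) U) =
      inUpperL (lowerL U) +
        inLowerL (matOp (matB p)⁻¹ (l • upperL U - mulOp (potential p ψ) (upperL U))) := by
  set W := mulOp (fun x => matRr p (ψ x)) U with hW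
  set Y := l • upperL U - mulOp (potential p ψ) (upperL U) with hY
  apply Lp.ext
  filter_upwards [inUpperL_add_inLowerL_apply (lowerL U) (matOp (matB p)⁻¹ Y),
    lower.coeFn_compLpL (p := 2) (μ := volume) U, upper.coeFn_compLpL (p := 2) (μ := volume) U,
    matOp_apply (matB p)⁻¹ Y, Lp.coeFn_sub (l • upperL U) (mulOp (potential p ψ) (upperL U)),
    Lp.coeFn_smul l (upperL U), mulOp_apply hV (upperL U), mulOp_apply hr U, mulOp_apply hl W,
    matOp_apply (matAInf p l) U,
    Lp.coeFn_add (matOp (matAInf p l) U) (mulOp (fun x => matRl p (ψ x)) W)]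
    with x h1 h2 h3 h4 h5 h6 h7 h8 h9 h10 h11
  rw [h1, h4, hY, h5, Pi.sub_apply, h6, Pi.smul_apply, h7, h2, h3, h11, Pi.add_apply, h10, h9, hW,
    h8, act_matAInf_add]
  rfl

/-- Eigenfunctions of `𝓛` for the eigenvalue `λ` correspond to the solutions in `H¹` of the
first-order system, and these to the eigenfunctions of `R_r G R_ℓ` for the eigenvalue `-1`. -/
lemma ker_shift_ne_bot_iff (hB : IsUnit (matB p).det)
    (hV : MemLp (fun x => act (potential p ψ x)) ∞ (volume : Measure ℝ))
    (hr : MemLp (fun x => act (matRr p (ψ x))) ∞ (volume : Measure ℝ))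
    (hl : MemLp (fun x => act (matRl p (ψ x))) ∞ (volume : Measure ℝ))
    {ι : Type*} [Fintype ι] [DecidableEq ι] {d : ι → ℂ}
    {E : ι → Matrix (Fin 2 ⊕ Fin 2) (Fin 2 ⊕ Fin 2) ℂ}
    (h : IsSpectralDecomposition (matAInf p l) d E) (hd : ∀ i, (d i).re ≠ 0) :
    LinearMap.ker (linShift p ψ l) ≠ ⊥ ↔ ∃ w : L2 (Fin 2 ⊕ Fin 2), w ≠ 0 ∧
      (mulOp (fun x => matRr p (ψ x)) ∘L h.greenOp hd ∘L mulOp fun x => matRl p (ψ x)) w = -w := by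
  have hsys := matOp_matAInf_add (l := l) hV hr hl
  set Rr := mulOp fun x => matRr p (ψ x)
  set Rl := mulOp fun x => matRl p (ψ x)
  constructor
  · intro hker
    obtain ⟨u, hu, hu0⟩ := (Submodule.ne_bot_iff _).1 hker
    rw [LinearMap.mem_ker, linShift_apply] at hu
    obtain ⟨g, hg1, hg2⟩ := secondDeriv_spec u
    set U : L2 (Fin 2 ⊕ Fin 2) := inUpperL (u : L2 (Fin 2)) + inLowerL g with hU
    have hupper : upperL U = u := upperL_inUpperL_add _ _
    have hlower : lowerL U = g := lowerL_inUpperL_add _ _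
    have hsd : secondDeriv u
        = matOp (matB p)⁻¹ (l • (u : L2 (Fin 2)) - mulOp (potential p ψ) u) := by
      have h1 : l • (u : L2 (Fin 2)) - mulOp (potential p ψ) u
          = matOp (matB p) (secondDeriv u) := by
        rw [sub_eq_zero] at hu
        rw [← hu, add_sub_cancel_right]
      rw [h1, ← matOp_mul, Matrix.nonsing_inv_mul _ hB, matOp_one]
    have hUd : HasWeakDeriv U (matOp (matAInf p l) U - -Rl (Rr U)) := by
      rw [sub_neg_eq_add, hsys, hupper, hlower, ← hsd]
      exact (hg1.compLpL inUpper).add (hg2.compLpL inLower)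
    have hUG := h.eq_greenOp hd hUd
    rw [map_neg] at hUG
    refine ⟨Rr U, fun h0 => hu0 ?_, ?_⟩
    · rw [h0, map_zero, map_zero, neg_zero] at hUG
      apply Subtype.ext
      rw [← hupper, hUG, map_zero]; rfl
    · change Rr (h.greenOp hd (Rl (Rr U))) = -Rr U
      conv_rhs => rw [hUG, map_neg, neg_neg]
  · rintro ⟨w, hw0, hw⟩
    change Rr (h.greenOp hd (Rl w)) = -w at hw
    set U := h.greenOp hd (-Rl w) with hU
    have hRU : Rr U = w := by rw [hU, map_neg, map_neg, hw, neg_neg]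
    have hUd := h.hasWeakDeriv_greenOp hd (-Rl w)
    rw [← hU, sub_neg_eq_add] at hUd
    conv at hUd => enter [2, 2]; rw [← hRU]
    rw [hsys] at hUd
    have h1 := hUd.compLpL upper
    have h2 := hUd.compLpL lower
    change HasWeakDeriv (upperL U) (upperL _) at h1
    change HasWeakDeriv (lowerL U) (lowerL _) at h2
    rw [upperL_inUpperL_add] at h1
    rw [lowerL_inUpperL_add] at h2
    have h3 : HasWeakDeriv₂ (upperL U) _ := ⟨_, h1, h2⟩
    refine (Submodule.ne_bot_iff _).2 ⟨⟨upperL U, ⟨_, h3⟩⟩, ?_, fun h0 => hw0 ?_⟩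
    · rw [LinearMap.mem_ker, linShift_apply,
        (secondDeriv_spec ⟨upperL U, ⟨_, h3⟩⟩).unique h3, ← matOp_mul, Matrix.mul_nonsing_inv _ hB,
        matOp_one]
      abel
    · have h4 : upperL U = 0 := congrArg Subtype.val h0
      rw [h4] at h1
      have h5 := h1.unique hasWeakDeriv_zero
      rw [← hRU, ← inUpperL_upperL_add U, h4, h5, map_zero, map_zero, add_zero, map_zero]

end System

/-- If `𝓛 - λ` is Fredholm, then the Birman–Schwinger operator `𝓚(λ)` is a Hilbert–Schmidt operator
and has the eigenvalue `-1` exactly if `λ` is an eigenvalue of `𝓛`. -/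
lemma birmanSchwinger_spec {p : Params} (hDβ : (p.D, p.β) ≠ (0, 0)) {ψ : ℝ → ℂ}
    (hψ : Continuous ψ) {C a : ℝ} (hC : 0 ≤ C) (ha : 0 < a)
    (hdecay : ∀ x : ℝ, ‖ψ x‖ ≤ C * Real.exp (-a * |x|)) {l : ℂ}
    (hF : IsFredholmAt (linearization p ψ) l) :
    IsIntegralOperator (birmanSchwingerKernel p ψ l) (birmanSchwinger p ψ l) ∧
    IsHilbertSchmidt (birmanSchwinger p ψ l) ∧
    (l ∈ pointSpectrum (linearization p ψ) ↔
      ∃ w, w ≠ 0 ∧ birmanSchwinger p ψ l w = -w) := by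
  obtain ⟨d, E, h, hd⟩ := exists_isSpectralDecomposition hDβ
    (eigSq_ne_of_isFredholmAt hDβ hψ ha hdecay hF)
  obtain ⟨K, hK0, hK⟩ := exists_norm_factors_le (p := p) hC ha hdecay
  have hr := memLp_top_of_norm_le_exp hK0 ha (aestronglyMeasurable_act_matRr (p := p) hψ)
    fun x => (hK x).1
  have hl := memLp_top_of_norm_le_exp hK0 ha (aestronglyMeasurable_act_matRl (p := p) hψ)
    fun x => (hK x).2
  have hV := memLp_potential p hψ fun x => (hdecay x).trans
    (mul_le_of_le_one_right hC (Real.exp_le_one_iff.2 (by nlinarith [abs_nonneg x])))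
  have hT : IsIntegralOperator (birmanSchwingerKernel p ψ l) _ :=
    (h.isIntegralOperator_greenOp hd).mulOp_comp_comp hr hl
  have hBS : birmanSchwinger p ψ l = _ := hT.integralOperator
  rw [hBS]
  refine ⟨hT, ?_, ker_shift_ne_bot_iff (isUnit_matB hDβ) hV hr hl h hd⟩
  set S := ∑ i, ‖act (E i)‖
  have hS : 0 ≤ S := Finset.sum_nonneg fun i _ => norm_nonneg _
  refine hT.isHilbertSchmidt (g := fun x => √S * K * Real.exp (-a * |x|))
    ((memLp_two_exp_neg_mul_abs ha).const_mul _) (fun x => by positivity) fun x y => ?_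
  have hmul : act (birmanSchwingerKernel p ψ l x y)
      = act (matRr p (ψ x)) * act (greenKernel (matAInf p l) (x - y)) * act (matRl p (ψ y)) := by
    simp only [birmanSchwingerKernel, act, map_mul]
  rw [hmul]
  calc _ ≤ ‖act (matRr p (ψ x))‖ * ‖act (greenKernel (matAInf p l) (x - y))‖ *
        ‖act (matRl p (ψ y))‖ := (norm_mul_le _ _).trans (by gcongr; exact norm_mul_le _ _)
    _ ≤ K * Real.exp (-a * |x|) * S * (K * Real.exp (-a * |y|)) := by
        gcongr
        · exact (hK x).1
        · exact h.norm_act_greenKernel_le _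
        · exact (hK y).2
    _ = √S * √S * (K * Real.exp (-a * |x|) * (K * Real.exp (-a * |y|))) := by
        rw [Real.mul_self_sqrt hS]; ring
    _ = _ := by ring

end CGLE

end

theorem theorem5p2 (p : CGLE.Params) (hβ : 0 ≤ p.β) (hDβ : (p.D, p.β) ≠ (0, 0))
    (ψ : ℝ → ℂ) (hψ : CGLE.IsStationarySolution p ψ)
    (hdecay : ∃ C a : ℝ, 0 < C ∧ 0 < a ∧ ∀ x : ℝ, ‖ψ x‖ ≤ C * Real.exp (-a * |x|))
    (l : ℂ) (hl : l ∉ CGLE.essentialSpectrum (CGLE.linearization p ψ)) :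
    CGLE.IsIntegralOperator (CGLE.birmanSchwingerKernel p ψ l) (CGLE.birmanSchwinger p ψ l) ∧
    CGLE.IsHilbertSchmidt (CGLE.birmanSchwinger p ψ l) ∧
    (l ∈ CGLE.pointSpectrum (CGLE.linearization p ψ) ↔
      CGLE.detTwo (CGLE.birmanSchwinger p ψ l) = 0) := by
  obtain ⟨C, a, hC, ha, hdec⟩ := hdecay
  obtain ⟨h1, h2, h3⟩ := CGLE.birmanSchwinger_spec hDβ hψ.1.continuous hC.le ha hdec
    (CGLE.isFredholmAt_of_notMem_essentialSpectrum hl)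
  exact ⟨h1, h2, h3.trans (CGLE.detTwo_eq_zero_iff h2).symm⟩
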